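/- An $\ell$-group is a Hausdorff, locally compact, totally disconnected topological group; it is an $\ell_c$-group if every element lies in a compact open subgroup and any two compact open subgroups are contained in a third. A complex representation of an $\ell$-group is smooth if every vector has an open stabilizer, and a smooth representation is admissible if the vectors fixed by any given compact open subgroup form a finite-dimensional space; an $\ell$-group is tame if all its irreducible smooth complex representations are admissible. Let $\widehat G$ denote the set of isomorphism classes of irreducible smooth complex representations of an $\ell$-group $G$. For $(\pi,V)\in\widehat G$, vectors $v_1,\dots,v_n\in V$, functionals $\xi_1,\dots,\xi_n$ in the smooth dual $V^\vee$ (the functionals in $V^*$ with open stabilizer), a compact set $B\subset G$ and $\varepsilon>0$, let $\mathscr U(\pi,v_j,\xi_j,B,\varepsilon)$ be the set of all $(\sigma,W)\in\widehat G$ for which there are $w_1,\dots,w_n\in W$ and $\zeta_1,\dots,\zeta_n\in W^\vee$ with $|\langle\xi_j,\pi(g)v_j\rangle-\langle\zeta_j,\sigma(g)w_j\rangle|<\varepsilon$ for all $j$ and all $g\in B$. The Fell topology on $\widehat G$ is the topology generated by these sets. Let $G$ be a tame $\ell_c$-group, $K\subset G$ a compact open subgroup and $(\rho,W)$ an irreducible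 smooth complex representation of $K$. Put $\mathscr V(K,\rho)=\{\pi\in\widehat G : \mathrm{Hom}_K(\pi|_K,\rho)\neq 0\}$ with the subspace topology of the Fell topology. Let $A=\mathcal H(G,\rho)$ be the unital convolution algebra of locally constant compactly supported functions $f:G\to\mathrm{End}_{\mathbb C}(W^\vee)$ with $f(k_1gk_2)=\rho^\vee(k_1)f(g)\rho^\vee(k_2)$ for $k_1,k_2\in K$, $g\in G$; convolution is taken with respect to the left Haar measure for which $K$ has measure $1$. For an irreducible smooth representation $\pi$ of $G$, the space $\widetilde\pi=\mathrm{Hom}_K(\rho,\pi|_K)$ of $\rho$-invariants is a left $A$-module by $$(f\cdot\varphi)(w)=\int_G \pi(g)\,\varphi\big(f(g)^{t}w\big)\,dg,$$ where $f(g)^t\in\mathrm{End}_{\mathbb C}(W)$ is the transpose of $f(g)$. Let $\widehat A$ be the set of left primitive ideals of $A$ (annihilators of simple left $A$-modules) with the Jacobson (hull-kernel) topology, in which the closure of $S\subset\widehat A$ is $\{P\in\widehat A : \bigcap_{I\in S}I\subset P\}$. Then for every $\pi\in\mathscr V(K,\rho)$ the $A$-module $\widetilde\pi$ is simple, and $\pi\mapsto\mathrm{Ann}_A(\widetilde\pi)$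 is a well-defined bijection from $\mathscr V(K,\rho)$ onto $\widehat A$, which is a homeomorphism. -/

import Mathlib

universe u v

set_option linter.unusedSectionVars false

noncomputable section

namespace EllGroup

/-! ### Smooth representations of locally profinite groups -/

section Smooth

variable {G : Type u} [Group G] [TopologicalSpace G] {V : Type v} [AddCommGroup V] [Module ℂ V]

/-- A vector of a complex representation is smooth if its stabilizer is open. -/
def IsSmoothVector (π : Representation ℂ G V) (v : V) : Prop :=
  IsOpen {g : G | π g v = v}

/-- A complex representation is smooth if every vector has an open stabilizer. -/
def IsSmooth (π : Representation ℂ G V) : Prop :=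
  ∀ v, IsSmoothVector π v

/-- The restriction of a representation to a subgroup. -/
abbrev restrict (π : Representation ℂ G V) (K : Subgroup G) : Representation ℂ K V :=
  π.comp K.subtype

/-- A smooth representation is admissible if the fixed vectors of every compact open subgroup form
a finite-dimensional space. -/
def IsAdmissible (π : Representation ℂ G V) : Prop :=
  IsSmooth π ∧ ∀ K : Subgroup G, IsOpen (K : Set G) → IsCompact (K : Set G) →
    FiniteDimensional ℂ (restrict π K).invariants

end Smooth

/-- An irreducible smooth complex representation of `G`.  Such a representation is a quotient of the
group algebra `ℂ[G]`, so up to isomorphism its space lives in the universe of `G`. -/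
structure SmoothIrrep (G : Type u) [Group G] [TopologicalSpace G] where
  V : Type u
  [addCommGroup : AddCommGroup V]
  [module : Module ℂ V]
  rep : Representation ℂ G V
  smooth : IsSmooth rep
  irreducible : rep.IsIrreducible

attribute [instance] SmoothIrrep.addCommGroup SmoothIrrep.module

/-- Every element of `G` lies in a compact open subgroup, and any two compact open subgroups are
contained in a third. -/
def IsEllCGroup (G : Type u) [Group G] [TopologicalSpace G] : Prop :=
  (∀ g : G, ∃ K : Subgroup G, IsOpen (K : Set G) ∧ IsCompact (K : Set G) ∧ g ∈ K) ∧
  ∀ K L : Subgroup G, IsOpen (K : Set G) → IsCompact (K : Set G) →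
    IsOpen (L : Set G) → IsCompact (L : Set G) →
    ∃ M : Subgroup G, IsOpen (M : Set G) ∧ IsCompact (M : Set G) ∧ K ≤ M ∧ L ≤ M

/-- `G` is tame if all its irreducible smooth representations are admissible. -/
def IsTame (G : Type u) [Group G] [TopologicalSpace G] : Prop :=
  ∀ π : SmoothIrrep G, IsAdmissible π.rep

/-- A compact open subgroup of `G`. -/
structure CompactOpenSubgroup (G : Type u) [Group G] [TopologicalSpace G] extends Subgroup G where
  isOpen : IsOpen (toSubgroup : Set G)
  isCompact : IsCompact (toSubgroup : Set G)

/-! ### The smooth dual space and its Fell topology -/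

section Dual

variable (G : Type u) [Group G] [TopologicalSpace G]

/-- Isomorphism of irreducible smooth representations. -/
instance smoothIrrepSetoid : Setoid (SmoothIrrep G) where
  r π σ := Nonempty (π.rep.Equiv σ.rep)
  iseqv := ⟨fun _ => ⟨.refl _⟩, fun ⟨e⟩ => ⟨e.symm⟩, fun ⟨e⟩ ⟨f⟩ => ⟨e.trans f⟩⟩

/-- The smooth dual space of `G`: isomorphism classes of irreducible smooth representations. -/
def SmoothDualSpace : Type (u + 1) := Quotient (smoothIrrepSetoid G)

variable {G}

/-- The isomorphism class of an irreducible smooth representation. -/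
def SmoothIrrep.toClass (π : SmoothIrrep G) : SmoothDualSpace G := Quotient.mk _ π

/-- The Fell neighbourhood attached to `π`, vectors `v j`, functionals `ξ j`, a set `B` and `ε`: all
classes of `σ` having vectors `w j` and smooth functionals `ζ j` with
`|⟨ξ j, π(g) (v j)⟩ - ⟨ζ j, σ(g) (w j)⟩| < ε` for all `j` and all `g ∈ B`. -/
def fellNhd (π : SmoothIrrep G) {n : ℕ} (v : Fin n → π.V) (ξ : Fin n → Module.Dual ℂ π.V)
    (B : Set G) (ε : ℝ) : Set (SmoothDualSpace G) :=
  {x | ∃ σ : SmoothIrrep G, σ.toClass = x ∧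
    ∃ (w : Fin n → σ.V) (ζ : Fin n → Module.Dual ℂ σ.V),
      (∀ j, IsSmoothVector σ.rep.dual (ζ j)) ∧
      ∀ j, ∀ g ∈ B, ‖ξ j (π.rep g (v j)) - ζ j (σ.rep g (w j))‖ < ε}

/-- The Fell topology, generated by the sets `fellNhd π v ξ B ε` with `ξ` in the smooth dual of `π`,
`B` compact and `ε > 0`. -/
instance fellTopology : TopologicalSpace (SmoothDualSpace G) :=
  TopologicalSpace.generateFrom
    {U | ∃ (π : SmoothIrrep G) (n : ℕ) (v : Fin n → π.V) (ξ : Fin n → Module.Dual ℂ π.V)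
      (B : Set G) (ε : ℝ), (∀ j, IsSmoothVector π.rep.dual (ξ j)) ∧ IsCompact B ∧ 0 < ε ∧
      U = fellNhd π v ξ B ε}

/-- The classes `π` in the smooth dual space of `G` with `Hom_K(π|_K, ρ) ≠ 0`. -/
def fellBasic (K : CompactOpenSubgroup G) (ρ : SmoothIrrep K.toSubgroup) :
    Set (SmoothDualSpace G) :=
  {x | ∃ π : SmoothIrrep G, π.toClass = x ∧
    ∃ φ : (restrict π.rep K.toSubgroup).IntertwiningMap ρ.rep, φ ≠ 0}

end Dual

/-! ### The primitive spectrum of a ring -/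

section Primitive

variable (A : Type u) [Ring A]

/-- The left primitive ideals of a ring: the annihilators of simple left modules.  (A simple module
is a quotient of `A`, so the universe of `A` suffices.) -/
def PrimitiveSpectrum : Type u :=
  {I : Ideal A // ∃ (M : Type u) (_ : AddCommGroup M) (_ : Module A M),
    IsSimpleModule A M ∧ I = Module.annihilator A M}

variable {A}

/-- The kernel of a set of primitive ideals, i.e. their intersection. -/
def primitiveKernel (S : Set (PrimitiveSpectrum A)) : Ideal A := ⨅ I ∈ S, I.1

theorem mem_primitiveKernel {S : Set (PrimitiveSpectrum A)} {a : A} :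
    a ∈ primitiveKernel S ↔ ∀ I ∈ S, a ∈ I.1 := by
  simp [primitiveKernel]

theorem primitiveKernel_anti {S T : Set (PrimitiveSpectrum A)} (h : S ⊆ T) :
    primitiveKernel T ≤ primitiveKernel S := fun _ ha =>
  mem_primitiveKernel.2 fun I hI => mem_primitiveKernel.1 ha I (h hI)

theorem primitive_union {S T : Set (PrimitiveSpectrum A)} {P : PrimitiveSpectrum A}
    (h : primitiveKernel (S ∪ T) ≤ P.1) :
    primitiveKernel S ≤ P.1 ∨ primitiveKernel T ≤ P.1 := by
  by_contra! hc
  obtain ⟨h1, h2⟩ := hc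
  obtain ⟨a, ha, haP⟩ := SetLike.not_le_iff_exists.1 h1
  obtain ⟨b, hb, hbP⟩ := SetLike.not_le_iff_exists.1 h2
  obtain ⟨P, M, _, _, hM, rfl⟩ := P
  simp only [Module.mem_annihilator, not_forall] at haP hbP
  obtain ⟨m, hm⟩ := haP
  obtain ⟨n, hn⟩ := hbP
  obtain ⟨c, hc⟩ := Submodule.mem_span_singleton.1
    ((IsSimpleModule.span_singleton_eq_top A hm).symm ▸ Submodule.mem_top : n ∈ Submodule.span A {a • m})
  have key : b * (c * a) ∈ primitiveKernel (S ∪ T) := by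
    refine mem_primitiveKernel.2 fun I hI => ?_
    rcases hI with hI | hI
    · exact I.1.mul_mem_left _ (I.1.mul_mem_left _ (mem_primitiveKernel.1 ha I hI))
    · have hbI := mem_primitiveKernel.1 hb I hI
      obtain ⟨I, N, _, _, hN, rfl⟩ := I
      simp only [Module.mem_annihilator] at hbI ⊢
      intro x
      rw [mul_smul, hbI]
  have := Module.mem_annihilator.1 (h key) m
  rw [mul_smul, mul_smul, hc] at this
  exact hn this

theorem primitive_empty (P : PrimitiveSpectrum A) :
    ¬ primitiveKernel (∅ : Set (PrimitiveSpectrum A)) ≤ P.1 := by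
  obtain ⟨P, M, _, _, hM, rfl⟩ := P
  intro h
  have h1 : (1 : A) ∈ Module.annihilator A M := h (mem_primitiveKernel.2 (by simp))
  have := IsSimpleModule.nontrivial A M
  obtain ⟨m, hm⟩ := exists_ne (0 : M)
  exact hm (by simpa using Module.mem_annihilator.1 h1 m)

/-- The Jacobson (hull-kernel) topology: a set `S` of primitive ideals is closed if it contains all
primitive ideals that contain the kernel of `S`. -/
instance jacobsonTopology : TopologicalSpace (PrimitiveSpectrum A) :=
  TopologicalSpace.ofClosed {S | ∀ P : PrimitiveSpectrum A, primitiveKernel S ≤ P.1 → P ∈ S}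
    (fun P hP => (primitive_empty P hP).elim)
    (fun _ h𝒮 P hP => Set.mem_sInter.2 fun _ hS =>
      h𝒮 hS P ((primitiveKernel_anti (Set.sInter_subset_of_mem hS)).trans hP))
    (fun _ hS _ hT P hP => (primitive_union hP).imp (hS P) (hT P))

theorem isClosed_primitive_iff {S : Set (PrimitiveSpectrum A)} :
    IsClosed S ↔ ∀ P : PrimitiveSpectrum A, primitiveKernel S ≤ P.1 → P ∈ S := by
  rw [← isOpen_compl_iff]
  change Sᶜᶜ ∈ {S | ∀ P : PrimitiveSpectrum A, primitiveKernel S ≤ P.1 → P ∈ S} ↔ _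
  rw [compl_compl]; rfl

/-- The closure of `S` consists of the primitive ideals containing the kernel of `S`. -/
theorem closure_primitive (S : Set (PrimitiveSpectrum A)) :
    closure S = {P | primitiveKernel S ≤ P.1} := by
  apply subset_antisymm
  · refine closure_minimal (fun P hP a ha => mem_primitiveKernel.1 ha P hP) ?_
    refine isClosed_primitive_iff.2 fun P hP => le_trans (fun a ha => ?_) hP
    exact mem_primitiveKernel.2 fun I hI => hI ha
  · intro P hP
    exact isClosed_primitive_iff.1 isClosed_closure P ((primitiveKernel_anti subset_closure).trans hP)

end Primitive

/-! ### Sums over left cosets -/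

section CosetSum

variable {G : Type u} [Group G] (K : Subgroup G) {M N : Type*} [AddCommMonoid M] [AddCommMonoid N]

/-- The sum of `F` over representatives of the left cosets `gK`.  For `F` constant on left cosets of
a compact open `K`, and vanishing off a compact set, this is the integral of `F` against the left
Haar measure of `G` for which `K` has measure `1`. -/
def cosetSum (F : G → M) : M := ∑ᶠ q : G ⧸ K, F q.out

variable {K}

theorem cosetSum_translate {F : G → M} (hF : ∀ g, ∀ k ∈ K, F (g * k) = F g) (x : G) :
    cosetSum K (fun g => F (x * g)) = cosetSum K F := by
  have h : ∀ g : G, F ((g : G ⧸ K).out) = F g := fun g => by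
    obtain ⟨k, hk⟩ := QuotientGroup.mk_out_eq_mul K g
    rw [hk, hF _ _ k.2]
  unfold cosetSum
  rw [← finsum_comp_equiv (MulAction.toPerm x : Equiv.Perm (G ⧸ K)) (f := fun q => F q.out)]
  refine finsum_congr fun q => ?_
  simp only [MulAction.toPerm_apply]
  rw [← h (x * q.out)]
  congr 2
  conv_rhs => rw [← QuotientGroup.out_eq' q]
  rfl

/-- Finiteness of the set of representatives at which `F` does not vanish. -/
def CosetFinite (K : Subgroup G) (F : G → M) : Prop :=
  (fun q : G ⧸ K => F q.out).support.Finite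

theorem cosetFinite_of_compact [TopologicalSpace G] [IsTopologicalGroup G]
    (hK : IsOpen (K : Set G)) {F : G → M}
    {C : Set G} (hC : IsCompact C) (hF : ∀ g, F g ≠ 0 → g ∈ C) : CosetFinite K F := by
  have : DiscreteTopology (G ⧸ K) := QuotientGroup.discreteTopology hK
  have h1 : ((↑) '' C : Set (G ⧸ K)).Finite :=
    (hC.image (QuotientGroup.continuous_mk (N := K))).finite_of_discrete
  refine h1.subset fun q hq => ⟨q.out, hF _ hq, QuotientGroup.out_eq' q⟩

theorem cosetSum_map {F : G → M} (hF : CosetFinite K F) (φ : M →+ N) :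
    φ (cosetSum K F) = cosetSum K (fun g => φ (F g)) :=
  φ.map_finsum hF

theorem cosetSum_add {F F' : G → M} (hF : CosetFinite K F) (hF' : CosetFinite K F') :
    cosetSum K (fun g => F g + F' g) = cosetSum K F + cosetSum K F' :=
  finsum_add_distrib hF hF'

theorem cosetSum_comm {F : G → G → M} (hF : CosetFinite K F)
    (hF' : ∀ x, CosetFinite K (F x)) :
    cosetSum K (fun x => cosetSum K (F x)) = cosetSum K (fun y => cosetSum K (fun x => F x y)) := by
  classical
  set A := hF.toFinset
  set B := A.biUnion fun q => (hF' q.out).toFinset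
  have hA : ∀ q, q ∉ A → F q.out = 0 := fun q hq => by
    by_contra h; exact hq (hF.mem_toFinset.2 h)
  have hB : ∀ q r : G ⧸ K, r ∉ B → F q.out r.out = 0 := fun q r hr => by
    by_contra h
    refine hr (Finset.mem_biUnion.2 ⟨q, ?_, (hF' q.out).mem_toFinset.2 h⟩)
    by_contra hq
    exact h (by rw [hA q hq]; rfl)
  unfold cosetSum
  rw [finsum_eq_sum_of_support_subset (s := A), finsum_eq_sum_of_support_subset (s := B)]
  · calc _ = ∑ q ∈ A, ∑ r ∈ B, F q.out r.out := Finset.sum_congr rfl fun q _ =>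
          finsum_eq_sum_of_support_subset _ fun r hr => by
            by_contra h; exact hr (hB q r h)
      _ = _ := Finset.sum_comm
      _ = _ := Finset.sum_congr rfl fun r _ => (finsum_eq_sum_of_support_subset _ fun q hq => by
            by_contra h; exact hq (by simp [hA q h])).symm
  · intro r hr
    by_contra h
    exact hr (by simp [hB _ r h])
  · intro q hq
    by_contra h
    exact hq (by simp [hA q h])

/-- The sum over left cosets is the integral against the left Haar measure giving `K` measure `1`. -/
theorem cosetSum_eq_integral [TopologicalSpace G] [IsTopologicalGroup G] [MeasurableSpace G]
    [BorelSpace G] (hK : IsOpen (K : Set G)) (μ : MeasureTheory.Measure G) [μ.IsMulLeftInvariant]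
    (hμ : μ (K : Set G) = 1) {F : G → ℂ} (hF : ∀ g, ∀ k ∈ K, F (g * k) = F g)
    (hfin : CosetFinite K F) : cosetSum K F = ∫ g, F g ∂μ := by
  classical
  have h : ∀ g : G, F ((g : G ⧸ K).out) = F g := fun g => by
    obtain ⟨k, hk⟩ := QuotientGroup.mk_out_eq_mul K g
    rw [hk, hF _ _ k.2]
  let C : G ⧸ K → Set G := fun q => (fun x => q.out⁻¹ * x) ⁻¹' (K : Set G)
  have hC : ∀ (q : G ⧸ K) (g : G), g ∈ C q ↔ q = (g : G ⧸ K) := fun q g => by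
    conv_rhs => rw [← QuotientGroup.out_eq' q]
    exact QuotientGroup.eq.symm
  have hCm : ∀ q, MeasurableSet (C q) := fun q =>
    (hK.preimage (continuous_const_mul _)).measurableSet
  have hCμ : ∀ q, μ (C q) = 1 := fun q => by
    rw [MeasureTheory.measure_preimage_mul, hμ]
  have hsum : F = fun g => ∑ q ∈ hfin.toFinset, (C q).indicator (fun _ => F q.out) g := by
    funext g
    rw [Finset.sum_eq_single (g : G ⧸ K)]
    · rw [Set.indicator_of_mem ((hC _ _).2 rfl), h]
    · intro q _ hq
      exact Set.indicator_of_notMem (fun hm => hq ((hC _ _).1 hm)) _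
    · intro hg
      have : F ((g : G ⧸ K).out) = 0 := by
        by_contra h0
        exact hg (hfin.mem_toFinset.2 h0)
      simp [this]
  conv_rhs => rw [hsum]
  rw [MeasureTheory.integral_finsetSum]
  · rw [cosetSum, finsum_eq_sum_of_support_subset (s := hfin.toFinset)]
    · refine Finset.sum_congr rfl fun q _ => ?_
      rw [MeasureTheory.integral_indicator_const _ (hCm q), MeasureTheory.Measure.real, hCμ]
      simp
    · intro q hq
      exact hfin.mem_toFinset.2 hq
  · intro q _
    exact (MeasureTheory.integrable_indicator_iff (hCm q)).2
      (MeasureTheory.integrableOn_const (by rw [hCμ]; simp))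

end CosetSum

/-! ### Irreducible smooth representations of compact groups -/

section Compact

variable {G : Type u} [Group G] [TopologicalSpace G] [IsTopologicalGroup G]
  (K : CompactOpenSubgroup G) (ρ : SmoothIrrep K.toSubgroup)

instance finiteDimensional_of_compact : FiniteDimensional ℂ ρ.V := by
  have : CompactSpace K.toSubgroup := isCompact_iff_compactSpace.1 K.isCompact
  have hs := ρ.irreducible
  have hnt : Nontrivial ρ.V := by
    by_contra h
    rw [not_nontrivial_iff_subsingleton] at h
    obtain ⟨a, b, hab⟩ := (inferInstance : Nontrivial (Subrepresentation ρ.rep))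
    exact hab (Subrepresentation.toSubmodule_injective (Subsingleton.elim _ _))
  obtain ⟨w, hw⟩ := exists_ne (0 : ρ.V)
  have hfin : (Set.range fun k : K.toSubgroup => ρ.rep k w).Finite := by
    have hlc : IsLocallyConstant fun k : K.toSubgroup => ρ.rep k w := by
      refine (IsLocallyConstant.iff_exists_open _).2 fun k => ?_
      refine ⟨(fun x => k⁻¹ * x) ⁻¹' {g | ρ.rep g w = w},
        (ρ.smooth w).preimage (continuous_const_mul _), by simp, fun x hx => ?_⟩
      have hx : ρ.rep (k⁻¹ * x) w = w := hx
      conv_rhs => rw [← hx]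
      rw [← Module.End.mul_apply, ← map_mul, mul_inv_cancel_left]
    exact hlc.range_finite
  let S : Subrepresentation ρ.rep :=
    ⟨Submodule.span ℂ (Set.range fun k : K.toSubgroup => ρ.rep k w), fun g v hv => by
      induction hv using Submodule.span_induction with
      | mem x hx =>
        obtain ⟨k, rfl⟩ := hx
        refine Submodule.subset_span ⟨g * k, by simp⟩
      | zero => simp
      | add x y _ _ hx hy => rw [map_add]; exact add_mem hx hy
      | smul a x _ hx => rw [map_smul]; exact Submodule.smul_mem _ _ hx⟩
  have hwS : w ∈ S.toSubmodule := Submodule.subset_span ⟨1, by simp⟩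
  rcases eq_bot_or_eq_top S with h | h
  · rw [h] at hwS
    exact (hw hwS).elim
  · have h2 : S.toSubmodule = ⊤ := by rw [h]; rfl
    exact ⟨h2 ▸ Submodule.fg_span hfin⟩

theorem isOpen_ker_rep : IsOpen {k : K.toSubgroup | ρ.rep k = 1} := by
  let b := Module.finBasis ℂ ρ.V
  have : {k : K.toSubgroup | ρ.rep k = 1} = ⋂ i, {k | ρ.rep k (b i) = b i} := by
    ext k
    simp only [Set.mem_ofPred_eq, Set.mem_iInter]
    exact ⟨fun h i => by rw [h]; rfl, fun h => b.ext h⟩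
  rw [this]
  exact isOpen_iInter_of_finite fun i => ρ.smooth _

/-- All functionals on `ρ` are smooth, so the smooth dual of `ρ` is the full linear dual. -/
theorem isSmooth_dual : IsSmooth ρ.rep.dual := by
  have hsub : ∀ (k x : K.toSubgroup), ρ.rep (k⁻¹ * x) = 1 → ρ.rep.dual x = ρ.rep.dual k := by
    intro k x h
    have h1 : ρ.rep x = ρ.rep k := by
      rw [← mul_inv_cancel_left k x, map_mul, h, mul_one]
    have h2 : ρ.rep x⁻¹ = ρ.rep k⁻¹ := by
      have e1 : ρ.rep x⁻¹ * ρ.rep x = 1 := by rw [← map_mul]; simp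
      have e2 : ρ.rep k * ρ.rep k⁻¹ = 1 := by rw [← map_mul]; simp
      calc _ = ρ.rep x⁻¹ * (ρ.rep k * ρ.rep k⁻¹) := by rw [e2, mul_one]
        _ = _ := by rw [← mul_assoc, ← h1, e1, one_mul]
    ext ξ w
    simp [Representation.dual_apply, h2]
  intro ξ
  refine isOpen_iff_mem_nhds.2 fun k hk => ?_
  refine Filter.mem_of_superset
    (((isOpen_ker_rep K ρ).preimage (continuous_const_mul k⁻¹)).mem_nhds
      (by change ρ.rep (k⁻¹ * k) = 1; rw [inv_mul_cancel, map_one])) fun x hx => ?_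
  change ρ.rep.dual x ξ = ξ
  rw [hsub k x hx]; exact hk

end Compact

/-! ### The Hecke algebra -/

section Hecke

variable {G : Type u} [Group G] [TopologicalSpace G] [IsTopologicalGroup G]
  (K : CompactOpenSubgroup G) (ρ : SmoothIrrep K.toSubgroup)

/-- The endomorphisms of the dual space of `ρ`. -/
abbrev DualEnd : Type u := Module.End ℂ (Module.Dual ℂ ρ.V)

/-- The locally constant compactly supported functions `f : G → End(W^∨)` such that
`f (k₁ g k₂) = ρ^∨(k₁) f(g) ρ^∨(k₂)`, where `W` is the space of `ρ`. -/
def heckeSubmodule : Submodule ℂ (G → DualEnd K ρ) where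
  carrier := {f | IsLocallyConstant f ∧ HasCompactSupport f ∧
    ∀ (k₁ k₂ : K.toSubgroup) (g : G), f (k₁ * g * k₂) = ρ.rep.dual k₁ * f g * ρ.rep.dual k₂}
  zero_mem' := ⟨IsLocallyConstant.const 0, HasCompactSupport.zero, by simp⟩
  add_mem' := fun {f h} hf hh => ⟨hf.1.comp₂ hh.1 (· + ·), hf.2.1.add hh.2.1, fun k₁ k₂ g => by
    simp only [Pi.add_apply, hf.2.2, hh.2.2, mul_add, add_mul]⟩
  smul_mem' := fun c f hf => ⟨hf.1.comp (c • ·), hf.2.1.comp_left (smul_zero c), fun k₁ k₂ g => by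
    simp only [Pi.smul_apply, hf.2.2, mul_smul_comm, smul_mul_assoc]⟩

/-- The Hecke algebra of `G` with respect to `(K, ρ)`. -/
def HeckeAlgebra : Type u := heckeSubmodule K ρ

namespace HeckeAlgebra

variable {K ρ}

instance : AddCommGroup (HeckeAlgebra K ρ) := inferInstanceAs (AddCommGroup (heckeSubmodule K ρ))
instance : Module ℂ (HeckeAlgebra K ρ) := inferInstanceAs (Module ℂ (heckeSubmodule K ρ))
instance : FunLike (HeckeAlgebra K ρ) G (DualEnd K ρ) := ⟨fun f => f.1, Subtype.val_injective⟩

@[ext] theorem ext {f h : HeckeAlgebra K ρ} (H : ∀ g, f g = h g) : f = h :=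
  DFunLike.ext f h H

@[simp] theorem add_apply (f h : HeckeAlgebra K ρ) (g : G) : (f + h) g = f g + h g := rfl
@[simp] theorem smul_apply (c : ℂ) (f : HeckeAlgebra K ρ) (g : G) : (c • f) g = c • f g := rfl
@[simp] theorem zero_apply (g : G) : (0 : HeckeAlgebra K ρ) g = 0 := rfl

theorem locConst (f : HeckeAlgebra K ρ) : IsLocallyConstant f := f.2.1

theorem map_left (f : HeckeAlgebra K ρ) (k : K.toSubgroup) (g : G) :
    f (k * g) = ρ.rep.dual k * f g := by
  have := f.2.2.2 k 1 g
  rwa [map_one, mul_one, OneMemClass.coe_one, mul_one] at this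

theorem map_right (f : HeckeAlgebra K ρ) (k : K.toSubgroup) (g : G) :
    f (g * k) = f g * ρ.rep.dual k := by
  have := f.2.2.2 1 k g
  rwa [map_one, one_mul, OneMemClass.coe_one, one_mul] at this

theorem cosetFinite {M : Type*} [AddCommMonoid M] (f : HeckeAlgebra K ρ) {F : G → M}
    (hF : ∀ g, f g = 0 → F g = 0) : CosetFinite K.toSubgroup F :=
  cosetFinite_of_compact K.isOpen f.2.2.1 fun g hg =>
    subset_tsupport _ fun h => hg (hF g h)

theorem cosetFinite' {M : Type*} [AddCommMonoid M] (f : HeckeAlgebra K ρ) (x : G) {F : G → M}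
    (hF : ∀ g, f (x * g) = 0 → F g = 0) : CosetFinite K.toSubgroup F :=
  cosetFinite_of_compact K.isOpen (f.2.2.1.image (continuous_const_mul x⁻¹)) fun g hg =>
    ⟨x * g, subset_tsupport _ fun h => hg (hF g h), by simp⟩

/-- Convolution `(f * h)(g) = ∫ f(x) h(x⁻¹ g) dx`, for the Haar measure giving `K` measure `1`; the
integrand is constant on each left coset `xK`. -/
def conv (f h : HeckeAlgebra K ρ) (g : G) : DualEnd K ρ :=
  cosetSum K.toSubgroup fun x => f x * h (x⁻¹ * g)

theorem conv_rightInv (f h : HeckeAlgebra K ρ) (g x : G) (k : G) (hk : k ∈ K.toSubgroup) :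
    f (x * k) * h ((x * k)⁻¹ * g) = f x * h (x⁻¹ * g) := by
  have h1 := f.map_right ⟨k, hk⟩ x
  have h2 := h.map_left ⟨k, hk⟩⁻¹ (x⁻¹ * g)
  simp only [InvMemClass.coe_inv] at h1 h2
  rw [h1, mul_inv_rev, mul_assoc k⁻¹, h2, mul_assoc (f x), ← mul_assoc (ρ.rep.dual _), ← map_mul,
    mul_inv_cancel, map_one, one_mul]

theorem cosetFinite_conv (f h : HeckeAlgebra K ρ) (g : G) :
    CosetFinite K.toSubgroup fun x => f x * h (x⁻¹ * g) :=
  f.cosetFinite fun x hx => by rw [hx, zero_mul]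

theorem conv_mem (f h : HeckeAlgebra K ρ) : conv f h ∈ heckeSubmodule K ρ := by
  refine ⟨?_, ?_, fun k₁ k₂ g => ?_⟩
  · set A := (f.cosetFinite (F := f) fun _ h => h).toFinset with hA
    have : conv f h = fun g => ∑ q ∈ A, f q.out * h (q.out⁻¹ * g) := by
      funext g
      refine finsum_eq_sum_of_support_subset _ fun q hq => ?_
      exact (Set.Finite.mem_toFinset _).2 (left_ne_zero_of_mul hq)
    rw [this]
    clear_value A
    clear this hA
    classical
    induction A using Finset.induction with
    | empty => exact IsLocallyConstant.const (0 : DualEnd K ρ)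
    | insert a s ha ih =>
      simp only [Finset.sum_insert ha]
      exact ((h.locConst.comp_continuous (continuous_const_mul _)).comp
        (fun T => f a.out * T)).comp₂ ih (· + ·)
  · refine HasCompactSupport.of_support_subset_isCompact (f.2.2.1.mul h.2.2.1) fun g hg => ?_
    have : ∃ q : G ⧸ K.toSubgroup, f q.out * h (q.out⁻¹ * g) ≠ 0 := by
      by_contra! H
      exact hg (by simp [conv, cosetSum, H])
    obtain ⟨q, hq⟩ := this
    exact ⟨q.out, subset_tsupport _ (left_ne_zero_of_mul hq), q.out⁻¹ * g,
      subset_tsupport _ (right_ne_zero_of_mul hq), by simp⟩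
  · have h1 := cosetSum_translate (K := K.toSubgroup)
      (F := fun x => f x * h (x⁻¹ * (k₁ * g * k₂)))
      (fun x k hk => conv_rightInv f h _ x k hk) (k₁ : G)
    unfold conv
    rw [← h1, mul_assoc (ρ.rep.dual k₁) (cosetSum _ _)]
    have h2 := cosetSum_map (cosetFinite_conv f h g)
      ((AddMonoidHom.mulLeft (ρ.rep.dual k₁)).comp (AddMonoidHom.mulRight (ρ.rep.dual k₂)))
    simp only [AddMonoidHom.coe_comp, Function.comp_apply, AddMonoidHom.coe_mulLeft,
      AddMonoidHom.mulRight_apply] at h2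
    rw [h2]
    congr 1
    funext x
    have e : (↑k₁ * x)⁻¹ * (↑k₁ * g * ↑k₂) = x⁻¹ * g * k₂ := by group
    rw [e, map_left, map_right]
    simp only [mul_assoc]

instance : Mul (HeckeAlgebra K ρ) := ⟨fun f h => ⟨conv f h, conv_mem f h⟩⟩

theorem mul_apply (f h : HeckeAlgebra K ρ) (g : G) :
    (f * h) g = cosetSum K.toSubgroup fun x => f x * h (x⁻¹ * g) := rfl

open Classical in
/-- The unit of the Hecke algebra: `ρ^∨` on `K`, extended by zero. -/
def unitFun (g : G) : DualEnd K ρ :=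
  if hg : g ∈ K.toSubgroup then ρ.rep.dual ⟨g, hg⟩ else 0

theorem unitFun_coe (k : K.toSubgroup) : unitFun (ρ := ρ) (k : G) = ρ.rep.dual k := by
  simp [unitFun]

theorem unitFun_of_notMem {g : G} (hg : g ∉ K.toSubgroup) : unitFun (ρ := ρ) g = 0 := by
  simp [unitFun, hg]

theorem unitFun_mem : unitFun ∈ heckeSubmodule K ρ := by
  have hmul : ∀ (k₁ k₂ : K.toSubgroup) (g : G),
      unitFun (ρ := ρ) (k₁ * g * k₂) = ρ.rep.dual k₁ * unitFun g * ρ.rep.dual k₂ := by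
    intro k₁ k₂ g
    by_cases hg : g ∈ K.toSubgroup
    · lift g to K.toSubgroup using hg
      have := unitFun_coe (ρ := ρ) (k₁ * g * k₂)
      simp only [Subgroup.coe_mul] at this
      rw [this, unitFun_coe, map_mul, map_mul]
    · rw [unitFun_of_notMem hg, unitFun_of_notMem]
      · simp
      · rwa [K.toSubgroup.mul_mem_cancel_right k₂.2, K.toSubgroup.mul_mem_cancel_left k₁.2]
  refine ⟨?_, ?_, hmul⟩
  · refine (IsLocallyConstant.iff_exists_open _).2 fun g => ?_
    refine ⟨(fun x => g⁻¹ * x) ⁻¹' ((↑) '' {k : K.toSubgroup | ρ.rep k⁻¹ = 1}), ?_, ?_, ?_⟩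
    · refine IsOpen.preimage (continuous_const_mul _) ?_
      exact K.isOpen.isOpenEmbedding_subtypeVal.isOpenMap _
        ((isOpen_ker_rep K ρ).preimage continuous_inv)
    · exact ⟨1, by simp, by simp⟩
    · rintro x ⟨k, hk, hkx⟩
      have hx : x = ((1 : K.toSubgroup) : G) * g * k := by
        simp only [hkx]; simp
      have hd : ρ.rep.dual k = 1 := by
        ext ξ w
        have hk : ρ.rep k⁻¹ = 1 := hk
        change ξ (ρ.rep k⁻¹ w) = ξ w
        rw [hk]; rfl
      rw [hx, hmul, hd, map_one, one_mul, mul_one]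
  · refine HasCompactSupport.of_support_subset_isCompact K.isCompact fun g hg => ?_
    by_contra h
    exact hg (unitFun_of_notMem h)

instance : One (HeckeAlgebra K ρ) := ⟨⟨unitFun, unitFun_mem⟩⟩

theorem one_coe (k : K.toSubgroup) : (1 : HeckeAlgebra K ρ) (k : G) = ρ.rep.dual k := unitFun_coe k

theorem one_of_notMem {g : G} (hg : g ∉ K.toSubgroup) : (1 : HeckeAlgebra K ρ) g = 0 :=
  unitFun_of_notMem hg

protected theorem mul_assoc' (f h l : HeckeAlgebra K ρ) : f * h * l = f * (h * l) := by
  ext1 g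
  simp only [mul_apply]
  calc _ = cosetSum K.toSubgroup fun y => cosetSum K.toSubgroup fun x =>
        f x * h (x⁻¹ * y) * l (y⁻¹ * g) := by
        congr 1; funext y
        exact cosetSum_map (cosetFinite_conv f h y) (AddMonoidHom.mulRight (l (y⁻¹ * g)))
    _ = cosetSum K.toSubgroup fun x => cosetSum K.toSubgroup fun y =>
        f x * h (x⁻¹ * y) * l (y⁻¹ * g) :=
        (cosetSum_comm (F := fun x y => f x * h (x⁻¹ * y) * l (y⁻¹ * g))
          (f.cosetFinite fun x hx => by funext y; simp [hx])
          fun x => h.cosetFinite' x⁻¹ fun y hy => by simp [hy]).symm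
    _ = _ := by
        congr 1; funext x
        rw [← cosetSum_translate (x := x)]
        · have := cosetSum_map (cosetFinite_conv h l (x⁻¹ * g)) (AddMonoidHom.mulLeft (f x))
          simp only [AddMonoidHom.coe_mulLeft] at this
          rw [this]
          congr 1; funext y
          simp [mul_assoc]
        · intro y k hk
          have h1 := h.map_right ⟨k, hk⟩ (x⁻¹ * y)
          have h2 := l.map_left ⟨k, hk⟩⁻¹ (y⁻¹ * g)
          simp only [InvMemClass.coe_inv] at h1 h2
          rw [← mul_assoc x⁻¹, h1, mul_inv_rev, mul_assoc k⁻¹, h2]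
          simp only [mul_assoc]
          rw [← mul_assoc (ρ.rep.dual _) (ρ.rep.dual _), ← map_mul,
            mul_inv_cancel, map_one, one_mul]

theorem cosetSum_eq_of_support {M : Type*} [AddCommMonoid M] {F : G → M}
    (hF : ∀ g, ∀ k ∈ K.toSubgroup, F (g * k) = F g) (x : G)
    (h0 : ∀ g, x⁻¹ * g ∉ K.toSubgroup → F g = 0) : cosetSum K.toSubgroup F = F x := by
  have h : F ((x : G ⧸ K.toSubgroup).out) = F x := by
    obtain ⟨k, hk⟩ := QuotientGroup.mk_out_eq_mul K.toSubgroup x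
    rw [hk, hF _ _ k.2]
  rw [← h]
  refine finsum_eq_single _ _ fun q hq => h0 _ fun hm => hq ?_
  rw [← QuotientGroup.out_eq' q]
  exact (QuotientGroup.eq.2 hm).symm

protected theorem one_mul' (f : HeckeAlgebra K ρ) : 1 * f = f := by
  ext1 g
  rw [mul_apply, cosetSum_eq_of_support (conv_rightInv 1 f g) 1]
  · have := one_coe (ρ := ρ) 1
    rw [OneMemClass.coe_one, map_one ρ.rep.dual] at this
    rw [this, one_mul, inv_one, one_mul]
  · intro x hx
    rw [one_of_notMem (by simpa using hx), zero_mul]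

protected theorem mul_one' (f : HeckeAlgebra K ρ) : f * 1 = f := by
  ext1 g
  rw [mul_apply, cosetSum_eq_of_support (conv_rightInv f 1 g) g]
  · have := one_coe (ρ := ρ) 1
    rw [OneMemClass.coe_one, map_one ρ.rep.dual] at this
    rw [inv_mul_cancel, this, mul_one]
  · intro x hx
    rw [one_of_notMem, mul_zero]
    rwa [← inv_mem_iff, mul_inv_rev, inv_inv]

instance : Ring (HeckeAlgebra K ρ) :=
  { (inferInstance : AddCommGroup (HeckeAlgebra K ρ)) with
    mul := (· * ·)
    one := 1
    mul_assoc := HeckeAlgebra.mul_assoc'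
    one_mul := HeckeAlgebra.one_mul'
    mul_one := HeckeAlgebra.mul_one'
    left_distrib := fun f h l => by
      ext1 g
      simp only [mul_apply, add_apply, mul_add]
      exact cosetSum_add (cosetFinite_conv f h g) (cosetFinite_conv f l g)
    right_distrib := fun f h l => by
      ext1 g
      simp only [mul_apply, add_apply, add_mul]
      exact cosetSum_add (cosetFinite_conv f l g) (cosetFinite_conv h l g)
    zero_mul := fun f => by
      ext1 g
      simp [mul_apply, cosetSum]
    mul_zero := fun f => by
      ext1 g
      simp [mul_apply, cosetSum] }

instance : Algebra ℂ (HeckeAlgebra K ρ) :=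
  Algebra.ofModule
    (fun c f h => by
      ext1 g
      have := cosetSum_map (cosetFinite_conv f h g) (DistribSMul.toAddMonoidHom (DualEnd K ρ) c)
      simp only [DistribSMul.toAddMonoidHom_apply] at this
      simp only [mul_apply, smul_apply, this, smul_mul_assoc])
    (fun c f h => by
      ext1 g
      have := cosetSum_map (cosetFinite_conv f h g) (DistribSMul.toAddMonoidHom (DualEnd K ρ) c)
      simp only [DistribSMul.toAddMonoidHom_apply] at this
      simp only [mul_apply, smul_apply, this, mul_smul_comm])

end HeckeAlgebra

/-! ### The module of `ρ`-invariants -/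

/-- The transpose of an endomorphism of `W^∨`, an endomorphism of `W` (which is finite-dimensional):
it is characterised by `ξ (Tᵗ w) = (T ξ) w`. -/
def transpose : DualEnd K ρ →ₗ[ℂ] Module.End ℂ ρ.V where
  toFun T := (Module.evalEquiv ℂ ρ.V).symm.toLinearMap ∘ₗ T.dualMap ∘ₗ
    (Module.evalEquiv ℂ ρ.V).toLinearMap
  map_add' S T := by ext w; simp [LinearMap.dualMap, map_add]
  map_smul' c T := by ext w; simp [LinearMap.dualMap]

variable {K ρ}

theorem dual_ext {w w' : ρ.V} (h : ∀ ξ : Module.Dual ℂ ρ.V, ξ w = ξ w') : w = w' :=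
  (Module.evalEquiv ℂ ρ.V).injective (LinearMap.ext fun ξ => by simpa using h ξ)

theorem apply_transpose (T : DualEnd K ρ) (ξ : Module.Dual ℂ ρ.V) (w : ρ.V) :
    ξ (transpose K ρ T w) = T ξ w := by
  simp [transpose]

theorem transpose_mul (S T : DualEnd K ρ) :
    transpose K ρ (S * T) = transpose K ρ T * transpose K ρ S := by
  refine LinearMap.ext fun w => dual_ext fun ξ => ?_
  simp [apply_transpose]

theorem transpose_dual (k : K.toSubgroup) : transpose K ρ (ρ.rep.dual k) = ρ.rep k⁻¹ := by
  refine LinearMap.ext fun w => dual_ext fun ξ => ?_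
  rw [apply_transpose]; rfl

variable (K ρ)

/-- The space `Hom_K(ρ, π|_K)` of `ρ`-invariants of `π`. -/
abbrev RhoInvariants (π : SmoothIrrep G) : Type u :=
  ρ.rep.IntertwiningMap (restrict π.rep K.toSubgroup)

namespace RhoInvariants

variable {K ρ} {π : SmoothIrrep G}

/-- The integrand of the action of `f` on `φ`. -/
def integrand (f : HeckeAlgebra K ρ) (φ : RhoInvariants K ρ π) (g : G) : ρ.V →ₗ[ℂ] π.V :=
  π.rep g ∘ₗ φ.toLinearMap ∘ₗ transpose K ρ (f g)

theorem integrand_finite (f : HeckeAlgebra K ρ) (φ : RhoInvariants K ρ π) :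
    CosetFinite K.toSubgroup (integrand f φ) :=
  f.cosetFinite fun g hg => by simp [integrand, hg]

theorem integrand_rightInv (f : HeckeAlgebra K ρ) (φ : RhoInvariants K ρ π) (g k : G)
    (hk : k ∈ K.toSubgroup) : integrand f φ (g * k) = integrand f φ g := by
  lift k to K.toSubgroup using hk
  ext w
  have h := Representation.IntertwiningMap.isIntertwining _ _ φ k (ρ.rep k⁻¹ (transpose K ρ (f g) w))
  have h2 : ρ.rep k (ρ.rep k⁻¹ (transpose K ρ (f g) w)) = transpose K ρ (f g) w := by
    rw [← Module.End.mul_apply, ← map_mul]; simp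
  rw [h2] at h
  simp only [integrand, HeckeAlgebra.map_right, transpose_mul, transpose_dual, map_mul,
    LinearMap.comp_apply, Module.End.mul_apply, Representation.IntertwiningMap.toLinearMap_apply]
  rw [h]
  rfl

theorem integrand_left (f : HeckeAlgebra K ρ) (φ : RhoInvariants K ρ π) (k : K.toSubgroup) (g : G) :
    integrand f φ (k * g) ∘ₗ ρ.rep k = π.rep k ∘ₗ integrand f φ g := by
  ext w
  simp only [integrand, HeckeAlgebra.map_left, transpose_mul, transpose_dual, map_mul,
    LinearMap.comp_apply, Module.End.mul_apply]
  rw [← Module.End.mul_apply (ρ.rep k⁻¹), ← map_mul]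
  simp

/-- The action of the Hecke algebra on `ρ`-invariants: `(f φ)(w) = ∫ π(g) φ(f(g)ᵗ w) dg`, for the
Haar measure giving `K` measure `1`; the integrand is constant on each left coset `gK`. -/
def act (f : HeckeAlgebra K ρ) (φ : RhoInvariants K ρ π) : RhoInvariants K ρ π where
  toLinearMap := cosetSum K.toSubgroup (integrand f φ)
  isIntertwining' k := by
    have h1 := cosetSum_map (integrand_finite f φ)
      (LinearMap.compRight ℂ (M := ρ.V) (π.rep (k : G))).toAddMonoidHom
    have h2 := cosetSum_map (integrand_finite f φ)
      (LinearMap.lcomp ℂ π.V (ρ.rep k)).toAddMonoidHom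
    change (LinearMap.lcomp ℂ π.V (ρ.rep k)).toAddMonoidHom (cosetSum K.toSubgroup (integrand f φ)) =
      (LinearMap.compRight ℂ (M := ρ.V) (π.rep (k : G))).toAddMonoidHom
        (cosetSum K.toSubgroup (integrand f φ))
    rw [h1, h2]
    change cosetSum K.toSubgroup (fun g => integrand f φ g ∘ₗ ρ.rep k) =
      cosetSum K.toSubgroup (fun g => π.rep k ∘ₗ integrand f φ g)
    rw [← cosetSum_translate (x := (k : G))]
    · simp only [integrand_left]
    · intro g l hl
      rw [integrand_rightInv f φ g l hl]

instance : SMul (HeckeAlgebra K ρ) (RhoInvariants K ρ π) := ⟨act⟩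

theorem smul_toLinearMap (f : HeckeAlgebra K ρ) (φ : RhoInvariants K ρ π) :
    (f • φ).toLinearMap =
      cosetSum K.toSubgroup fun g => π.rep g ∘ₗ φ.toLinearMap ∘ₗ transpose K ρ (f g) := rfl

theorem smul_toLinearMap' (f : HeckeAlgebra K ρ) (φ : RhoInvariants K ρ π) :
    (f • φ).toLinearMap = cosetSum K.toSubgroup (integrand f φ) := rfl

protected theorem one_smul' (φ : RhoInvariants K ρ π) : (1 : HeckeAlgebra K ρ) • φ = φ := by
  apply Representation.IntertwiningMap.ext
  rw [smul_toLinearMap', HeckeAlgebra.cosetSum_eq_of_support (integrand_rightInv 1 φ) 1]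
  · have := HeckeAlgebra.one_coe (ρ := ρ) 1
    simp only [OneMemClass.coe_one] at this
    ext w
    simp only [integrand, this, transpose_dual]
    simp
  · intro g hg
    simp [integrand, HeckeAlgebra.one_of_notMem (ρ := ρ) (g := g) (by simpa using hg)]

protected theorem mul_smul' (f h : HeckeAlgebra K ρ) (φ : RhoInvariants K ρ π) :
    (f * h) • φ = f • h • φ := by
  apply Representation.IntertwiningMap.ext
  rw [smul_toLinearMap, smul_toLinearMap]
  calc _ = cosetSum K.toSubgroup fun y => cosetSum K.toSubgroup fun x =>
        π.rep y ∘ₗ φ.toLinearMap ∘ₗ transpose K ρ (f x * h (x⁻¹ * y)) := by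
        congr 1; funext y
        exact cosetSum_map (HeckeAlgebra.cosetFinite_conv f h y)
          ((LinearMap.compRight ℂ (M := ρ.V) (π.rep y ∘ₗ φ.toLinearMap)) ∘ₗ
            transpose K ρ).toAddMonoidHom
    _ = cosetSum K.toSubgroup fun x => cosetSum K.toSubgroup fun y =>
        π.rep y ∘ₗ φ.toLinearMap ∘ₗ transpose K ρ (f x * h (x⁻¹ * y)) :=
        (cosetSum_comm
          (F := fun x y => π.rep y ∘ₗ φ.toLinearMap ∘ₗ transpose K ρ (f x * h (x⁻¹ * y)))
          (f.cosetFinite fun x hx => by funext y; simp [hx])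
          fun x => h.cosetFinite' x⁻¹ fun y hy => by simp [hy]).symm
    _ = _ := by
        congr 1; funext x
        have hx : ∀ y, π.rep (x * y) ∘ₗ φ.toLinearMap ∘ₗ transpose K ρ (f x * h (x⁻¹ * (x * y))) =
            π.rep x ∘ₗ integrand h φ y ∘ₗ transpose K ρ (f x) := fun y => by
          ext w
          simp [integrand, transpose_mul]
        rw [← cosetSum_translate (x := x)]
        · simp only [hx]
          exact (cosetSum_map (integrand_finite h φ)
            ((LinearMap.compRight ℂ (M := ρ.V) (π.rep x)) ∘ₗ
              (LinearMap.lcomp ℂ π.V (transpose K ρ (f x)))).toAddMonoidHom).symm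
        · intro y k hk
          have h1 := hx (x⁻¹ * (y * k))
          have h2 := hx (x⁻¹ * y)
          rw [mul_inv_cancel_left] at h1 h2
          rw [h1, h2, ← mul_assoc, integrand_rightInv h φ _ k hk]

/-- `Hom_K(ρ, π|_K)` as a left module over the Hecke algebra. -/
instance : Module (HeckeAlgebra K ρ) (RhoInvariants K ρ π) where
  one_smul := RhoInvariants.one_smul'
  mul_smul := RhoInvariants.mul_smul'
  smul_zero f := by
    apply Representation.IntertwiningMap.ext
    simp [smul_toLinearMap, cosetSum]
  zero_smul φ := by
    apply Representation.IntertwiningMap.ext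
    simp [smul_toLinearMap, cosetSum]
  smul_add f φ ψ := by
    apply Representation.IntertwiningMap.ext
    rw [Representation.IntertwiningMap.add_toLinearMap, smul_toLinearMap', smul_toLinearMap',
      smul_toLinearMap', ← cosetSum_add (integrand_finite f φ) (integrand_finite f ψ)]
    congr 1; funext g
    ext w
    simp [integrand]
  add_smul f h φ := by
    apply Representation.IntertwiningMap.ext
    rw [Representation.IntertwiningMap.add_toLinearMap, smul_toLinearMap', smul_toLinearMap',
      smul_toLinearMap', ← cosetSum_add (integrand_finite f φ) (integrand_finite h φ)]
    congr 1; funext g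
    ext w
    simp [integrand]

end RhoInvariants

end Hecke

end EllGroup

end

open EllGroup

/-! Every argument passes between `G` and `A = HeckeAlgebra K ρ` by averaging over compact groups.
Averaging a linear map `ρ → π` over `K` gives a `ρ`-invariant, and by `heckeSingle_smul` the average
of `π(x) ∘ φ ∘ Tᵗ` is the result of applying an element of `A` to `φ`. So a statement about
`G`-spans of the image of `φ` becomes a statement about the `A`-submodule generated by `φ`, once
linear maps have been decomposed by `mem_span_comp_of_range_le`.

Simplicity: a non-zero `φ` has image generating `π`, so any `ψ` is a combination of maps `π(g) φ R`;
averaging leaves `ψ` fixed and turns the combination into `f • φ` (`exists_smul_eq`).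

Injectivity: tameness makes the modules of invariants finite-dimensional, so equal annihilators give
isomorphic modules. If `φ` and `ψ` correspond under a module isomorphism, the subrepresentation of
`π × σ` generated by the pairs `(φ w, ψ w)` is the graph of an isomorphism
(`nonempty_equiv_of_linearEquiv`).

Surjectivity: a simple module is `A / I`. Elements of `A` become functions `G → W` under left
translation; the functions coming from `I` generate a subrepresentation not containing those coming
from `1`, and Zorn's lemma yields an irreducible subquotient carrying a non-zero `ρ`-invariant
killed by `I` (`exists_rhoInvariant_of_ideal`).

Topology: the sets `{P | f ∉ P}` are a basis of the Jacobson topology, and `f ∉ Ann` means that `f`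
acts non-trivially on the invariants. This is Fell-open, because the non-vanishing is detected by
finitely many averages of one matrix coefficient over a compact set
(`exists_fellNhd_of_smul_ne_zero`). Conversely, finitely many coefficients of `π` on a compact set
`B` live, by the `ℓ_c` property and admissibility, in an irreducible representation `τ` of one
compact open subgroup `L ⊇ B ∪ K`. A coefficient of `τ` gives `f ∈ A` that is non-zero on `π` and
non-zero only on those `σ` whose restriction to `L` contains `τ`; such `σ` reproduce the
coefficients exactly on `B` (`exists_hecke_forall_coefficient`). -/

noncomputable section

namespace EllGroup

/-! ### Averaging over a compact group -/

section Average

open MeasureTheory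

variable {C : Type*} [Group C] [TopologicalSpace C] [IsTopologicalGroup C] [CompactSpace C]
  {X Y : Type*} [AddCommGroup X] [Module ℂ X] [AddCommGroup Y] [Module ℂ Y]

/-- The normalized Haar measure of a subset of a compact group. -/
def haarMass (S : Set C) : ℝ :=
  letI : MeasurableSpace C := borel C
  haveI : BorelSpace C := ⟨rfl⟩
  (Measure.haarMeasure (⊤ : TopologicalSpace.PositiveCompacts C)).real S

theorem haarMass_nonneg (S : Set C) : 0 ≤ haarMass S := measureReal_nonneg

theorem haarMass_empty : haarMass (∅ : Set C) = 0 := by simp [haarMass]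

theorem haarMass_univ : haarMass (Set.univ : Set C) = 1 := by
  let _ : MeasurableSpace C := borel C
  have : BorelSpace C := ⟨rfl⟩
  have h := Measure.haarMeasure_self (K₀ := (⊤ : TopologicalSpace.PositiveCompacts C))
  rw [TopologicalSpace.PositiveCompacts.coe_top] at h
  simp [haarMass, Measure.real, h]

theorem haarMass_translate (l : C) (S : Set C) :
    haarMass ((fun c => l * c) ⁻¹' S) = haarMass S := by
  let _ : MeasurableSpace C := borel C
  have : BorelSpace C := ⟨rfl⟩
  simp [haarMass, Measure.real, measure_preimage_mul]

theorem haarMass_biUnion {ι : Type*} (s : Finset ι) (S : ι → Set C)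
    (hd : (s : Set ι).PairwiseDisjoint S) (hS : ∀ i ∈ s, IsOpen (S i)) :
    haarMass (⋃ i ∈ s, S i) = ∑ i ∈ s, haarMass (S i) := by
  let _ : MeasurableSpace C := borel C
  have : BorelSpace C := ⟨rfl⟩
  exact measureReal_biUnion_finset hd (fun i hi => (hS i hi).measurableSet)

/-- The mean value of a locally constant function on a compact group. -/
def avg (F : C → X) : X := ∑ᶠ x : X, (haarMass (F ⁻¹' {x}) : ℂ) • x

theorem avg_translate (F : C → X) (l : C) : avg (fun c => F (l * c)) = avg F :=
  finsum_congr fun x => by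
    rw [← haarMass_translate l (F ⁻¹' {x})]; rfl

/-- Each fibre of `φ ∘ H` is a finite disjoint union of open fibres of `H`, so the mean may be
computed on any finer locally constant partition. Linearity of `avg` reduces to this by choosing a
common refinement. -/
theorem avg_comp {S : Type*} {H : C → S} (hH : IsLocallyConstant H) (φ : S → X) :
    avg (fun c => φ (H c)) =
      ∑ s ∈ hH.range_finite.toFinset, (haarMass (H ⁻¹' {s}) : ℂ) • φ s := by
  classical
  set R := hH.range_finite.toFinset with hR
  have hmem : ∀ c, H c ∈ R := fun c => hH.range_finite.mem_toFinset.2 ⟨c, rfl⟩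
  have key : ∀ x, haarMass ((fun c => φ (H c)) ⁻¹' {x}) =
      ∑ s ∈ R with φ s = x, haarMass (H ⁻¹' {s}) := fun x => by
    rw [← haarMass_biUnion]
    · congr 1
      ext c
      simp [hmem]
    · intro s _ t _ hst
      exact Disjoint.preimage _ (Set.disjoint_singleton.2 hst)
    · exact fun s _ => hH _
  rw [avg, finsum_eq_sum_of_support_subset (s := R.image φ)]
  · rw [← Finset.sum_fiberwise_of_maps_to (g := φ) (t := R.image φ)
      (fun s hs => Finset.mem_image_of_mem φ hs)]
    refine Finset.sum_congr rfl fun x _ => ?_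
    rw [key, Complex.ofReal_sum, Finset.sum_smul]
    refine Finset.sum_congr rfl fun s hs => ?_
    rw [(Finset.mem_filter.1 hs).2]
  · intro x hx
    by_contra hxR
    refine hx ?_
    have : (fun c => φ (H c)) ⁻¹' {x} = ∅ := by
      ext c
      simp only [Set.mem_preimage, Set.mem_singleton_iff, Set.mem_empty_iff_false, iff_false]
      rintro rfl
      exact hxR (Finset.mem_coe.2 (Finset.mem_image_of_mem φ (hmem c)))
    simp [this, haarMass_empty]

theorem avg_const (x : X) : avg (fun _ : C => x) = x := by
  rw [avg, finsum_eq_single _ x]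
  · have : (fun _ : C => x) ⁻¹' {x} = Set.univ := by ext; simp
    rw [this, haarMass_univ]; simp
  · intro y hy
    have : (fun _ : C => x) ⁻¹' {y} = ∅ := by ext; simp [hy.symm]
    rw [this, haarMass_empty]; simp

theorem map_avg {F : C → X} (hF : IsLocallyConstant F) (φ : X →ₗ[ℂ] Y) :
    φ (avg F) = avg (fun c => φ (F c)) := by
  rw [avg_comp hF φ, avg_comp hF (fun x => x), map_sum]
  simp

theorem isLocallyConstant_prodMk {S T : Type*} {F : C → S} {F' : C → T} (hF : IsLocallyConstant F)
    (hF' : IsLocallyConstant F') : IsLocallyConstant fun c => (F c, F' c) :=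
  hF.comp₂ hF' Prod.mk

theorem avg_add {F F' : C → X} (hF : IsLocallyConstant F) (hF' : IsLocallyConstant F') :
    avg (fun c => F c + F' c) = avg F + avg F' := by
  have h := isLocallyConstant_prodMk hF hF'
  -- All three averages are computed on the fibres of the joint map `c ↦ (F c, F' c)`.
  rw [avg_comp h (fun p => p.1 + p.2)]
  conv_rhs => rw [show F = fun c => (F c, F' c).1 from rfl, avg_comp h (fun p => p.1)]
  conv_rhs => enter [2]; rw [show F' = fun c => (F c, F' c).2 from rfl, avg_comp h (fun p => p.2)]
  rw [← Finset.sum_add_distrib]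
  simp

theorem avg_sub {F F' : C → X} (hF : IsLocallyConstant F) (hF' : IsLocallyConstant F') :
    avg (fun c => F c - F' c) = avg F - avg F' := by
  have := avg_add (hF.comp₂ hF' (· - ·)) hF'
  simp only [sub_add_cancel] at this
  exact eq_sub_of_add_eq this.symm

theorem isLocallyConstant_sum {ι : Type*} (s : Finset ι) {F : ι → C → X}
    (hF : ∀ i ∈ s, IsLocallyConstant (F i)) : IsLocallyConstant fun c => ∑ i ∈ s, F i c := by
  classical
  induction s using Finset.induction with
  | empty =>
    simp only [Finset.sum_empty]
    exact IsLocallyConstant.const 0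
  | insert a s ha ih =>
    simp only [Finset.sum_insert ha]
    exact (hF a (by simp)).comp₂ (ih fun i hi => hF i (by simp [hi])) (· + ·)

theorem avg_sum {ι : Type*} (s : Finset ι) {F : ι → C → X}
    (hF : ∀ i ∈ s, IsLocallyConstant (F i)) :
    avg (fun c => ∑ i ∈ s, F i c) = ∑ i ∈ s, avg (F i) := by
  classical
  induction s using Finset.induction with
  | empty => simpa using avg_const (C := C) (0 : X)
  | insert a s ha ih =>
    simp only [Finset.sum_insert ha]
    rw [avg_add (hF a (by simp)) (isLocallyConstant_sum s fun i hi => hF i (by simp [hi])),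
      ih fun i hi => hF i (by simp [hi])]

theorem avg_mem {F : C → X} (hF : IsLocallyConstant F) (S : Submodule ℂ X) (h : ∀ c, F c ∈ S) :
    avg F ∈ S := by
  rw [avg_comp hF (fun x => x)]
  refine S.sum_mem fun x hx => S.smul_mem _ ?_
  obtain ⟨c, rfl⟩ := hF.range_finite.mem_toFinset.1 hx
  exact h c

theorem norm_avg_le {F : C → ℂ} (hF : IsLocallyConstant F) {B : ℝ} (h : ∀ c, ‖F c‖ ≤ B) :
    ‖avg F‖ ≤ B := by
  have h1 : ∑ s ∈ hF.range_finite.toFinset, haarMass (F ⁻¹' {s}) = 1 := by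
    have := avg_comp hF (fun _ => (1 : ℂ))
    rw [avg_const] at this
    simp only [smul_eq_mul, mul_one] at this
    exact_mod_cast this.symm
  rw [avg_comp hF (fun x => x)]
  calc _ ≤ ∑ s ∈ hF.range_finite.toFinset, haarMass (F ⁻¹' {s}) * B := by
        refine norm_sum_le_of_le _ fun x hx => ?_
        obtain ⟨c, rfl⟩ := hF.range_finite.mem_toFinset.1 hx
        rw [norm_smul, Complex.norm_real, Real.norm_of_nonneg (haarMass_nonneg _)]
        exact mul_le_mul_of_nonneg_left (h c) (haarMass_nonneg _)
    _ = B := by rw [← Finset.sum_mul, h1, one_mul]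

end Average

/-! ### Averaging linear maps -/

section AverageMap

variable {G : Type*} [Group G] [TopologicalSpace G] [IsTopologicalGroup G]
  {V V₁ V₂ V₃ : Type*} [AddCommGroup V] [Module ℂ V] [AddCommGroup V₁] [Module ℂ V₁]
  [AddCommGroup V₂] [Module ℂ V₂] [AddCommGroup V₃] [Module ℂ V₃]

theorem IsSmooth.restrict {π : Representation ℂ G V} (h : IsSmooth π) (K : Subgroup G) :
    IsSmooth (restrict π K) := fun v => (h v).preimage continuous_subtype_val

theorem isLocallyConstant_iff_exists_nhds {X S : Type*} [TopologicalSpace X] {F : X → S} :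
    IsLocallyConstant F ↔ ∀ x, ∀ᶠ y in nhds x, F y = F x :=
  IsLocallyConstant.iff_eventually_eq F

theorem IsSmooth.isLocallyConstant {π : Representation ℂ G V} (h : IsSmooth π) (v : V) :
    IsLocallyConstant fun g => π g v := by
  rw [isLocallyConstant_iff_exists_nhds]
  intro g
  have hO : IsOpen ((fun x => g⁻¹ * x) ⁻¹' {g | π g v = v}) :=
    (h v).preimage (continuous_const_mul _)
  filter_upwards [hO.mem_nhds (by simp)] with x hx
  have hx : π (g⁻¹ * x) v = v := hx
  conv_rhs => rw [← hx]
  rw [← Module.End.mul_apply, ← map_mul, mul_inv_cancel_left]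

theorem IsSmooth.isLocallyConstant_inv {π : Representation ℂ G V} (h : IsSmooth π) (v : V) :
    IsLocallyConstant fun g => π g⁻¹ v :=
  (h.isLocallyConstant v).comp_continuous continuous_inv

theorem IsSmooth.isLocallyConstant_apply {X : Type*} [TopologicalSpace X]
    {π : Representation ℂ G V} (h : IsSmooth π)
    {f : X → G} (hf : Continuous f) {F : X → V} (hF : IsLocallyConstant F) :
    IsLocallyConstant fun x => π (f x) (F x) := by
  rw [isLocallyConstant_iff_exists_nhds] at hF ⊢
  intro x
  have := isLocallyConstant_iff_exists_nhds.1 ((h.isLocallyConstant (F x)).comp_continuous hf) x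
  filter_upwards [hF x, this] with y hy hy'
  rw [hy]; exact hy'

variable {C : Type*} [Group C] [TopologicalSpace C] [IsTopologicalGroup C]
  {τ₁ : Representation ℂ C V₁} {τ₂ : Representation ℂ C V₂} {τ₃ : Representation ℂ C V₃}
  (h₁ : IsSmooth τ₁) (h₂ : IsSmooth τ₂)

include h₁ h₂ in
theorem isLocallyConstant_conj (T : V₁ →ₗ[ℂ] V₂) (v : V₁) :
    IsLocallyConstant fun c => τ₂ c (T (τ₁ c⁻¹ v)) :=
  h₂.isLocallyConstant_apply continuous_id ((h₁.isLocallyConstant_inv v).comp T)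

variable [CompactSpace C]

/-- The average `∫ τ₂(c) T τ₁(c)⁻¹ dc` of a linear map over a compact group. -/
def avgMap (T : V₁ →ₗ[ℂ] V₂) : τ₁.IntertwiningMap τ₂ where
  toFun v := avg fun c => τ₂ c (T (τ₁ c⁻¹ v))
  map_add' v w := by
    rw [← avg_add (isLocallyConstant_conj h₁ h₂ T v) (isLocallyConstant_conj h₁ h₂ T w)]
    simp
  map_smul' a v := by
    have := map_avg (isLocallyConstant_conj h₁ h₂ T v) (LinearMap.lsmul ℂ V₂ a)
    simp only [LinearMap.lsmul_apply] at this
    simp [this]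
  isIntertwining' l := by
    ext v
    have := map_avg (isLocallyConstant_conj h₁ h₂ T v) (τ₂ l)
    simp only [LinearMap.comp_apply, LinearMap.coe_mk, AddHom.coe_mk]
    rw [this, ← avg_translate _ l]
    congr 1; funext c
    rw [mul_inv_rev, map_mul τ₂, map_mul τ₁, Module.End.mul_apply, Module.End.mul_apply,
      Representation.inv_self_apply]

theorem avgMap_apply (T : V₁ →ₗ[ℂ] V₂) (v : V₁) :
    avgMap h₁ h₂ T v = avg fun c => τ₂ c (T (τ₁ c⁻¹ v)) := rfl

theorem avgMap_add (S T : V₁ →ₗ[ℂ] V₂) :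
    avgMap h₁ h₂ (S + T) = avgMap h₁ h₂ S + avgMap h₁ h₂ T := by
  apply DFunLike.ext
  intro v
  rw [Representation.IntertwiningMap.coe_add, Pi.add_apply, avgMap_apply, avgMap_apply,
    avgMap_apply, ← avg_add (isLocallyConstant_conj h₁ h₂ S v) (isLocallyConstant_conj h₁ h₂ T v)]
  simp

theorem avgMap_smul (a : ℂ) (T : V₁ →ₗ[ℂ] V₂) (v : V₁) :
    avgMap h₁ h₂ (a • T) v = a • avgMap h₁ h₂ T v := by
  have := map_avg (isLocallyConstant_conj h₁ h₂ T v) (LinearMap.lsmul ℂ V₂ a)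
  simp only [LinearMap.lsmul_apply] at this
  rw [avgMap_apply, avgMap_apply, this]
  simp

theorem avgMap_zero : avgMap h₁ h₂ (0 : V₁ →ₗ[ℂ] V₂) = 0 := by
  have := avgMap_add h₁ h₂ (0 : V₁ →ₗ[ℂ] V₂) 0
  simpa using this

theorem avgMap_comp (h₃ : IsSmooth τ₃) (T : V₁ →ₗ[ℂ] V₂) (S : τ₂.IntertwiningMap τ₃) (v : V₁) :
    S (avgMap h₁ h₂ T v) = avgMap h₁ h₃ (S.toLinearMap ∘ₗ T) v := by
  rw [avgMap_apply, avgMap_apply]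
  have := map_avg (isLocallyConstant_conj h₁ h₂ T v) S.toLinearMap
  rw [Representation.IntertwiningMap.toLinearMap_apply] at this
  rw [this]
  congr 1; funext c
  exact Representation.IntertwiningMap.isIntertwining _ _ S c _

/-- Equivariance is required only at the single vector `v`: the integrand is then constant there.
This covers maps that are equivariant only on a subspace, such as linear retractions. -/
theorem avgMap_of_intertwining (T : V₁ →ₗ[ℂ] V₂) (v : V₁)
    (h : ∀ c, T (τ₁ c⁻¹ v) = τ₂ c⁻¹ (T v)) : avgMap h₁ h₂ T v = T v := by
  rw [avgMap_apply]
  conv_rhs => rw [← avg_const (C := C) (T v)]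
  congr 1; funext c
  rw [h, Representation.self_inv_apply]

theorem avgMap_intertwining (T : τ₁.IntertwiningMap τ₂) : avgMap h₁ h₂ T.toLinearMap = T :=
  DFunLike.ext _ _ fun v => avgMap_of_intertwining h₁ h₂ T.toLinearMap v fun _ =>
    Representation.IntertwiningMap.isIntertwining _ _ T _ _

/-- The trace is a finite sum of coordinates, hence commutes with the average, and all conjugates of
`T` have the same trace. -/
theorem trace_avgMap [FiniteDimensional ℂ V₁] (T : V₁ →ₗ[ℂ] V₁) :
    LinearMap.trace ℂ V₁ (avgMap h₁ h₁ T).toLinearMap = LinearMap.trace ℂ V₁ T := by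
  classical
  let b := Module.finBasis ℂ V₁
  have htr : ∀ S : V₁ →ₗ[ℂ] V₁, LinearMap.trace ℂ V₁ S = ∑ i, b.coord i (S (b i)) := fun S => by
    rw [LinearMap.trace_eq_matrix_trace ℂ b, Matrix.trace]
    simp [LinearMap.toMatrix_apply]
  rw [htr]
  have h : ∀ i, b.coord i ((avgMap h₁ h₁ T).toLinearMap (b i)) =
      avg fun c => b.coord i ((τ₁ c ∘ₗ T ∘ₗ τ₁ c⁻¹) (b i)) := fun i =>
    map_avg (isLocallyConstant_conj h₁ h₁ T (b i)) (b.coord i)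
  simp only [h]
  rw [← avg_sum (F := fun i c => b.coord i ((τ₁ c ∘ₗ T ∘ₗ τ₁ c⁻¹) (b i))) Finset.univ fun i _ =>
    (isLocallyConstant_conj h₁ h₁ T (b i)).comp (b.coord i)]
  simp only [← htr]
  conv_rhs => rw [← avg_const (C := C) (LinearMap.trace ℂ V₁ T)]
  congr 1; funext c
  rw [← LinearMap.comp_assoc, LinearMap.trace_comp_comm']
  congr 1
  ext v
  simp

end AverageMap

/-! ### Schur's lemma in trace form. -/

section Schur

variable {C : Type*} [Group C] {V : Type*} [AddCommGroup V] [Module ℂ V] [FiniteDimensional ℂ V]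
  {τ : Representation ℂ C V}

theorem nontrivial_of_isIrreducible {C V : Type*} [Group C] [AddCommGroup V] [Module ℂ V]
    {τ : Representation ℂ C V} (h : τ.IsIrreducible) : Nontrivial V := by
  by_contra hV
  rw [not_nontrivial_iff_subsingleton] at hV
  obtain ⟨a, b, hab⟩ := h.toNontrivial
  exact hab (Subrepresentation.toSubmodule_injective (Subsingleton.elim _ _))

/-- Schur's lemma, with the scalar expressed through the trace. -/
theorem schur_trace (h : τ.IsIrreducible) (T : τ.IntertwiningMap τ) (v : V) :
    T v = (LinearMap.trace ℂ V T.toLinearMap / Module.finrank ℂ V) • v := by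
  obtain ⟨a, rfl⟩ :=
    (Representation.IsIrreducible.algebraMap_intertwiningMap_bijective_of_isAlgClosed
      (ρ := τ)).2 T
  have hT : (algebraMap ℂ (τ.IntertwiningMap τ) a).toLinearMap = a • LinearMap.id := by
    rfl
  have := nontrivial_of_isIrreducible h
  have hn : (Module.finrank ℂ V : ℂ) ≠ 0 := by
    exact_mod_cast (Module.finrank_pos (R := ℂ) (M := V)).ne'
  rw [hT, map_smul, LinearMap.trace_id, smul_eq_mul, mul_div_cancel_right₀ _ hn]
  rfl

end Schur

/-! ### Hecke operators supported on one double coset, and how they act. -/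

section HeckeSingle

open scoped Pointwise

variable {G : Type u} [Group G] [TopologicalSpace G] [IsTopologicalGroup G]

instance (K : CompactOpenSubgroup G) : CompactSpace K.toSubgroup :=
  isCompact_iff_compactSpace.1 K.isCompact

/-- A smooth finite-dimensional representation is locally constant. -/
theorem IsSmooth.isLocallyConstant_rep {V : Type*} [AddCommGroup V] [Module ℂ V]
    [FiniteDimensional ℂ V] {π : Representation ℂ G V} (h : IsSmooth π) :
    IsLocallyConstant fun g => π g := by
  rw [isLocallyConstant_iff_exists_nhds]
  intro g
  let b := Module.finBasis ℂ V
  have : ∀ i, ∀ᶠ y in nhds g, π y (b i) = π g (b i) := fun i =>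
    isLocallyConstant_iff_exists_nhds.1 (h.isLocallyConstant (b i)) g
  filter_upwards [Filter.eventually_all.2 this] with y hy
  exact b.ext hy

variable {K : CompactOpenSubgroup G} {ρ : SmoothIrrep K.toSubgroup}

theorem isLocallyConstant_dual : IsLocallyConstant fun k : K.toSubgroup => ρ.rep.dual k :=
  (isSmooth_dual K ρ).isLocallyConstant_rep

/-- `ρ^∨` is trivial on an open subgroup of `K`, and right translation by that subgroup does not
change `f`. -/
theorem isLocallyConstant_of_map_right {f : G → DualEnd K ρ}
    (hf : ∀ (g : G) (k : K.toSubgroup), f (g * k) = f g * ρ.rep.dual k) : IsLocallyConstant f := by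
  rw [isLocallyConstant_iff_exists_nhds]
  intro g
  have h1 : IsOpen ((↑) '' {k : K.toSubgroup | ρ.rep.dual k = 1} : Set G) :=
    K.isOpen.isOpenEmbedding_subtypeVal.isOpenMap _ (isLocallyConstant_dual {1})
  have h2 := (h1.preimage (continuous_const_mul g⁻¹)).mem_nhds (x := g)
    ⟨1, map_one ρ.rep.dual, by simp⟩
  filter_upwards [h2] with y hy
  obtain ⟨k, hk, hky⟩ := hy
  have hk : ρ.rep.dual k = 1 := hk
  have : y = g * k := by rw [hky]; simp
  rw [this, hf, hk, mul_one]

theorem isLocallyConstant_dual_mul_mul (h : HeckeAlgebra K ρ) (x g : G) (T : DualEnd K ρ) :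
    IsLocallyConstant fun k : K.toSubgroup => ρ.rep.dual k * T * h (x⁻¹ * ((k : G)⁻¹ * g)) :=
  (isLocallyConstant_dual.comp (· * T)).comp₂
    (h.locConst.comp_continuous (f := fun k : K.toSubgroup => x⁻¹ * ((k : G)⁻¹ * g))
      (by fun_prop)) (· * ·)

theorem mem_of_one_ne_zero {g : G} (h : (1 : HeckeAlgebra K ρ) g ≠ 0) : g ∈ K.toSubgroup := by
  by_contra hg
  exact h (HeckeAlgebra.one_of_notMem hg)

/-- The double average over `K` of the function with value `T` at `x` and `0` elsewhere. -/
def heckeSingle (x : G) (T : DualEnd K ρ) : HeckeAlgebra K ρ :=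
  -- Only the left average is written out. The right one is carried by the unit `1`, equal to `ρ^∨`
  -- on `K` and to zero elsewhere.
  ⟨fun g => avg fun k : K.toSubgroup =>
      ρ.rep.dual k * T * (1 : HeckeAlgebra K ρ) (x⁻¹ * ((k : G)⁻¹ * g)), by
    have hr : ∀ (g : G) (l : K.toSubgroup), (avg fun k : K.toSubgroup =>
        ρ.rep.dual k * T * (1 : HeckeAlgebra K ρ) (x⁻¹ * ((k : G)⁻¹ * (g * l)))) =
        (avg fun k : K.toSubgroup =>
          ρ.rep.dual k * T * (1 : HeckeAlgebra K ρ) (x⁻¹ * ((k : G)⁻¹ * g))) * ρ.rep.dual l := by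
      intro g l
      have := map_avg (isLocallyConstant_dual_mul_mul 1 x g T)
        (LinearMap.mulRight ℂ (ρ.rep.dual l))
      simp only [LinearMap.mulRight_apply] at this
      rw [this]
      congr 1; funext k
      rw [mul_assoc (ρ.rep.dual k * T), ← HeckeAlgebra.map_right]
      simp only [mul_assoc]
    refine ⟨isLocallyConstant_of_map_right hr, ?_, fun k₁ k₂ g => ?_⟩
    · refine HasCompactSupport.of_support_subset_isCompact
        (K.isCompact.mul ((isCompact_singleton (x := x)).mul K.isCompact)) fun g hg => ?_
      have : ∃ k : K.toSubgroup, (1 : HeckeAlgebra K ρ) (x⁻¹ * ((k : G)⁻¹ * g)) ≠ 0 := by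
        by_contra! H
        exact hg (by simp [H, avg_const])
      obtain ⟨k, hk⟩ := this
      exact ⟨k, k.2, _, ⟨x, rfl, _, mem_of_one_ne_zero hk, rfl⟩, by simp⟩
    · beta_reduce
      rw [hr]
      congr 1
      have := map_avg (isLocallyConstant_dual_mul_mul 1 x g T)
        (LinearMap.mulLeft ℂ (ρ.rep.dual k₁))
      simp only [LinearMap.mulLeft_apply] at this
      rw [this, ← avg_translate _ k₁]
      congr 1; funext k
      rw [map_mul, Subgroup.coe_mul, mul_inv_rev]
      simp only [mul_assoc, inv_mul_cancel_left]⟩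

theorem heckeSingle_apply (x g : G) (T : DualEnd K ρ) :
    heckeSingle x T g = avg fun k : K.toSubgroup =>
      ρ.rep.dual k * T * (1 : HeckeAlgebra K ρ) (x⁻¹ * ((k : G)⁻¹ * g)) := rfl

/-- After exchanging the average over `K` with the coset sum, the summand for a fixed `k` is
supported on the single coset `kxK`, where it is evaluated at `kx`. The hypothesis `hΞ` makes the
summand constant on left cosets. Convolution and the action on invariants are both sums of this
shape. -/
theorem cosetSum_heckeSingle {M : Type*} [AddCommGroup M] [Module ℂ M] (x : G) (T : DualEnd K ρ)
    (Ξ : G → DualEnd K ρ →ₗ[ℂ] M)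
    (hΞ : ∀ (g : G) (k : K.toSubgroup) (S : DualEnd K ρ), Ξ (g * k) (S * ρ.rep.dual k) = Ξ g S) :
    cosetSum K.toSubgroup (fun g => Ξ g (heckeSingle x T g)) =
      avg fun k : K.toSubgroup => Ξ (k * x) (ρ.rep.dual k * T) := by
  let B : Set G := (K.toSubgroup : Set G) * (({x} : Set G) * (K.toSubgroup : Set G))
  have hB : IsCompact B := K.isCompact.mul ((isCompact_singleton (x := x)).mul K.isCompact)
  have hmem : ∀ (k : K.toSubgroup) (g : G), (1 : HeckeAlgebra K ρ) (x⁻¹ * ((k : G)⁻¹ * g)) ≠ 0 →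
      g ∈ B := fun k g hk => ⟨k, k.2, _, ⟨x, rfl, _, mem_of_one_ne_zero hk, rfl⟩, by simp⟩
  classical
  -- One finite set of cosets, those meeting `KxK`, has to serve for all `k` at once so that sum and
  -- average can be exchanged.
  have hfin : CosetFinite K.toSubgroup (B.indicator fun _ => (1 : ℕ)) :=
    cosetFinite_of_compact K.isOpen hB fun g hg => by
      by_contra h; exact hg (Set.indicator_of_notMem h _)
  set A := hfin.toFinset with hA
  have hA0 : ∀ q : G ⧸ K.toSubgroup, q ∉ A → ∀ k : K.toSubgroup,
      (1 : HeckeAlgebra K ρ) (x⁻¹ * ((k : G)⁻¹ * q.out)) = 0 := fun q hq k => by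
    by_contra h
    refine hq (hfin.mem_toFinset.2 ?_)
    simp [hmem k _ h]
  have hk : ∀ k : K.toSubgroup, ∑ q ∈ A,
      Ξ q.out (ρ.rep.dual k * T * (1 : HeckeAlgebra K ρ) (x⁻¹ * ((k : G)⁻¹ * q.out))) =
      Ξ (k * x) (ρ.rep.dual k * T) := fun k => by
    calc _ = cosetSum K.toSubgroup fun g =>
          Ξ g (ρ.rep.dual k * T * (1 : HeckeAlgebra K ρ) (x⁻¹ * ((k : G)⁻¹ * g))) := by
          refine (finsum_eq_sum_of_support_subset _ fun q hq => ?_).symm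
          by_contra h
          exact hq (by simp [hA0 q h k])
      _ = _ := by
          rw [HeckeAlgebra.cosetSum_eq_of_support ?_ ((k : G) * x) ?_]
          · have := HeckeAlgebra.one_coe (ρ := ρ) 1
            rw [OneMemClass.coe_one, map_one ρ.rep.dual] at this
            simp [this]
          · intro g l hl
            lift l to K.toSubgroup using hl
            rw [← hΞ g l]
            congr 1
            rw [mul_assoc _ _ (ρ.rep.dual l), ← HeckeAlgebra.map_right]
            simp only [mul_assoc]
          · intro g hg
            have : (1 : HeckeAlgebra K ρ) (x⁻¹ * ((k : G)⁻¹ * g)) = 0 :=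
              HeckeAlgebra.one_of_notMem (by simpa [mul_assoc] using hg)
            simp [this]
  rw [cosetSum, finsum_eq_sum_of_support_subset (s := A)]
  · simp only [← hk]
    rw [avg_sum A (F := fun q (k : K.toSubgroup) =>
      Ξ q.out (ρ.rep.dual k * T * (1 : HeckeAlgebra K ρ) (x⁻¹ * ((k : G)⁻¹ * q.out))))
      fun q _ => (isLocallyConstant_dual_mul_mul 1 x q.out T).comp (Ξ q.out)]
    refine Finset.sum_congr rfl fun q _ => ?_
    rw [heckeSingle_apply, map_avg (isLocallyConstant_dual_mul_mul 1 x q.out T) (Ξ q.out)]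
  · intro q hq
    by_contra h
    refine hq ?_
    simp only [heckeSingle_apply, hA0 q h, mul_zero, avg_const, map_zero]

theorem transpose_surjective : Function.Surjective (transpose K ρ) := fun S =>
  ⟨S.dualMap, LinearMap.ext fun w => dual_ext fun ξ => by rw [apply_transpose]; rfl⟩

/-- The convolution `heckeSingle x T * h`. -/
theorem heckeSingle_mul_apply (x y : G) (T : DualEnd K ρ) (h : HeckeAlgebra K ρ) :
    (heckeSingle x T * h) y =
      avg fun k : K.toSubgroup => ρ.rep.dual k * T * h (x⁻¹ * ((k : G)⁻¹ * y)) := by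
  rw [HeckeAlgebra.mul_apply]
  refine (cosetSum_heckeSingle x T (fun g => LinearMap.mulRight ℂ (h (g⁻¹ * y))) ?_).trans ?_
  · intro g k S
    have h2 := h.map_left k⁻¹ (g⁻¹ * y)
    simp only [InvMemClass.coe_inv] at h2
    rw [LinearMap.mulRight_apply, LinearMap.mulRight_apply, mul_inv_rev, mul_assoc (k : G)⁻¹, h2,
      mul_assoc S, ← mul_assoc (ρ.rep.dual k), ← map_mul, mul_inv_cancel, map_one, one_mul]
  · simp [mul_assoc]

/-- The action of `heckeSingle x T` on `ρ`-invariants. -/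
theorem heckeSingle_smul {π : SmoothIrrep G} (x : G) (T : DualEnd K ρ)
    (φ : RhoInvariants K ρ π) :
    heckeSingle x T • φ = avgMap ρ.smooth (π.smooth.restrict K.toSubgroup)
      (π.rep x ∘ₗ φ.toLinearMap ∘ₗ transpose K ρ T) := by
  let Ξ : G → DualEnd K ρ →ₗ[ℂ] ρ.V →ₗ[ℂ] π.V := fun g =>
    (LinearMap.compRight ℂ (M := ρ.V) (π.rep g ∘ₗ φ.toLinearMap)) ∘ₗ transpose K ρ
  have hΞ : ∀ (g : G) (k : K.toSubgroup) (S : DualEnd K ρ),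
      Ξ (g * k) (S * ρ.rep.dual k) = Ξ g S := fun g k S => by
    ext w
    have h := Representation.IntertwiningMap.isIntertwining _ _ φ k
      (ρ.rep k⁻¹ (transpose K ρ S w))
    rw [Representation.self_inv_apply] at h
    change π.rep (g * k) (φ (transpose K ρ (S * ρ.rep.dual k) w)) =
      π.rep g (φ (transpose K ρ S w))
    rw [transpose_mul, transpose_dual, Module.End.mul_apply, h, map_mul]
    rfl
  have key := cosetSum_heckeSingle x T Ξ hΞ
  apply Representation.IntertwiningMap.ext
  refine key.trans ?_
  ext w
  have hlc : IsLocallyConstant fun k : K.toSubgroup => Ξ (k * x) (ρ.rep.dual k * T) := by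
    rw [isLocallyConstant_iff_exists_nhds]
    intro k
    let b := Module.finBasis ℂ ρ.V
    have h1 : ∀ i, ∀ᶠ y : K.toSubgroup in nhds k,
        π.rep (y : G) (π.rep x (φ (transpose K ρ T (ρ.rep y⁻¹ (b i))))) =
        π.rep (k : G) (π.rep x (φ (transpose K ρ T (ρ.rep k⁻¹ (b i))))) := fun i =>
      isLocallyConstant_iff_exists_nhds.1 (isLocallyConstant_conj ρ.smooth
        (π.smooth.restrict K.toSubgroup)
        (π.rep x ∘ₗ φ.toLinearMap ∘ₗ transpose K ρ T) (b i)) k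
    filter_upwards [Filter.eventually_all.2 h1] with y hy
    refine b.ext fun i => ?_
    have := hy i
    change π.rep (y * x) (φ (transpose K ρ (ρ.rep.dual y * T) (b i))) =
      π.rep (k * x) (φ (transpose K ρ (ρ.rep.dual k * T) (b i)))
    rw [transpose_mul, transpose_mul, transpose_dual, transpose_dual, map_mul, map_mul]
    exact this
  have h3 := map_avg hlc (LinearMap.applyₗ (R := ℂ) w)
  refine h3.trans ?_
  change _ = avgMap ρ.smooth (π.smooth.restrict K.toSubgroup) _ w
  rw [avgMap_apply]
  congr 1; funext k
  change π.rep (k * x) (φ (transpose K ρ (ρ.rep.dual k * T) w)) = _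
  rw [transpose_mul, transpose_dual, map_mul]
  rfl

end HeckeSingle

/-! ### Generation of linear maps, and simplicity of the module of invariants -/

section Density

variable {G W X ι : Type*} [Group G] [AddCommGroup W] [Module ℂ W] [FiniteDimensional ℂ W]
  [AddCommGroup X] [Module ℂ X]

/-- A linear map whose image lies in the `G`-span of the images of the maps `φ i` is a linear
combination of maps `τ(g) ∘ φ i ∘ R`. -/
theorem mem_span_comp_of_range_le (τ : Representation ℂ G X) (φ : ι → W →ₗ[ℂ] X) (T : W →ₗ[ℂ] X)
    (hT : ∀ w, T w ∈ Submodule.span ℂ {y | ∃ g i u, y = τ g (φ i u)}) :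
    T ∈ Submodule.span ℂ {S | ∃ (g : G) (i : ι) (R : Module.End ℂ W), S = τ g ∘ₗ φ i ∘ₗ R} := by
  -- `T` is a finite sum of rank one maps `l ⊗ y`, and for a generator `y = τ(g) φ_i(u)` one has `l
  -- ⊗ y = τ(g) ∘ φ_i ∘ (l ⊗ u)`.
  have key : ∀ y ∈ Submodule.span ℂ {y | ∃ g i u, y = τ g (φ i u)}, ∀ l : Module.Dual ℂ W,
      l.smulRight y ∈
        Submodule.span ℂ {S | ∃ (g : G) (i : ι) (R : Module.End ℂ W), S = τ g ∘ₗ φ i ∘ₗ R} := by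
    intro y hy l
    induction hy using Submodule.span_induction with
    | mem x hx =>
      obtain ⟨g, i, u, rfl⟩ := hx
      exact Submodule.subset_span ⟨g, i, l.smulRight u, by ext w; simp⟩
    | zero =>
      convert Submodule.zero_mem _
      ext w; simp
    | add x y _ _ hx hy =>
      convert Submodule.add_mem _ hx hy using 1
      ext w; simp
    | smul a x _ hx =>
      convert Submodule.smul_mem _ a hx using 1
      ext w; exact smul_comm _ _ _
  let b := Module.finBasis ℂ W
  have : T = ∑ i, (b.coord i).smulRight (T (b i)) := by
    refine b.ext fun j => ?_
    simp [LinearMap.sum_apply, Finsupp.single_apply]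
  rw [this]
  exact Submodule.sum_mem _ fun i _ => key _ (hT _) _

theorem span_orbit_eq_top {τ : Representation ℂ G X} (h : τ.IsIrreducible) {x : X} (hx : x ≠ 0) :
    Submodule.span ℂ (Set.range fun g => τ g x) = ⊤ := by
  let S : Subrepresentation τ :=
    ⟨Submodule.span ℂ (Set.range fun g => τ g x), fun g v hv => by
      induction hv using Submodule.span_induction with
      | mem y hy =>
        obtain ⟨k, rfl⟩ := hy
        exact Submodule.subset_span ⟨g * k, by simp⟩
      | zero => simp
      | add y z _ _ hy hz => rw [map_add]; exact add_mem hy hz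
      | smul a y _ hy => rw [map_smul]; exact Submodule.smul_mem _ _ hy⟩
  have hxS : x ∈ S.toSubmodule := Submodule.subset_span ⟨1, by simp⟩
  rcases eq_bot_or_eq_top S with h | h
  · rw [h] at hxS
    exact (hx hxS).elim
  · exact congrArg Subrepresentation.toSubmodule h

end Density

/-! ### Equivariant splittings for smooth representations of compact groups. -/

section Splitting

variable {C : Type*} [Group C] [TopologicalSpace C] [IsTopologicalGroup C] [CompactSpace C]
  {V₁ V₂ : Type*} [AddCommGroup V₁] [Module ℂ V₁] [AddCommGroup V₂] [Module ℂ V₂]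
  {τ₁ : Representation ℂ C V₁} {τ₂ : Representation ℂ C V₂}

/-- Maschke's argument: the average of a linear left inverse is equivariant and is still a left
inverse. -/
theorem exists_intertwining_leftInverse (h₁ : IsSmooth τ₁) (h₂ : IsSmooth τ₂)
    (f : τ₁.IntertwiningMap τ₂) (hf : Function.Injective f) :
    ∃ q : τ₂.IntertwiningMap τ₁, ∀ v, q (f v) = v := by
  obtain ⟨q, hq⟩ := LinearMap.exists_leftInverse_of_injective f.toLinearMap
    (LinearMap.ker_eq_bot.2 hf)
  have hq : ∀ v, q (f v) = v := fun v => LinearMap.congr_fun hq v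
  refine ⟨avgMap h₂ h₁ q, fun v => ?_⟩
  rw [avgMap_of_intertwining, hq]
  intro c
  rw [← Representation.IntertwiningMap.isIntertwining, hq, hq]

theorem exists_intertwining_rightInverse (h₁ : IsSmooth τ₁) (h₂ : IsSmooth τ₂)
    (f : τ₁.IntertwiningMap τ₂) (hf : Function.Surjective f) :
    ∃ s : τ₂.IntertwiningMap τ₁, ∀ v, f (s v) = v := by
  obtain ⟨s, hs⟩ := LinearMap.exists_rightInverse_of_surjective f.toLinearMap
    (LinearMap.range_eq_top.2 hf)
  refine ⟨avgMap h₂ h₁ s, fun v => ?_⟩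
  rw [avgMap_comp h₂ h₁ h₂, hs, avgMap_of_intertwining]
  · rfl
  · intro c; rfl

end Splitting

/-! ### The module of `ρ`-invariants is simple when non-zero. -/

section Simple

variable {G : Type u} [Group G] [TopologicalSpace G] [IsTopologicalGroup G]
  {K : CompactOpenSubgroup G} {ρ : SmoothIrrep K.toSubgroup} {π σ : SmoothIrrep G}

namespace RhoInvariants

theorem smul_apply (f : HeckeAlgebra K ρ) (φ : RhoInvariants K ρ π) (w : ρ.V) :
    (f • φ) w = cosetSum K.toSubgroup fun g => π.rep g (φ (transpose K ρ (f g) w)) :=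
  cosetSum_map (integrand_finite f φ)
    (LinearMap.applyₗ (R := ℂ) (M := ρ.V) (M₂ := π.V) w).toAddMonoidHom

/-- Composition with an intertwining map, as a map of modules over the Hecke algebra. -/
def map (E : π.rep.IntertwiningMap σ.rep) :
    RhoInvariants K ρ π →ₗ[HeckeAlgebra K ρ] RhoInvariants K ρ σ where
  toFun φ :=
    { toLinearMap := E.toLinearMap ∘ₗ φ.toLinearMap
      isIntertwining' := fun k => by
        ext w
        have h1 := Representation.IntertwiningMap.isIntertwining _ _ φ k w
        have h2 := Representation.IntertwiningMap.isIntertwining _ _ E (k : G) (φ w)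
        change E (φ (ρ.rep k w)) = σ.rep k (E (φ w))
        rw [← h2, h1]; rfl }
  map_add' φ ψ := by
    apply Representation.IntertwiningMap.ext
    ext w
    exact map_add E.toLinearMap _ _
  map_smul' f φ := by
    apply DFunLike.ext
    intro w
    change E ((f • φ) w) = (f • _ : RhoInvariants K ρ σ) w
    rw [smul_apply, smul_apply]
    refine (cosetSum_map (f.cosetFinite fun g hg => by simp [hg])
      E.toLinearMap.toAddMonoidHom).trans ?_
    congr 1; funext g
    exact Representation.IntertwiningMap.isIntertwining _ _ E g _

theorem map_apply (E : π.rep.IntertwiningMap σ.rep) (φ : RhoInvariants K ρ π) (w : ρ.V) :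
    map E φ w = E (φ w) := rfl

theorem annihilator_le_of_equiv (e : π.rep.Equiv σ.rep) :
    Module.annihilator (HeckeAlgebra K ρ) (RhoInvariants K ρ π) ≤
      Module.annihilator (HeckeAlgebra K ρ) (RhoInvariants K ρ σ) := by
  refine LinearMap.annihilator_le_of_surjective (map e.toIntertwiningMap) fun ψ =>
    ⟨map e.symm.toIntertwiningMap ψ, DFunLike.ext _ _ fun w => ?_⟩
  rw [map_apply, map_apply]
  exact e.toLinearEquiv.apply_symm_apply _

theorem annihilator_eq_of_equiv (e : π.rep.Equiv σ.rep) :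
    Module.annihilator (HeckeAlgebra K ρ) (RhoInvariants K ρ π) =
      Module.annihilator (HeckeAlgebra K ρ) (RhoInvariants K ρ σ) :=
  le_antisymm (annihilator_le_of_equiv e) (annihilator_le_of_equiv e.symm)

theorem injective_of_ne_zero {φ : RhoInvariants K ρ π} (hφ : φ ≠ 0) : Function.Injective φ :=
  have := ρ.irreducible
  (Representation.IsIrreducible.injective_or_eq_zero φ).resolve_right hφ

theorem smul_complex (a : ℂ) (f : HeckeAlgebra K ρ) (φ : RhoInvariants K ρ π) (w : ρ.V) :
    ((a • f) • φ) w = a • (f • φ) w := by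
  rw [smul_apply, smul_apply]
  have := cosetSum_map (K := K.toSubgroup)
    (F := fun g => π.rep g (φ (transpose K ρ (f g) w)))
    (f.cosetFinite fun g hg => by simp [hg])
    (DistribSMul.toAddMonoidHom π.V a)
  simp only [DistribSMul.toAddMonoidHom_apply] at this
  rw [this]
  congr 1; funext g
  rw [HeckeAlgebra.smul_apply, map_smul, LinearMap.smul_apply]
  have h1 := map_smul φ.toLinearMap a (transpose K ρ (f g) w)
  simp only [Representation.IntertwiningMap.toLinearMap_apply] at h1
  rw [h1, map_smul]

/-- Since `φ` is injective and `π` irreducible, `ψ` is a combination of maps `π(g) ∘ φ ∘ R`.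
Averaging over `K` fixes `ψ` and sends each such map to `heckeSingle g T • φ`, with `Tᵗ = R`. -/
theorem exists_smul_eq {φ : RhoInvariants K ρ π} (hφ : φ ≠ 0) (ψ : RhoInvariants K ρ π) :
    ∃ f : HeckeAlgebra K ρ, f • φ = ψ := by
  have := nontrivial_of_isIrreducible ρ.irreducible
  obtain ⟨w, hw⟩ := exists_ne (0 : ρ.V)
  have hφw : φ w ≠ 0 := fun h =>
    hw (injective_of_ne_zero hφ (h.trans (map_zero φ.toLinearMap).symm))
  have hmem := mem_span_comp_of_range_le π.rep (fun _ : Unit => φ.toLinearMap) ψ.toLinearMap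
    fun u => by
      have : ψ u ∈ (⊤ : Submodule ℂ π.V) := trivial
      rw [← span_orbit_eq_top π.irreducible hφw] at this
      refine Submodule.span_mono ?_ this
      rintro _ ⟨g, rfl⟩
      exact ⟨g, (), w, rfl⟩
  suffices ∀ T ∈ Submodule.span ℂ {S | ∃ (g : G) (_ : Unit) (R : Module.End ℂ ρ.V),
      S = π.rep g ∘ₗ φ.toLinearMap ∘ₗ R}, ∃ f : HeckeAlgebra K ρ,
      f • φ = avgMap ρ.smooth (π.smooth.restrict K.toSubgroup) T by
    obtain ⟨f, hf⟩ := this _ hmem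
    exact ⟨f, hf.trans (avgMap_intertwining _ _ ψ)⟩
  intro T hT
  induction hT using Submodule.span_induction with
  | mem T hT =>
    obtain ⟨g, -, R, rfl⟩ := hT
    obtain ⟨R, rfl⟩ := transpose_surjective R
    exact ⟨heckeSingle g R, heckeSingle_smul g R φ⟩
  | zero => exact ⟨0, by rw [zero_smul, avgMap_zero]⟩
  | add S T _ _ hS hT =>
    obtain ⟨f, hf⟩ := hS
    obtain ⟨h, hh⟩ := hT
    exact ⟨f + h, by rw [add_smul, hf, hh, avgMap_add]⟩
  | smul a T _ hT =>
    obtain ⟨f, hf⟩ := hT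
    refine ⟨a • f, DFunLike.ext _ _ fun w => ?_⟩
    rw [avgMap_smul, ← hf, smul_complex]

theorem isSimpleModule [Nontrivial (RhoInvariants K ρ π)] :
    IsSimpleModule (HeckeAlgebra K ρ) (RhoInvariants K ρ π) :=
  isSimpleModule_iff_toSpanSingleton_surjective.2 ⟨inferInstance, fun _ hφ ψ =>
    exists_smul_eq hφ ψ⟩

end RhoInvariants

/-- `K` acts completely reducibly, so `ρ` is a subrepresentation of `π|_K` exactly when it is a
quotient. This reconciles the `Hom_K(π|_K, ρ)` that defines `fellBasic` with the `Hom_K(ρ, π|_K)`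
that carries the module structure. -/
theorem nontrivial_rhoInvariants_iff : Nontrivial (RhoInvariants K ρ π) ↔
    ∃ φ : (restrict π.rep K.toSubgroup).IntertwiningMap ρ.rep, φ ≠ 0 := by
  have := ρ.irreducible
  have := nontrivial_of_isIrreducible ρ.irreducible
  obtain ⟨w, hw⟩ := exists_ne (0 : ρ.V)
  constructor
  · intro h
    obtain ⟨φ, hφ⟩ := exists_ne (0 : RhoInvariants K ρ π)
    obtain ⟨q, hq⟩ := exists_intertwining_leftInverse ρ.smooth
      (π.smooth.restrict K.toSubgroup) φ (RhoInvariants.injective_of_ne_zero hφ)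
    exact ⟨q, fun h0 => hw (by rw [← hq w, h0]; rfl)⟩
  · rintro ⟨φ, hφ⟩
    obtain ⟨s, hs⟩ := exists_intertwining_rightInverse (π.smooth.restrict K.toSubgroup) ρ.smooth φ
      ((Representation.IsIrreducible.surjective_or_eq_zero φ).resolve_right hφ)
    refine ⟨s, 0, fun h0 => hw ?_⟩
    rw [← hs w, h0]
    exact map_zero φ.toLinearMap

theorem mem_fellBasic_iff : π.toClass ∈ fellBasic K ρ ↔ Nontrivial (RhoInvariants K ρ π) := by
  constructor
  · rintro ⟨σ, hσ, φ, hφ⟩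
    obtain ⟨e⟩ : Nonempty (σ.rep.Equiv π.rep) := Quotient.exact hσ
    have := nontrivial_rhoInvariants_iff.2 ⟨φ, hφ⟩
    obtain ⟨ψ, hψ⟩ := exists_ne (0 : RhoInvariants K ρ σ)
    refine ⟨RhoInvariants.map e.toIntertwiningMap ψ, 0, fun h => hψ (DFunLike.ext _ _ fun w => ?_)⟩
    have h1 : e.toIntertwiningMap (ψ w) = 0 := DFunLike.congr_fun h w
    exact e.toLinearEquiv.map_eq_zero_iff.1 h1
  · intro h
    obtain ⟨φ, hφ⟩ := nontrivial_rhoInvariants_iff.1 h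
    exact ⟨π, rfl, φ, hφ⟩

end Simple

/-! ### The annihilator determines the representation -/

/-- A finitely cogenerated simple module is determined by its annihilator. -/
theorem nonempty_linearEquiv_of_annihilator_le {A M N ι : Type*} [Ring A] [AddCommGroup M]
    [Module A M] [AddCommGroup N] [Module A N] [IsSimpleModule A M] [IsSimpleModule A N] [Finite ι]
    (m : ι → M) (hm : ∀ a : A, (∀ i, a • m i = 0) → a ∈ Module.annihilator A M)
    (h : Module.annihilator A M ≤ Module.annihilator A N) : Nonempty (M ≃ₗ[A] N) := by
  classical
  have := IsSimpleModule.nontrivial A N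
  have := Fintype.ofFinite ι
  obtain ⟨n, hn⟩ := exists_ne (0 : N)
  let f : A →ₗ[A] (ι → M) := LinearMap.pi fun i => LinearMap.toSpanSingleton A M (m i)
  let g : A →ₗ[A] N := LinearMap.toSpanSingleton A N n
  have hfg : LinearMap.ker f ≤ LinearMap.ker g := fun a ha => by
    have ha : ∀ i, a • m i = 0 := fun i => congrFun (LinearMap.mem_ker.1 ha) i
    exact Module.mem_annihilator.1 (h (hm a ha)) n
  -- `A / ker f` embeds in the semisimple module `ι → M` and, by `hm` and `h`, maps to `N` by `1 ↦
  -- n`. The extension `E` of this map is non-zero on some factor `M`, and there Schur's lemma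
  -- applies.
  obtain ⟨E, hE⟩ := IsSemisimpleModule.extension_property ((LinearMap.ker f).liftQ f le_rfl)
    (LinearMap.ker_eq_bot.1 (Submodule.ker_liftQ_eq_bot _ _ _ le_rfl))
    ((LinearMap.ker f).liftQ g hfg)
  have hE1 : E (f 1) = n := by
    have := LinearMap.congr_fun hE (Submodule.Quotient.mk 1)
    simpa [g] using this
  have : ∃ i, E ∘ₗ LinearMap.single A (fun _ => M) i ≠ 0 := by
    by_contra! H
    refine hn ?_
    rw [← hE1, ← LinearMap.sum_single_apply (fun _ : ι => M) (f 1), map_sum]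
    exact Finset.sum_eq_zero fun i _ => LinearMap.congr_fun (H i) _
  obtain ⟨i, hi⟩ := this
  exact ⟨LinearEquiv.ofBijective _ ((LinearMap.bijective_or_eq_zero _).resolve_right hi)⟩

section Injective

variable {G : Type u} [Group G] [TopologicalSpace G] [IsTopologicalGroup G]
  {K : CompactOpenSubgroup G} {ρ : SmoothIrrep K.toSubgroup} {π σ : SmoothIrrep G}

/-- The kernel of `ρ`, as a compact open subgroup of `G`. -/
def kernelSubgroup (ρ : SmoothIrrep K.toSubgroup) : CompactOpenSubgroup G where
  toSubgroup := ρ.rep.ker.map K.toSubgroup.subtype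
  isOpen := K.isOpen.isOpenEmbedding_subtypeVal.isOpenMap _ (isOpen_ker_rep K ρ)
  isCompact := ((Subgroup.isClosed_of_isOpen ρ.rep.ker (isOpen_ker_rep K ρ)).isCompact).image
    continuous_subtype_val

theorem RhoInvariants.mem_invariants (φ : RhoInvariants K ρ π) (w : ρ.V) :
    φ w ∈ (restrict π.rep (kernelSubgroup ρ).toSubgroup).invariants := by
  rintro ⟨_, k, hk, rfl⟩
  have h := Representation.IntertwiningMap.isIntertwining _ _ φ k w
  have hk : ρ.rep k = 1 := hk
  rw [hk] at h
  exact h.symm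

/-- Invariants take values in the vectors fixed by the kernel of `ρ`, a compact open subgroup of
`G`, and tameness makes that space finite-dimensional. -/
theorem RhoInvariants.finiteDimensional (hT : IsTame G) (π : SmoothIrrep G) :
    FiniteDimensional ℂ (RhoInvariants K ρ π) := by
  have := (hT π).2 (kernelSubgroup ρ).toSubgroup (kernelSubgroup ρ).isOpen
    (kernelSubgroup ρ).isCompact
  let F : RhoInvariants K ρ π →ₗ[ℂ]
      ρ.V →ₗ[ℂ] (restrict π.rep (kernelSubgroup ρ).toSubgroup).invariants :=
    { toFun := fun φ => φ.toLinearMap.codRestrict _ φ.mem_invariants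
      map_add' := fun φ ψ => rfl
      map_smul' := fun a φ => rfl }
  refine FiniteDimensional.of_injective F fun φ ψ h => DFunLike.ext _ _ fun w => ?_
  exact congrArg Subtype.val (LinearMap.congr_fun h w)

theorem RhoInvariants.smul_complex_comm (a : ℂ) (f : HeckeAlgebra K ρ) (φ : RhoInvariants K ρ π) :
    f • (a • φ) = a • (f • φ) := by
  refine DFunLike.ext _ _ fun w => ?_
  change (f • (a • φ)) w = a • (f • φ) w
  rw [smul_apply, smul_apply]
  refine Eq.trans ?_ (cosetSum_map (f.cosetFinite fun g hg => by simp [hg])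
    (DistribSMul.toAddMonoidHom π.V a)).symm
  congr 1; funext g
  exact map_smul (π.rep g) a _

/-- The subrepresentation of `π × σ` generated by the graph of the relation `φ w ↦ ψ w`. -/
def graphSubrepresentation (φ : RhoInvariants K ρ π) (ψ : RhoInvariants K ρ σ) :
    Subrepresentation (π.rep.prod σ.rep) where
  toSubmodule := Submodule.span ℂ {z | ∃ (g : G) (_ : Unit) (w : ρ.V),
    z = π.rep.prod σ.rep g (φ.toLinearMap.prod ψ.toLinearMap w)}
  apply_mem_toSubmodule g z hz := by
    induction hz using Submodule.span_induction with
    | mem z hz =>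
      obtain ⟨k, _, w, rfl⟩ := hz
      refine Submodule.subset_span ⟨g * k, (), w, ?_⟩
      rw [map_mul]; rfl
    | zero => rw [map_zero]; exact zero_mem _
    | add y z _ _ hy hz => rw [map_add]; exact add_mem hy hz
    | smul a y _ hy => rw [map_smul]; exact Submodule.smul_mem _ _ hy

/-- If the annihilator of `φ` kills `ψ`, the graph contains no vector `(0, y)` with `y ≠ 0`. -/
theorem eq_zero_of_mem_graph (φ : RhoInvariants K ρ π) (ψ : RhoInvariants K ρ σ) (hψ : ψ ≠ 0)
    (h : ∀ f : HeckeAlgebra K ρ, f • φ = 0 → f • ψ = 0) (y : σ.V)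
    (hy : ((0 : π.V), y) ∈ (graphSubrepresentation φ ψ).toSubmodule) : y = 0 := by
  by_contra hy0
  set D := (graphSubrepresentation φ ψ).toSubmodule
  -- The `x` with `(0, x) ∈ D` form a `G`-stable subspace of the irreducible `σ`, so one non-zero
  -- `y` puts all of `0 × σ` into `D`.
  have hall : ∀ x : σ.V, ((0 : π.V), x) ∈ D := fun x => by
    have hx : x ∈ (⊤ : Submodule ℂ σ.V) := trivial
    rw [← span_orbit_eq_top σ.irreducible hy0] at hx
    refine (Submodule.span_le (p := D.comap (LinearMap.inr ℂ π.V σ.V))).2 ?_ hx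
    rintro _ ⟨g, rfl⟩
    have := (graphSubrepresentation φ ψ).apply_mem_toSubmodule g hy
    rwa [Representation.prod_apply_apply, map_zero] at this
  have hmem := mem_span_comp_of_range_le (π.rep.prod σ.rep)
    (fun _ : Unit => φ.toLinearMap.prod ψ.toLinearMap)
    (LinearMap.inr ℂ π.V σ.V ∘ₗ ψ.toLinearMap) fun w => hall _
  -- The map `w ↦ (0, ψ w)` is a combination of maps `g ∘ (φ, ψ) ∘ R`. Averaging both components
  -- yields one `f` with `f • φ = 0` and `f • ψ = ψ`, contradicting `h` and `hψ`.
  suffices ∀ T ∈ Submodule.span ℂ {S | ∃ (g : G) (_ : Unit) (R : Module.End ℂ ρ.V),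
      S = π.rep.prod σ.rep g ∘ₗ φ.toLinearMap.prod ψ.toLinearMap ∘ₗ R}, ∃ f : HeckeAlgebra K ρ,
      f • φ = avgMap ρ.smooth (π.smooth.restrict K.toSubgroup) (LinearMap.fst ℂ _ _ ∘ₗ T) ∧
      f • ψ = avgMap ρ.smooth (σ.smooth.restrict K.toSubgroup) (LinearMap.snd ℂ _ _ ∘ₗ T) by
    obtain ⟨f, hf, hf'⟩ := this _ hmem
    rw [← LinearMap.comp_assoc, LinearMap.fst_comp_inr, LinearMap.zero_comp, avgMap_zero] at hf
    rw [← LinearMap.comp_assoc, LinearMap.snd_comp_inr, LinearMap.id_comp, avgMap_intertwining,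
      h f hf] at hf'
    exact hψ hf'.symm
  intro T hT
  induction hT using Submodule.span_induction with
  | mem T hT =>
    obtain ⟨g, -, R, rfl⟩ := hT
    obtain ⟨R, rfl⟩ := transpose_surjective R
    exact ⟨heckeSingle g R, heckeSingle_smul g R φ, heckeSingle_smul g R ψ⟩
  | zero =>
    exact ⟨0, by rw [zero_smul, LinearMap.comp_zero, avgMap_zero],
      by rw [zero_smul, LinearMap.comp_zero, avgMap_zero]⟩
  | add S T _ _ hS hT =>
    obtain ⟨f, hf, hf'⟩ := hS
    obtain ⟨l, hl, hl'⟩ := hT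
    exact ⟨f + l, by rw [add_smul, hf, hl, LinearMap.comp_add, avgMap_add],
      by rw [add_smul, hf', hl', LinearMap.comp_add, avgMap_add]⟩
  | smul a T _ hT =>
    obtain ⟨f, hf, hf'⟩ := hT
    refine ⟨a • f, DFunLike.ext _ _ fun w => ?_, DFunLike.ext _ _ fun w => ?_⟩
    · rw [LinearMap.comp_smul, avgMap_smul, ← hf, RhoInvariants.smul_complex]
    · rw [LinearMap.comp_smul, avgMap_smul, ← hf', RhoInvariants.smul_complex]

/-- `φ` and `θ φ` have the same annihilator, so `eq_zero_of_mem_graph` applies in both directions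
and both projections of the generated graph are injective. They are non-zero maps to irreducible
representations, hence surjective, and the graph is that of an isomorphism. -/
theorem nonempty_equiv_of_linearEquiv [Nontrivial (RhoInvariants K ρ π)]
    (θ : RhoInvariants K ρ π ≃ₗ[HeckeAlgebra K ρ] RhoInvariants K ρ σ) :
    Nonempty (π.rep.Equiv σ.rep) := by
  obtain ⟨φ, hφ⟩ := exists_ne (0 : RhoInvariants K ρ π)
  have hψ : θ φ ≠ 0 := by simpa using hφ
  set ψ := θ φ with hψ'
  have h1 : ∀ f : HeckeAlgebra K ρ, f • φ = 0 → f • ψ = 0 := fun f hf => by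
    rw [hψ', ← map_smul, hf, map_zero]
  have h2 : ∀ f : HeckeAlgebra K ρ, f • ψ = 0 → f • φ = 0 := fun f hf => by
    rw [hψ', ← map_smul] at hf
    exact θ.map_eq_zero_iff.1 hf
  let D := graphSubrepresentation φ ψ
  have hmem : ∀ w, (φ w, ψ w) ∈ D.toSubmodule := fun w =>
    Submodule.subset_span ⟨1, (), w, by simp⟩
  have hswap : ∀ z ∈ D.toSubmodule, z.swap ∈ (graphSubrepresentation ψ φ).toSubmodule := by
    intro z hz
    refine (Submodule.span_le (p := Submodule.comap (LinearEquiv.prodComm ℂ π.V σ.V).toLinearMap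
      (graphSubrepresentation ψ φ).toSubmodule)).2 ?_ hz
    rintro _ ⟨g, _, w, rfl⟩
    exact Submodule.subset_span ⟨g, (), w, rfl⟩
  let p : D.toRepresentation.IntertwiningMap π.rep :=
    { toLinearMap := LinearMap.fst ℂ _ _ ∘ₗ D.toSubmodule.subtype
      isIntertwining' := fun g => rfl }
  let q : D.toRepresentation.IntertwiningMap σ.rep :=
    { toLinearMap := LinearMap.snd ℂ _ _ ∘ₗ D.toSubmodule.subtype
      isIntertwining' := fun g => rfl }
  have := π.irreducible
  have := σ.irreducible
  have := nontrivial_of_isIrreducible ρ.irreducible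
  obtain ⟨w, hw⟩ := exists_ne (0 : ρ.V)
  have hp : Function.Bijective p := by
    constructor
    · refine (injective_iff_map_eq_zero p.toLinearMap).2 ?_
      rintro ⟨⟨x, y⟩, hxy⟩ (h0 : x = 0)
      subst h0
      have := eq_zero_of_mem_graph φ ψ hψ h1 y hxy
      subst this; rfl
    · refine (Representation.IsIrreducible.surjective_or_eq_zero p).resolve_right fun h0 => hw ?_
      have : φ w = 0 := DFunLike.congr_fun h0 ⟨_, hmem w⟩
      exact RhoInvariants.injective_of_ne_zero hφ (this.trans (map_zero φ.toLinearMap).symm)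
  have hq : Function.Bijective q := by
    constructor
    · refine (injective_iff_map_eq_zero q.toLinearMap).2 ?_
      rintro ⟨⟨x, y⟩, hxy⟩ (h0 : y = 0)
      subst h0
      have := eq_zero_of_mem_graph ψ φ hφ h2 x (hswap _ hxy)
      subst this; rfl
    · refine (Representation.IsIrreducible.surjective_or_eq_zero q).resolve_right fun h0 => hw ?_
      have : ψ w = 0 := DFunLike.congr_fun h0 ⟨_, hmem w⟩
      exact RhoInvariants.injective_of_ne_zero hψ (this.trans (map_zero ψ.toLinearMap).symm)
  exact ⟨(p.ofBijective hp).symm.trans (q.ofBijective hq)⟩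

/-- Over a tame group, irreducible representations with non-zero `ρ`-invariants are determined by
the annihilator of the module of invariants. -/
theorem nonempty_equiv_of_annihilator_eq (hT : IsTame G) [Nontrivial (RhoInvariants K ρ π)]
    [Nontrivial (RhoInvariants K ρ σ)]
    (h : Module.annihilator (HeckeAlgebra K ρ) (RhoInvariants K ρ π) =
      Module.annihilator (HeckeAlgebra K ρ) (RhoInvariants K ρ σ)) :
    Nonempty (π.rep.Equiv σ.rep) := by
  have := RhoInvariants.isSimpleModule (K := K) (ρ := ρ) (π := π)
  have := RhoInvariants.isSimpleModule (K := K) (ρ := ρ) (π := σ)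
  have := RhoInvariants.finiteDimensional (K := K) (ρ := ρ) hT π
  -- An element of the Hecke algebra that kills a finite complex basis kills the module; this is
  -- where tameness enters.
  let b := Module.finBasis ℂ (RhoInvariants K ρ π)
  obtain ⟨θ⟩ := nonempty_linearEquiv_of_annihilator_le b (fun f hf => by
    refine Module.mem_annihilator.2 fun φ => ?_
    rw [← b.sum_repr φ, Finset.smul_sum]
    exact Finset.sum_eq_zero fun i _ => by
      rw [RhoInvariants.smul_complex_comm, hf, smul_zero]) h.le
  exact nonempty_equiv_of_linearEquiv θ

end Injective

/-! ### Construction of irreducible representations -/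

section Quotient

variable {G : Type u} [Group G] [TopologicalSpace G] [IsTopologicalGroup G]

theorem isSmoothVector_iff {V : Type*} [AddCommGroup V] [Module ℂ V] {π : Representation ℂ G V}
    {v : V} : IsSmoothVector π v ↔ ∀ᶠ g in nhds 1, π g v = v := by
  constructor
  · intro h
    exact h.mem_nhds (by simp)
  · intro h
    refine isOpen_iff_mem_nhds.2 fun g hg => ?_
    have hg : π g v = v := hg
    have hc : Filter.Tendsto (fun x => g⁻¹ * x) (nhds g) (nhds 1) := by
      have := (continuous_const_mul g⁻¹).tendsto g
      rwa [inv_mul_cancel] at this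
    filter_upwards [hc.eventually h] with x hx
    rw [← mul_inv_cancel_left g x, map_mul, Module.End.mul_apply, hx, hg]

/-- A smooth vector outside a subrepresentation survives in an irreducible smooth subquotient. -/
theorem exists_smoothIrrep_of_notMem {X₀ : Type u} [AddCommGroup X₀] [Module ℂ X₀]
    (τ : Representation ℂ G X₀) {x₀ : X₀} (hx₀ : IsSmoothVector τ x₀) (Y : Subrepresentation τ)
    (hY : x₀ ∉ Y.toSubmodule) :
    ∃ (π : SmoothIrrep G) (X : Subrepresentation τ) (hX : x₀ ∈ X.toSubmodule)
      (P : X.toRepresentation.IntertwiningMap π.rep), P ⟨x₀, hX⟩ ≠ 0 ∧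
      ∀ y : X.toSubmodule, (y : X₀) ∈ Y.toSubmodule → P y = 0 := by
  let X : Subrepresentation τ :=
    { toSubmodule := Submodule.span ℂ (Set.range fun g => τ g x₀)
      apply_mem_toSubmodule := fun g v hv => by
        induction hv using Submodule.span_induction with
        | mem y hy =>
          obtain ⟨k, rfl⟩ := hy
          exact Submodule.subset_span ⟨g * k, by simp⟩
        | zero => rw [map_zero]; exact zero_mem _
        | add y z _ _ hy hz => rw [map_add]; exact add_mem hy hz
        | smul a y _ hy => rw [map_smul]; exact Submodule.smul_mem _ _ hy }
  have hX : x₀ ∈ X.toSubmodule := Submodule.subset_span ⟨1, by simp⟩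
  have hXs : ∀ x ∈ X.toSubmodule, IsSmoothVector τ x := fun x hx => by
    induction hx using Submodule.span_induction with
    | mem y hy =>
      obtain ⟨k, rfl⟩ := hy
      have hc : Filter.Tendsto (fun x => k⁻¹ * x * k) (nhds 1) (nhds 1) := by
        have : Continuous fun x => k⁻¹ * x * k := by fun_prop
        simpa using this.tendsto 1
      refine isSmoothVector_iff.2 ?_
      filter_upwards [hc.eventually (isSmoothVector_iff.1 hx₀)] with x hx
      have : x * k = k * (k⁻¹ * x * k) := by group
      change τ x (τ k x₀) = τ k x₀
      rw [← Module.End.mul_apply, ← map_mul, this, map_mul, Module.End.mul_apply, hx]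
    | zero => simp [isSmoothVector_iff]
    | add y z _ _ hy hz =>
      refine isSmoothVector_iff.2 ?_
      filter_upwards [isSmoothVector_iff.1 hy, isSmoothVector_iff.1 hz] with g h1 h2
      rw [map_add, h1, h2]
    | smul a y _ hy =>
      refine isSmoothVector_iff.2 ?_
      filter_upwards [isSmoothVector_iff.1 hy] with g h1
      rw [map_smul, h1]
  -- `Z` is maximal among the stable subspaces of `X₀` that contain `Y` and miss `x₀`; the
  -- representation sought is the image of the span `X` of the orbit of `x₀` in the quotient by `Z`.
  obtain ⟨Z, hYZ, hZ⟩ := zorn_le_nonempty₀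
    {Z : Submodule ℂ X₀ | (∀ g, ∀ z ∈ Z, τ g z ∈ Z) ∧ x₀ ∉ Z} (by
      intro c hc hchain Z₀ hZ₀
      refine ⟨sSup c, ⟨fun g z hz => ?_, fun hx => ?_⟩, fun Z hZ => le_sSup hZ⟩
      · obtain ⟨Z, hZ, hzZ⟩ := (Submodule.mem_sSup_of_directed ⟨Z₀, hZ₀⟩ hchain.directedOn).1 hz
        exact (le_sSup hZ : Z ≤ sSup c) ((hc hZ).1 g z hzZ)
      · obtain ⟨Z, hZ, hxZ⟩ := (Submodule.mem_sSup_of_directed ⟨Z₀, hZ₀⟩ hchain.directedOn).1 hx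
        exact (hc hZ).2 hxZ) Y.toSubmodule ⟨fun g z hz => Y.apply_mem_toSubmodule g hz, hY⟩
  let Z' : Submodule ℂ X.toSubmodule := Z.comap X.toSubmodule.subtype
  let q : Representation ℂ G (X.toSubmodule ⧸ Z') :=
    X.toRepresentation.quotient Z' fun g x hx => hZ.prop.1 g _ hx
  have hq : ∀ g (x : X.toSubmodule), q g (Submodule.Quotient.mk x) =
      Submodule.Quotient.mk (X.toRepresentation g x) := fun g x => rfl
  have hmk : ∀ x : X.toSubmodule, (Submodule.Quotient.mk x : X.toSubmodule ⧸ Z') = 0 ↔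
      (x : X₀) ∈ Z := fun x => Submodule.Quotient.mk_eq_zero _
  have hx0 : (Submodule.Quotient.mk ⟨x₀, hX⟩ : X.toSubmodule ⧸ Z') ≠ 0 := fun h =>
    hZ.prop.2 ((hmk _).1 h)
  have hirr : q.IsIrreducible := by
    refine { exists_pair_ne := ⟨⊥, ⊤, fun h => hx0 ?_⟩, eq_bot_or_eq_top := fun U => ?_ }
    · have : (Submodule.Quotient.mk ⟨x₀, hX⟩ : X.toSubmodule ⧸ Z') ∈
        (⊤ : Subrepresentation q).toSubmodule := Submodule.mem_top
      rw [← h] at this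
      exact this
    · by_cases hU : (Submodule.Quotient.mk ⟨x₀, hX⟩ : X.toSubmodule ⧸ Z') ∈ U.toSubmodule
      · right
        apply Subrepresentation.toSubmodule_injective
        refine eq_top_iff.2 fun v _ => ?_
        obtain ⟨⟨x, hx⟩, rfl⟩ := Submodule.Quotient.mk_surjective _ v
        have hle : X.toSubmodule ≤
            (U.toSubmodule.comap Z'.mkQ).map X.toSubmodule.subtype := by
          refine Submodule.span_le.2 ?_
          rintro _ ⟨g, rfl⟩
          exact ⟨X.toRepresentation g ⟨x₀, hX⟩, U.apply_mem_toSubmodule g hU, rfl⟩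
        obtain ⟨x', hx', hxx⟩ := hle hx
        have : x' = ⟨x, hx⟩ := Subtype.ext hxx
        subst this
        exact hx'
      · left
        -- If `U` misses the class of `x₀`, then `Z` enlarged by the preimage of `U` still misses
        -- `x₀`; maximality forces it back into `Z`, so `U = 0`.
        let Z₁ : Submodule ℂ X₀ := Z ⊔ (U.toSubmodule.comap Z'.mkQ).map X.toSubmodule.subtype
        have hZ₁ : Z₁ ≤ Z := by
          refine hZ.le_of_ge ⟨fun g z hz => ?_, fun hx => ?_⟩ le_sup_left
          · obtain ⟨z, hzZ, _, ⟨x, hx, rfl⟩, rfl⟩ := Submodule.mem_sup.1 hz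
            rw [map_add]
            exact Submodule.add_mem_sup (hZ.prop.1 g z hzZ)
              ⟨X.toRepresentation g x, U.apply_mem_toSubmodule g hx, rfl⟩
          · obtain ⟨z, hz, _, ⟨x, hx, rfl⟩, hzx⟩ := Submodule.mem_sup.1 hx
            refine hU ?_
            have : (Submodule.Quotient.mk ⟨x₀, hX⟩ : X.toSubmodule ⧸ Z') =
                Submodule.Quotient.mk x := by
              rw [← sub_eq_zero, ← Submodule.Quotient.mk_sub, hmk]
              have : x₀ - x = z := by rw [← hzx]; simp
              simpa [this] using hz
            rw [this]
            exact hx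
        apply Subrepresentation.toSubmodule_injective
        refine eq_bot_iff.2 fun v hv => ?_
        obtain ⟨x, rfl⟩ := Submodule.Quotient.mk_surjective _ v
        exact (hmk x).2 (hZ₁ (Submodule.mem_sup_right ⟨x, hv, rfl⟩))
  have hsm : IsSmooth q := fun v => by
    obtain ⟨x, rfl⟩ := Submodule.Quotient.mk_surjective _ v
    refine isSmoothVector_iff.2 ?_
    filter_upwards [isSmoothVector_iff.1 (hXs _ x.2)] with g hg
    rw [hq]
    congr 1
    exact Subtype.ext hg
  refine ⟨⟨X.toSubmodule ⧸ Z', q, hsm, hirr⟩, X, hX, ⟨Z'.mkQ, fun g => rfl⟩, hx0, fun y hy => ?_⟩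
  exact (hmk y).2 (hYZ hy)

end Quotient

/-! ### Every primitive ideal comes from a representation. -/

section Surjective

variable {G : Type u} [Group G] [TopologicalSpace G] [IsTopologicalGroup G]
  {K : CompactOpenSubgroup G} {ρ : SmoothIrrep K.toSubgroup}

/-- Left translation of functions on a group. -/
def leftTranslation (G W : Type*) [Group G] [AddCommGroup W] [Module ℂ W] :
    Representation ℂ G (G → W) where
  toFun g :=
    { toFun := fun F x => F (g⁻¹ * x)
      map_add' := fun _ _ => rfl
      map_smul' := fun _ _ => rfl }
  map_one' := by ext F x; simp
  map_mul' g h := by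
    ext F x
    simp [mul_assoc]

theorem leftTranslation_apply {G W : Type*} [Group G] [AddCommGroup W] [Module ℂ W] (g x : G)
    (F : G → W) : leftTranslation G W g F x = F (g⁻¹ * x) := rfl

/-- The function `x ↦ h(x)ᵗ w` attached to an element of the Hecke algebra and a vector. -/
def heckeFun (h : HeckeAlgebra K ρ) : ρ.V →ₗ[ℂ] G → ρ.V where
  toFun w x := transpose K ρ (h x) w
  map_add' _ _ := by ext x; simp
  map_smul' _ _ := by ext x; simp

theorem heckeFun_apply (h : HeckeAlgebra K ρ) (w : ρ.V) (x : G) :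
    heckeFun h w x = transpose K ρ (h x) w := rfl

theorem heckeFun_rep (k : K.toSubgroup) (w : ρ.V) :
    heckeFun (1 : HeckeAlgebra K ρ) (ρ.rep k w) =
      leftTranslation G ρ.V k (heckeFun (1 : HeckeAlgebra K ρ) w) := by
  funext x
  have := (1 : HeckeAlgebra K ρ).map_left k⁻¹ x
  simp only [InvMemClass.coe_inv] at this
  rw [leftTranslation_apply, heckeFun_apply, heckeFun_apply, this, transpose_mul, transpose_dual,
    inv_inv]
  rfl

theorem heckeFun_injective {f h : HeckeAlgebra K ρ} (H : ∀ w, heckeFun f w = heckeFun h w) :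
    f = h := by
  ext1 g
  ext ξ w
  rw [← apply_transpose, ← apply_transpose]
  exact congrArg ξ (congrFun (H w) g)

theorem isSmoothVector_heckeFun (w : ρ.V) :
    IsSmoothVector (leftTranslation G ρ.V) (heckeFun (1 : HeckeAlgebra K ρ) w) := by
  refine isSmoothVector_iff.2 ?_
  have h1 : IsOpen ((↑) '' {k : K.toSubgroup | ρ.rep k = 1} : Set G) :=
    K.isOpen.isOpenEmbedding_subtypeVal.isOpenMap _ (isOpen_ker_rep K ρ)
  filter_upwards [h1.mem_nhds ⟨1, map_one ρ.rep, rfl⟩] with g hg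
  obtain ⟨k, hk, rfl⟩ := hg
  have hk : ρ.rep k = 1 := hk
  rw [← heckeFun_rep, hk]; rfl

/-- The subrepresentation generated by the functions attached to elements of a left ideal. -/
def idealSubrepresentation (I : Ideal (HeckeAlgebra K ρ)) :
    Subrepresentation (leftTranslation G ρ.V) where
  toSubmodule := Submodule.span ℂ {y | ∃ (g : G) (h : I) (w : ρ.V),
    y = leftTranslation G ρ.V g (heckeFun (h : HeckeAlgebra K ρ) w)}
  apply_mem_toSubmodule g z hz := by
    induction hz using Submodule.span_induction with
    | mem z hz =>
      obtain ⟨k, h, w, rfl⟩ := hz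
      refine Submodule.subset_span ⟨g * k, h, w, ?_⟩
      rw [map_mul]; rfl
    | zero => rw [map_zero]; exact zero_mem _
    | add y z _ _ hy hz => rw [map_add]; exact add_mem hy hz
    | smul a y _ hy => rw [map_smul]; exact Submodule.smul_mem _ _ hy

/-- Passing from `I` to its `G`-span of functions loses nothing: averaging over `K` turns a
combination of translates of functions from `I` back into a function attached to an element of `I`.
-/
theorem one_mem_of_heckeFun_mem (I : Ideal (HeckeAlgebra K ρ)) {w₀ : ρ.V} (hw₀ : w₀ ≠ 0)
    (h : heckeFun (1 : HeckeAlgebra K ρ) w₀ ∈ (idealSubrepresentation I).toSubmodule) :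
    (1 : HeckeAlgebra K ρ) ∈ I := by
  have hall : ∀ w, heckeFun (1 : HeckeAlgebra K ρ) w ∈ (idealSubrepresentation I).toSubmodule := by
    intro w
    have hw : w ∈ (⊤ : Submodule ℂ ρ.V) := trivial
    rw [← span_orbit_eq_top ρ.irreducible hw₀] at hw
    refine (Submodule.span_le
      (p := (idealSubrepresentation I).toSubmodule.comap (heckeFun 1))).2 ?_ hw
    rintro _ ⟨k, rfl⟩
    change heckeFun 1 (ρ.rep k w₀) ∈ (idealSubrepresentation I).toSubmodule
    rw [heckeFun_rep]
    exact (idealSubrepresentation I).apply_mem_toSubmodule _ h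
  have hmem := mem_span_comp_of_range_le (leftTranslation G ρ.V)
    (fun h : I => heckeFun (h : HeckeAlgebra K ρ)) (heckeFun 1) hall
  -- The average of a generator `g ∘ heckeFun h ∘ Rᵗ` is the function of `heckeSingle g R * h`,
  -- which lies in the left ideal `I`, while `heckeFun 1` is its own average. Local constancy is
  -- carried along so that averages can be added.
  suffices ∀ T ∈ Submodule.span ℂ {S | ∃ (g : G) (h : I) (R : Module.End ℂ ρ.V),
      S = leftTranslation G ρ.V g ∘ₗ heckeFun (h : HeckeAlgebra K ρ) ∘ₗ R}, ∃ a ∈ I, ∀ w y,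
      IsLocallyConstant (fun k : K.toSubgroup => T (ρ.rep k⁻¹ w) ((k : G)⁻¹ * y)) ∧
      heckeFun a w y = avg fun k : K.toSubgroup => T (ρ.rep k⁻¹ w) ((k : G)⁻¹ * y) by
    obtain ⟨a, ha, haT⟩ := this _ hmem
    convert ha
    refine heckeFun_injective fun w => funext fun y => ?_
    rw [(haT w y).2]
    conv_lhs => rw [← avg_const (C := K.toSubgroup) (heckeFun 1 w y)]
    congr 1; funext k
    rw [heckeFun_rep, leftTranslation_apply]
    simp
  intro T hT
  induction hT using Submodule.span_induction with
  | mem T hT =>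
    obtain ⟨g, h, R, rfl⟩ := hT
    obtain ⟨R, rfl⟩ := transpose_surjective R
    refine ⟨heckeSingle g R * h, I.mul_mem_left _ h.2, fun w y => ?_⟩
    have e : (fun k : K.toSubgroup =>
        (leftTranslation G ρ.V g ∘ₗ heckeFun (h : HeckeAlgebra K ρ) ∘ₗ transpose K ρ R)
          (ρ.rep k⁻¹ w) ((k : G)⁻¹ * y)) = fun k : K.toSubgroup =>
        transpose K ρ (ρ.rep.dual k * R * (h : HeckeAlgebra K ρ) (g⁻¹ * ((k : G)⁻¹ * y))) w := by
      funext k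
      rw [transpose_mul, transpose_mul, transpose_dual]
      rfl
    have hl := isLocallyConstant_dual_mul_mul (h : HeckeAlgebra K ρ) g y R
    rw [e, heckeFun_apply, heckeSingle_mul_apply]
    exact ⟨hl.comp fun S => transpose K ρ S w,
      map_avg hl ((LinearMap.applyₗ (R := ℂ) w) ∘ₗ transpose K ρ)⟩
  | zero =>
    exact ⟨0, I.zero_mem, fun w y => ⟨IsLocallyConstant.const 0,
      by simp [heckeFun_apply, avg_const]⟩⟩
  | add S T _ _ hS hT =>
    obtain ⟨a, ha, haS⟩ := hS
    obtain ⟨b, hb, hbT⟩ := hT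
    refine ⟨a + b, I.add_mem ha hb, fun w y => ⟨(haS w y).1.comp₂ (hbT w y).1 (· + ·), ?_⟩⟩
    refine Eq.trans ?_ (avg_add (haS w y).1 (hbT w y).1).symm
    rw [← (haS w y).2, ← (hbT w y).2]
    simp [heckeFun_apply]
  | smul c T _ hT =>
    obtain ⟨a, ha, haT⟩ := hT
    refine ⟨c • a, ?_, fun w y => ⟨(haT w y).1.comp (c • ·), ?_⟩⟩
    · rw [← one_mul a, ← smul_mul_assoc]
      exact I.mul_mem_left _ ha
    · refine Eq.trans ?_ (map_avg (haT w y).1 (LinearMap.lsmul ℂ ρ.V c))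
      rw [← (haT w y).2]
      simp [heckeFun_apply]

/-- This is the identity `h * 1 = h` after transposition. It says that `h`, acting on the
`ρ`-invariant `heckeFun 1`, produces `heckeFun h`. -/
theorem cosetSum_heckeFun (h : HeckeAlgebra K ρ) (w : ρ.V) :
    cosetSum K.toSubgroup (fun g => leftTranslation G ρ.V g
      (heckeFun (1 : HeckeAlgebra K ρ) (transpose K ρ (h g) w))) = heckeFun h w := by
  funext x
  have h1 := cosetSum_map (K := K.toSubgroup) (F := fun g => leftTranslation G ρ.V g
      (heckeFun (1 : HeckeAlgebra K ρ) (transpose K ρ (h g) w)))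
    (h.cosetFinite fun g hg => by simp [hg]) (LinearMap.proj (R := ℂ) x).toAddMonoidHom
  refine h1.trans ?_
  rw [heckeFun_apply]
  conv_rhs => rw [← mul_one h, HeckeAlgebra.mul_apply]
  refine Eq.trans ?_ (cosetSum_map (HeckeAlgebra.cosetFinite_conv h 1 x)
    ((LinearMap.applyₗ (R := ℂ) w) ∘ₗ transpose K ρ).toAddMonoidHom).symm
  congr 1; funext g
  change transpose K ρ _ _ = transpose K ρ (h g * _) w
  rw [transpose_mul]
  rfl

/-- Every proper left ideal of the Hecke algebra kills a non-zero `ρ`-invariant of some irreducible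
smooth representation. -/
theorem exists_rhoInvariant_of_ideal {I : Ideal (HeckeAlgebra K ρ)} (hI : I ≠ ⊤) :
    ∃ (π : SmoothIrrep G) (φ : RhoInvariants K ρ π), φ ≠ 0 ∧ ∀ h ∈ I, h • φ = 0 := by
  have := nontrivial_of_isIrreducible ρ.irreducible
  obtain ⟨w₀, hw₀⟩ := exists_ne (0 : ρ.V)
  obtain ⟨π, X, hX, P, hP, hPY⟩ := exists_smoothIrrep_of_notMem (leftTranslation G ρ.V)
    (isSmoothVector_heckeFun w₀) (idealSubrepresentation I)
    fun h => hI ((Ideal.eq_top_iff_one I).2 (one_mem_of_heckeFun_mem I hw₀ h))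
  have hXw : ∀ w, heckeFun (1 : HeckeAlgebra K ρ) w ∈ X.toSubmodule := fun w => by
    have hw : w ∈ (⊤ : Submodule ℂ ρ.V) := trivial
    rw [← span_orbit_eq_top ρ.irreducible hw₀] at hw
    refine (Submodule.span_le (p := X.toSubmodule.comap (heckeFun 1))).2 ?_ hw
    rintro _ ⟨k, rfl⟩
    change heckeFun 1 (ρ.rep k w₀) ∈ X.toSubmodule
    rw [heckeFun_rep]
    exact X.apply_mem_toSubmodule _ hX
  let φ : RhoInvariants K ρ π :=
    { toLinearMap := P.toLinearMap ∘ₗ (heckeFun 1).codRestrict X.toSubmodule hXw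
      isIntertwining' := fun k => by
        ext w
        have h1 := Representation.IntertwiningMap.isIntertwining _ _ P (k : G) ⟨_, hXw w⟩
        refine Eq.trans ?_ h1
        change P _ = P _
        congr 1
        exact Subtype.ext (heckeFun_rep k w) }
  have hφ : ∀ w, φ w = P ⟨_, hXw w⟩ := fun w => rfl
  refine ⟨π, φ, fun h0 => hP (DFunLike.congr_fun h0 w₀), fun h hh => DFunLike.ext _ _ fun w => ?_⟩
  -- `F` sums inside `X` to `heckeFun h w`, a vector of the subrepresentation killed by `P`;
  -- applying `P` termwise gives `(h • φ) w`.
  let F : G → X.toSubmodule := fun g => X.toRepresentation g ⟨_, hXw (transpose K ρ (h g) w)⟩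
  have hF : CosetFinite K.toSubgroup F := h.cosetFinite fun g hg => by
    have : (⟨_, hXw (transpose K ρ (h g) w)⟩ : X.toSubmodule) = 0 := Subtype.ext (by simp [hg])
    simp [F, this]
  have h1 : ((cosetSum K.toSubgroup F : X.toSubmodule) : G → ρ.V) = heckeFun h w :=
    (cosetSum_map hF X.toSubmodule.subtype.toAddMonoidHom).trans (cosetSum_heckeFun h w)
  have h2 : P (cosetSum K.toSubgroup F) = 0 := hPY _ (by
    rw [h1]
    exact Submodule.subset_span ⟨1, ⟨h, hh⟩, w, by simp⟩)
  rw [RhoInvariants.smul_apply]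
  refine Eq.trans ?_ h2
  refine Eq.trans ?_ (cosetSum_map hF P.toLinearMap.toAddMonoidHom).symm
  congr 1; funext g
  rw [hφ]
  exact (Representation.IntertwiningMap.isIntertwining _ _ P g _).symm

/-- The annihilator `I` of a non-zero `m ∈ M` is a maximal left ideal. Some non-zero `φ` is killed
by `I`, so `I` is exactly the annihilator of `φ`. As `m` and `φ` generate their modules, the two
modules have the same annihilator. -/
theorem exists_annihilator_eq (P : PrimitiveSpectrum (HeckeAlgebra K ρ)) :
    ∃ π : SmoothIrrep G, Nontrivial (RhoInvariants K ρ π) ∧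
      Module.annihilator (HeckeAlgebra K ρ) (RhoInvariants K ρ π) = P.1 := by
  obtain ⟨P, M, _, _, hM, rfl⟩ := P
  have := IsSimpleModule.nontrivial (HeckeAlgebra K ρ) M
  obtain ⟨m, hm⟩ := exists_ne (0 : M)
  have hmax := IsSimpleModule.ker_toSpanSingleton_isMaximal (HeckeAlgebra K ρ) hm
  obtain ⟨π, φ, hφ, hφI⟩ := exists_rhoInvariant_of_ideal hmax.ne_top
  refine ⟨π, ⟨φ, 0, hφ⟩, ?_⟩
  have hI : LinearMap.ker (LinearMap.toSpanSingleton (HeckeAlgebra K ρ) M m) =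
      LinearMap.ker (LinearMap.toSpanSingleton (HeckeAlgebra K ρ) (RhoInvariants K ρ π) φ) := by
    refine hmax.eq_of_le (fun h => hφ ?_) fun h hh => hφI h hh
    have : (1 : HeckeAlgebra K ρ) ∈ LinearMap.ker
      (LinearMap.toSpanSingleton (HeckeAlgebra K ρ) (RhoInvariants K ρ π) φ) := by
      rw [h]; trivial
    simpa using this
  have hI' : ∀ f : HeckeAlgebra K ρ, f • m = 0 ↔ f • φ = 0 := fun f => SetLike.ext_iff.1 hI f
  ext f
  rw [Module.mem_annihilator, Module.mem_annihilator]
  constructor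
  · intro hf n
    obtain ⟨a, rfl⟩ := IsSimpleModule.toSpanSingleton_surjective (HeckeAlgebra K ρ) hm n
    rw [LinearMap.toSpanSingleton_apply, ← mul_smul, hI', mul_smul, hf]
  · intro hf ψ
    obtain ⟨a, rfl⟩ := RhoInvariants.exists_smul_eq hφ ψ
    rw [← mul_smul, ← hI', mul_smul, hf]

end Surjective

/-! ### Non-vanishing of a Hecke operator is an open condition for the Fell topology -/

section FellOpen

open scoped Pointwise

variable {G : Type u} [Group G] [TopologicalSpace G] [IsTopologicalGroup G]

theorem isSmooth_trivial {V : Type*} [AddCommGroup V] [Module ℂ V] :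
    IsSmooth (Representation.trivial ℂ G V) := fun v => by
  simp [IsSmoothVector]

/-- The pointwise stabilizer in `K` of a finite family of vectors. -/
def fixingSubgroup {ι : Type*} [Finite ι] (K : CompactOpenSubgroup G) (π : SmoothIrrep G)
    (v : ι → π.V) : CompactOpenSubgroup G where
  carrier := {g | g ∈ K.toSubgroup ∧ ∀ i, π.rep g (v i) = v i}
  mul_mem' := fun {a b} ha hb => ⟨mul_mem ha.1 hb.1, fun i => by
    rw [map_mul, Module.End.mul_apply, hb.2, ha.2]⟩
  one_mem' := ⟨one_mem _, by simp⟩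
  inv_mem' := fun {a} ha => ⟨inv_mem ha.1, fun i => by
    conv_lhs => rw [← ha.2 i]
    exact π.rep.inv_self_apply _ _⟩
  isOpen := by
    have : {g : G | g ∈ K.toSubgroup ∧ ∀ i, π.rep g (v i) = v i} =
        (K.toSubgroup : Set G) ∩ ⋂ i, {g | π.rep g (v i) = v i} := by
      ext g; simp
    change IsOpen {g : G | g ∈ K.toSubgroup ∧ ∀ i, π.rep g (v i) = v i}
    rw [this]
    exact K.isOpen.inter (isOpen_iInter_of_finite fun i => π.smooth _)
  isCompact := by
    have : {g : G | g ∈ K.toSubgroup ∧ ∀ i, π.rep g (v i) = v i} =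
        (K.toSubgroup : Set G) ∩ ⋂ i, {g | π.rep g (v i) = v i} := by
      ext g; simp
    change IsCompact {g : G | g ∈ K.toSubgroup ∧ ∀ i, π.rep g (v i) = v i}
    rw [this]
    refine K.isCompact.inter_right (isClosed_iInter fun i => ?_)
    exact (π.smooth.isLocallyConstant (v i)).isClosed_fiber (v i)

/-- Averaging a functional over the open subgroup of `K` that stabilizes `y` makes it smooth without
changing its value at `y`. -/
theorem exists_smooth_dual_ne_zero (K : CompactOpenSubgroup G) (π : SmoothIrrep G) {y : π.V}
    (hy : y ≠ 0) : ∃ ξ : Module.Dual ℂ π.V, IsSmoothVector π.rep.dual ξ ∧ ξ y ≠ 0 := by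
  obtain ⟨l, hl⟩ := Module.Projective.exists_dual_eq_one ℂ hy
  let N := fixingSubgroup K π fun _ : Unit => y
  let ξ := avgMap (π.smooth.restrict N.toSubgroup) (isSmooth_trivial (G := N.toSubgroup)) l
  refine ⟨ξ.toLinearMap, isSmoothVector_iff.2 ?_, ?_⟩
  · filter_upwards [N.isOpen.mem_nhds (one_mem N.toSubgroup)] with g hg
    ext v
    exact Representation.IntertwiningMap.isIntertwining _ _ ξ ⟨g⁻¹, inv_mem hg⟩ v
  · have : ξ y = l y := avgMap_of_intertwining _ _ l y fun c =>
      congrArg l ((inv_mem c.2 : (c : G)⁻¹ ∈ N.toSubgroup).2 ())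
    change ξ y ≠ 0
    rw [this, hl]
    exact one_ne_zero

variable {K : CompactOpenSubgroup G} {ρ : SmoothIrrep K.toSubgroup} {π σ : SmoothIrrep G}

/-- The `ρ`-invariant obtained by averaging the rank one map `u ↦ l(u) x`. -/
def rankOneInvariant (l : Module.Dual ℂ ρ.V) (x : π.V) : RhoInvariants K ρ π :=
  avgMap ρ.smooth (π.smooth.restrict K.toSubgroup) (l.smulRight x)

theorem isLocallyConstant_coeff (l : Module.Dual ℂ ρ.V) (ζ : Module.Dual ℂ π.V) (u : ρ.V) (x : π.V)
    (g : G) : IsLocallyConstant fun k : K.toSubgroup =>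
      l (ρ.rep k⁻¹ u) * ζ (π.rep (g * k) x) :=
  ((ρ.smooth.isLocallyConstant_inv u).comp l).comp₂
    (((π.smooth.isLocallyConstant x).comp_continuous
      (f := fun k : K.toSubgroup => g * (k : G)) (by fun_prop)).comp ζ) (· * ·)

/-- The weights involve only `f`, `l`, `w` and `ρ`, so the number depends on `π` only through its
coefficient `g ↦ ζ(π(g) x)` on finitely many cosets of `K`. This makes representations of `G`
comparable in the Fell topology. -/
theorem apply_smul_rankOneInvariant (f : HeckeAlgebra K ρ) (l : Module.Dual ℂ ρ.V) (x : π.V)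
    (ζ : Module.Dual ℂ π.V) (w : ρ.V) :
    ζ ((f • rankOneInvariant l x : RhoInvariants K ρ π) w) =
      ∑ q ∈ (f.cosetFinite (F := f) fun _ h => h).toFinset, avg fun k : K.toSubgroup =>
        l (ρ.rep k⁻¹ (transpose K ρ (f q.out) w)) * ζ (π.rep (q.out * k) x) := by
  rw [RhoInvariants.smul_apply]
  refine (cosetSum_map (f.cosetFinite fun g hg => by simp [hg]) ζ.toAddMonoidHom).trans ?_
  rw [cosetSum, finsum_eq_sum_of_support_subset
    (s := (f.cosetFinite (F := f) fun _ h => h).toFinset)]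
  · refine Finset.sum_congr rfl fun q _ => ?_
    have h := map_avg (isLocallyConstant_conj ρ.smooth (π.smooth.restrict K.toSubgroup)
      (l.smulRight x) (transpose K ρ (f q.out) w)) (ζ ∘ₗ π.rep q.out)
    refine h.trans ?_
    congr 1; funext k
    simp
  · intro q hq
    by_contra h
    refine hq ?_
    have h0 : f q.out = 0 := by
      by_contra h0
      exact h (Finset.mem_coe.2 ((Set.Finite.mem_toFinset _).2 h0))
    simp [h0]

/-- The average equals `φ` composed with the average of `l ⊗ u` on `ρ`, which by Schur's lemma is
the scalar `l(u) / dim ρ`. -/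
theorem rankOneInvariant_apply (φ : RhoInvariants K ρ π) (l : Module.Dual ℂ ρ.V) (u : ρ.V)
    (hu : l u = 1) : rankOneInvariant l (φ u) = (Module.finrank ℂ ρ.V : ℂ)⁻¹ • φ := by
  refine DFunLike.ext _ _ fun w => ?_
  have h1 := avgMap_comp ρ.smooth ρ.smooth (π.smooth.restrict K.toSubgroup) (l.smulRight u) φ w
  have h2 := schur_trace ρ.irreducible (avgMap ρ.smooth ρ.smooth (l.smulRight u)) w
  rw [trace_avgMap, LinearMap.trace_smulRight, hu] at h2
  have h3 : φ.toLinearMap ∘ₗ l.smulRight u = l.smulRight (φ u) := by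
    ext v
    exact map_smul φ.toLinearMap _ _
  rw [h2, h3] at h1
  refine h1.symm.trans ?_
  rw [one_div]
  exact map_smul φ.toLinearMap _ _

/-- Take the coefficient of `π` given by `φ u₀` and a smooth `ξ` that does not vanish on `(f • φ)
w`. If `σ` has a nearby coefficient with vector `x`, then the rank one invariant of `σ` built from
`x` has nearly the same pairing with `f`, hence a non-zero one. -/
theorem exists_fellNhd_of_smul_ne_zero {f : HeckeAlgebra K ρ} {φ : RhoInvariants K ρ π}
    (hf : f • φ ≠ 0) :
    ∃ (v : Fin 1 → π.V) (ξ : Fin 1 → Module.Dual ℂ π.V) (B : Set G) (ε : ℝ),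
      (∀ j, IsSmoothVector π.rep.dual (ξ j)) ∧ IsCompact B ∧ 0 < ε ∧
      ∀ (σ : SmoothIrrep G) (w : Fin 1 → σ.V) (ζ : Fin 1 → Module.Dual ℂ σ.V),
        (∀ j, ∀ g ∈ B, ‖ξ j (π.rep g (v j)) - ζ j (σ.rep g (w j))‖ < ε) →
        ∃ ψ : RhoInvariants K ρ σ, f • ψ ≠ 0 := by
  have := nontrivial_of_isIrreducible ρ.irreducible
  have hw : ∃ w, (f • φ) w ≠ 0 := by
    by_contra! H
    exact hf (DFunLike.ext _ _ H)
  obtain ⟨w, hw⟩ := hw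
  obtain ⟨ξ, hξ, hξw⟩ := exists_smooth_dual_ne_zero K π hw
  obtain ⟨u₀, hu₀⟩ := exists_ne (0 : ρ.V)
  obtain ⟨l, hl⟩ := Module.Projective.exists_dual_eq_one ℂ hu₀
  set A := (f.cosetFinite (F := f) fun _ h => h).toFinset with hA
  have hbd : ∀ q : G ⧸ K.toSubgroup, ∃ C : ℝ, ∀ k : K.toSubgroup,
      ‖l (ρ.rep k⁻¹ (transpose K ρ (f q.out) w))‖ ≤ C := fun q => by
    have hfin := (((ρ.smooth.isLocallyConstant_inv (transpose K ρ (f q.out) w)).comp l).comp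
      norm).range_finite
    obtain ⟨C, hC⟩ := hfin.bddAbove
    exact ⟨C, fun k => hC ⟨k, rfl⟩⟩
  choose C hC using hbd
  have hC0 : ∀ q, 0 ≤ C q := fun q => (norm_nonneg _).trans (hC q 1)
  set M : ℝ := ∑ q ∈ A, C q with hM
  have hM0 : 0 ≤ M := Finset.sum_nonneg fun q _ => hC0 q
  set c : ℂ := ξ ((f • rankOneInvariant l (φ u₀) : RhoInvariants K ρ π) w) with hc
  have hc0 : c ≠ 0 := by
    rw [hc, rankOneInvariant_apply φ l u₀ hl, RhoInvariants.smul_complex_comm]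
    change ξ ((Module.finrank ℂ ρ.V : ℂ)⁻¹ • (f • φ) w) ≠ 0
    rw [map_smul, smul_eq_mul]
    refine mul_ne_zero (inv_ne_zero ?_) hξw
    exact_mod_cast (Module.finrank_pos (R := ℂ) (M := ρ.V)).ne'
  -- `M` bounds the total weight of the averages, so the pairing changes by at most `M * ε`, which
  -- is strictly less than `‖c‖`.
  obtain ⟨ε, hεc⟩ : ∃ ε, ε = ‖c‖ / (M + 1) := ⟨_, rfl⟩
  have hε : 0 < ε := hεc ▸ div_pos (norm_pos_iff.2 hc0) (by linarith)
  refine ⟨fun _ => φ u₀, fun _ => ξ, (Quotient.out '' (A : Set (G ⧸ K.toSubgroup))) * K.toSubgroup,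
    ε, fun _ => hξ, ((A.finite_toSet.image _).isCompact).mul K.isCompact, hε,
    fun σ x ζ h => ⟨rankOneInvariant l (x 0), fun h0 => ?_⟩⟩
  have h1 : ζ 0 ((f • rankOneInvariant l (x 0) : RhoInvariants K ρ σ) w) = 0 := by
    rw [h0]
    exact map_zero (ζ 0)
  rw [apply_smul_rankOneInvariant] at h1
  rw [apply_smul_rankOneInvariant] at hc
  have h2 : ‖c‖ ≤ ∑ q ∈ A, C q * ε := by
    rw [← sub_zero c, ← h1, hc, ← Finset.sum_sub_distrib]
    refine norm_sum_le_of_le _ fun q hq => ?_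
    have hl1 := isLocallyConstant_coeff l ξ (transpose K ρ (f q.out) w) (φ u₀) q.out
    have hl2 := isLocallyConstant_coeff l (ζ 0) (transpose K ρ (f q.out) w) (x 0) q.out
    rw [← avg_sub hl1 hl2]
    refine norm_avg_le (hl1.comp₂ hl2 (· - ·)) fun k => ?_
    rw [← mul_sub, norm_mul]
    exact mul_le_mul (hC q k) (h 0 _ ⟨_, ⟨q, hq, rfl⟩, _, k.2, rfl⟩).le (norm_nonneg _) (hC0 q)
  rw [← Finset.sum_mul, ← hM, hεc, mul_div_assoc', le_div_iff₀ (by linarith)] at h2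
  have := norm_pos_iff.2 hc0
  nlinarith

end FellOpen

/-! ### Irreducible restrictions to compact open subgroups -/

section Restriction

variable {G : Type u} [Group G] [TopologicalSpace G] [IsTopologicalGroup G]

/-- Compact open subgroups are directed and each point has one as a neighbourhood, so compactness
reduces the claim to finitely many of them. -/
theorem exists_compactOpenSubgroup_ge (hG : IsEllCGroup G) (K : CompactOpenSubgroup G) {B : Set G}
    (hB : IsCompact B) :
    ∃ L : CompactOpenSubgroup G, K.toSubgroup ≤ L.toSubgroup ∧ B ⊆ L.toSubgroup := by
  have hsup : ∀ L₁ L₂ : CompactOpenSubgroup G, ∃ L : CompactOpenSubgroup G,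
      L₁.toSubgroup ≤ L.toSubgroup ∧ L₂.toSubgroup ≤ L.toSubgroup := fun L₁ L₂ => by
    obtain ⟨L, ho, hc, h⟩ := hG.2 _ _ L₁.isOpen L₁.isCompact L₂.isOpen L₂.isCompact
    exact ⟨⟨L, ho, hc⟩, h⟩
  refine hB.induction_on (p := fun B => ∃ L : CompactOpenSubgroup G,
    K.toSubgroup ≤ L.toSubgroup ∧ B ⊆ L.toSubgroup) ?_ ?_ ?_ ?_
  · exact ⟨K, le_rfl, Set.empty_subset _⟩
  · rintro S T hST ⟨L, hL, hB⟩
    exact ⟨L, hL, hST.trans hB⟩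
  · rintro S T ⟨L₁, hL₁, hB₁⟩ ⟨L₂, hL₂, hB₂⟩
    obtain ⟨L, h, h'⟩ := hsup L₁ L₂
    exact ⟨L, hL₁.trans h, Set.union_subset (hB₁.trans h) (hB₂.trans h')⟩
  · intro x _
    obtain ⟨L, ho, hc, hxL⟩ := hG.1 x
    obtain ⟨M, h, h'⟩ := hsup K ⟨L, ho, hc⟩
    exact ⟨M.toSubgroup, mem_nhdsWithin_of_mem_nhds (M.isOpen.mem_nhds (h' hxL)), M, h, subset_rfl⟩

/-- The subrepresentation of the restriction to `L` generated by a subspace. -/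
def spanSubrepresentation (π : SmoothIrrep G) (L : Subgroup G) (M : Submodule ℂ π.V) :
    Subrepresentation (restrict π.rep L) where
  toSubmodule := Submodule.span ℂ {y | ∃ (l : L) (m : M), y = π.rep l m}
  apply_mem_toSubmodule g z hz := by
    induction hz using Submodule.span_induction with
    | mem z hz =>
      obtain ⟨l, m, rfl⟩ := hz
      refine Submodule.subset_span ⟨g * l, m, ?_⟩
      rw [Subgroup.coe_mul, map_mul]; rfl
    | zero => rw [map_zero]; exact zero_mem _
    | add y z _ _ hy hz => rw [map_add]; exact add_mem hy hz
    | smul a y _ hy => rw [map_smul]; exact Submodule.smul_mem _ _ hy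

theorem le_spanSubrepresentation (π : SmoothIrrep G) (L : Subgroup G) (M : Submodule ℂ π.V) :
    M ≤ (spanSubrepresentation π L M).toSubmodule := fun m hm =>
  Submodule.subset_span ⟨1, ⟨m, hm⟩, by simp⟩

theorem isSmooth_toRepresentation {V : Type*} [AddCommGroup V] [Module ℂ V]
    {π : Representation ℂ G V} (h : IsSmooth π) (U : Subrepresentation π) :
    IsSmooth U.toRepresentation := fun v => by
  refine isSmoothVector_iff.2 ?_
  filter_upwards [isSmoothVector_iff.1 (h v)] with g hg
  exact Subtype.ext hg

/-- For large `L`, each non-zero vector fixed by `N` generates all of them under `L`. -/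
theorem exists_forall_invariants_le (hG : IsEllCGroup G) (hT : IsTame G) (π : SmoothIrrep G)
    (N : CompactOpenSubgroup G) :
    ∃ L₀ : CompactOpenSubgroup G, N.toSubgroup ≤ L₀.toSubgroup ∧
      ∀ L : CompactOpenSubgroup G, L₀.toSubgroup ≤ L.toSubgroup →
        ∀ S : Subrepresentation (restrict π.rep L.toSubgroup),
          ∀ m ∈ (restrict π.rep N.toSubgroup).invariants, m ≠ 0 → m ∈ S.toSubmodule →
            (restrict π.rep N.toSubgroup).invariants ≤ S.toSubmodule := by
  classical
  set M := (restrict π.rep N.toSubgroup).invariants with hM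
  have hfd : FiniteDimensional ℂ M := (hT π).2 _ N.isOpen N.isCompact
  have htr := isSmooth_trivial (G := N.toSubgroup) (V := π.V)
  have hsm := π.smooth.restrict N.toSubgroup
  let P := avgMap htr hsm LinearMap.id
  have hPM : ∀ v, P v ∈ M := fun v n =>
    (Representation.IntertwiningMap.isIntertwining _ _ P n v).symm
  have hPm : ∀ m ∈ M, P m = m := fun m hm =>
    avgMap_of_intertwining htr hsm LinearMap.id m fun c => (hm c⁻¹).symm
  let r : G → Module.End ℂ M := fun g =>
    P.toLinearMap.codRestrict M hPM ∘ₗ π.rep g ∘ₗ M.subtype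
  -- The operators `P π(g)` on the finite-dimensional space `M` span a finite-dimensional space, so
  -- finitely many `g` already span it. A subgroup `L` containing those `g` and `N` then sees the
  -- same operators on `M` as `G` does.
  obtain ⟨s, hs, hspan⟩ := Submodule.fg_span_iff_fg_span_finset_subset (Set.range r) |>.1
    (IsNoetherian.noetherian (Submodule.span ℂ (Set.range r)))
  have hinv : ∀ a ∈ s, ∃ g, r g = a := fun a ha => hs ha
  choose! t ht using hinv
  obtain ⟨L₀, hN, hsL⟩ := exists_compactOpenSubgroup_ge hG N (s.image t).finite_toSet.isCompact
  refine ⟨L₀, hN, fun L hL S m hm hm0 hmS m' hm' => ?_⟩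
  have hPS : ∀ v ∈ S.toSubmodule, P v ∈ S.toSubmodule := fun v hv =>
    avg_mem (isLocallyConstant_conj htr hsm LinearMap.id v) S.toSubmodule fun c =>
      S.apply_mem_toSubmodule ⟨c, hL (hN c.2)⟩ hv
  have h1 : ∀ a ∈ Submodule.span ℂ (Set.range r), (a ⟨m, hm⟩ : π.V) ∈ S.toSubmodule := by
    rw [hspan]
    intro a ha
    refine (Submodule.span_le (p := S.toSubmodule.comap
      (M.subtype ∘ₗ LinearMap.applyₗ (R := ℂ) (⟨m, hm⟩ : M)))).2 ?_ ha
    intro b hb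
    have hg : t b ∈ L.toSubgroup := hL (hsL (by simpa using ⟨b, hb, rfl⟩))
    rw [← ht b hb]
    exact hPS _ (S.apply_mem_toSubmodule ⟨t b, hg⟩ hmS)
  -- The vectors `π(g) m` span `π`, hence the vectors `P π(g) m` span `M`; all of them lie in `S`.
  have h2 : ∀ v, P v ∈ S.toSubmodule := fun v => by
    have hv : v ∈ (⊤ : Submodule ℂ π.V) := trivial
    rw [← span_orbit_eq_top π.irreducible hm0] at hv
    refine (Submodule.span_le (p := S.toSubmodule.comap P.toLinearMap)).2 ?_ hv
    rintro _ ⟨g, rfl⟩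
    exact h1 _ (Submodule.subset_span ⟨g, rfl⟩)
  rw [← hPm m' hm']
  exact h2 m'

/-- The vectors fixed by a compact open subgroup lie in an irreducible representation of every
sufficiently large compact open subgroup. -/
theorem exists_isIrreducible_spanSubrepresentation (hG : IsEllCGroup G) (hT : IsTame G)
    (π : SmoothIrrep G) (N : CompactOpenSubgroup G)
    (hN : (restrict π.rep N.toSubgroup).invariants ≠ ⊥) :
    ∃ L₀ : CompactOpenSubgroup G, ∀ L : CompactOpenSubgroup G, L₀.toSubgroup ≤ L.toSubgroup →
      (spanSubrepresentation π L.toSubgroup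
        (restrict π.rep N.toSubgroup).invariants).toRepresentation.IsIrreducible := by
  obtain ⟨L₀, hNL, h⟩ := exists_forall_invariants_le hG hT π N
  refine ⟨L₀, fun L hL => ?_⟩
  set M := (restrict π.rep N.toSubgroup).invariants with hM
  set U := spanSubrepresentation π L.toSubgroup M with hU
  obtain ⟨m₀, hm₀, hm₀0⟩ := (Submodule.ne_bot_iff _).1 hN
  have hMU : M ≤ U.toSubmodule := le_spanSubrepresentation π _ M
  refine { exists_pair_ne := ⟨⊥, ⊤, fun hbt => hm₀0 ?_⟩, eq_bot_or_eq_top := fun U' => ?_ }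
  · have : (⟨m₀, hMU hm₀⟩ : U.toSubmodule) ∈
        (⊤ : Subrepresentation U.toRepresentation).toSubmodule := Submodule.mem_top
    rw [← hbt] at this
    exact congrArg Subtype.val ((Submodule.mem_bot ℂ).1 this)
  let S : Subrepresentation (restrict π.rep L.toSubgroup) :=
    { toSubmodule := U'.toSubmodule.map U.toSubmodule.subtype
      apply_mem_toSubmodule := by
        rintro g _ ⟨v, hv, rfl⟩
        exact ⟨U.toRepresentation g v, U'.apply_mem_toSubmodule g hv, rfl⟩ }
  by_cases hS : ∃ m ∈ M, m ≠ 0 ∧ m ∈ S.toSubmodule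
  · right
    obtain ⟨m, hm, hm0, hmS⟩ := hS
    have hMS := h L hL S m hm hm0 hmS
    have hUS : U.toSubmodule ≤ S.toSubmodule := by
      refine Submodule.span_le.2 ?_
      rintro _ ⟨l, m, rfl⟩
      exact S.apply_mem_toSubmodule l (hMS m.2)
    apply Subrepresentation.toSubmodule_injective
    refine eq_top_iff.2 fun v _ => ?_
    obtain ⟨v', hv', hvv⟩ := hUS v.2
    have : v' = v := Subtype.ext hvv
    exact this ▸ hv'
  · left
    push Not at hS
    have hsU := isSmooth_toRepresentation (π.smooth.restrict L.toSubgroup) U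
    obtain ⟨q, hq⟩ := exists_intertwining_leftInverse (isSmooth_toRepresentation hsU U') hsU
      ⟨U'.toSubmodule.subtype, fun g => rfl⟩ Subtype.val_injective
    -- The `L`-equivariant projection `q` onto `U'` sends `N`-fixed vectors to `N`-fixed vectors of
    -- `U'`, and there are none but zero. So `q` kills `M`, which generates `U`, and `U' = 0`.
    have hqM : ∀ m (hm : m ∈ M), q ⟨m, hMU hm⟩ = 0 := fun m hm => by
      by_contra hq0
      refine hS ((q ⟨m, hMU hm⟩ : U.toSubmodule) : π.V) ?_ ?_ ⟨_, (q ⟨m, hMU hm⟩).2, rfl⟩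
      · intro n
        have h1 := Representation.IntertwiningMap.isIntertwining _ _ q
          ⟨n, hL (hNL n.2)⟩ ⟨m, hMU hm⟩
        have h2 : U.toRepresentation ⟨n, hL (hNL n.2)⟩ ⟨m, hMU hm⟩ = ⟨m, hMU hm⟩ :=
          Subtype.ext (hm n)
        rw [h2] at h1
        exact (congrArg (fun x : U'.toSubmodule => ((x : U.toSubmodule) : π.V)) h1).symm
      · intro h0
        exact hq0 (Subtype.ext (Subtype.ext h0))
    have hq0 : ∀ v, q v = 0 := by
      have hle : U.toSubmodule ≤ (LinearMap.ker q.toLinearMap).map U.toSubmodule.subtype := by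
        refine Submodule.span_le.2 ?_
        rintro _ ⟨l, m, rfl⟩
        refine ⟨U.toRepresentation l ⟨m, hMU m.2⟩, ?_, rfl⟩
        refine (Representation.IntertwiningMap.isIntertwining _ _ q l _).trans ?_
        rw [hqM m m.2, map_zero]
      intro v
      obtain ⟨v', hv', hvv⟩ := hle v.2
      have : v' = v := Subtype.ext hvv
      exact this ▸ hv'
    apply Subrepresentation.toSubmodule_injective
    refine eq_bot_iff.2 fun v hv => ?_
    have := hq ⟨v, hv⟩
    rw [hq0] at this
    exact (Submodule.mem_bot ℂ).2 (congrArg Subtype.val this).symm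

end Restriction

/-! ### Hecke operators attached to representations of larger compact subgroups -/

section HeckeCompact

variable {G : Type u} [Group G] [TopologicalSpace G] [IsTopologicalGroup G]
  {K L : CompactOpenSubgroup G} {ρ : SmoothIrrep K.toSubgroup} {τ : SmoothIrrep L.toSubgroup}
  {π σ : SmoothIrrep G}

theorem transpose_dualMap (S : Module.End ℂ ρ.V) : transpose K ρ S.dualMap = S :=
  LinearMap.ext fun w => dual_ext fun ξ => by rw [apply_transpose]; rfl

/-- The restriction of a representation of `L` to a smaller subgroup `K`. -/
abbrev restrictLE (hKL : K.toSubgroup ≤ L.toSubgroup) (τ : SmoothIrrep L.toSubgroup) :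
    Representation ℂ K.toSubgroup τ.V := τ.rep.comp (Subgroup.inclusion hKL)

/-- Extension by zero of a function on `L`. -/
def extendZero {M : Type*} [Zero M] (F : L.toSubgroup → M) (g : G) : M := by
  classical exact if hg : g ∈ L.toSubgroup then F ⟨g, hg⟩ else 0

theorem extendZero_coe {M : Type*} [Zero M] (F : L.toSubgroup → M) (l : L.toSubgroup) :
    extendZero F (l : G) = F l := by
  simp [extendZero]

theorem extendZero_of_notMem {M : Type*} [Zero M] (F : L.toSubgroup → M) {g : G}
    (hg : g ∉ L.toSubgroup) : extendZero F g = 0 := by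
  simp [extendZero, hg]

theorem cosetFinite_extendZero {M : Type*} [AddCommMonoid M] (F : L.toSubgroup → M) :
    CosetFinite K.toSubgroup (extendZero F) :=
  cosetFinite_of_compact K.isOpen L.isCompact fun g hg => by
    by_contra h
    exact hg (extendZero_of_notMem F h)

variable (hKL : K.toSubgroup ≤ L.toSubgroup)

/-- The element of the Hecke algebra whose transpose is the coefficient `l ↦ p τ(l)⁻¹ i` of `τ`. -/
def heckeCoefficient (i : ρ.rep.IntertwiningMap (restrictLE hKL τ))
    (p : (restrictLE hKL τ).IntertwiningMap ρ.rep) : HeckeAlgebra K ρ :=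
  ⟨extendZero fun l : L.toSubgroup =>
      (p.toLinearMap ∘ₗ τ.rep l⁻¹ ∘ₗ i.toLinearMap).dualMap, by
    have hmul : ∀ (k₁ k₂ : K.toSubgroup) (g : G), extendZero (fun l : L.toSubgroup =>
        (p.toLinearMap ∘ₗ τ.rep l⁻¹ ∘ₗ i.toLinearMap).dualMap) (k₁ * g * k₂) =
        ρ.rep.dual k₁ * extendZero (fun l : L.toSubgroup =>
          (p.toLinearMap ∘ₗ τ.rep l⁻¹ ∘ₗ i.toLinearMap).dualMap) g * ρ.rep.dual k₂ := by
      intro k₁ k₂ g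
      by_cases hg : g ∈ L.toSubgroup
      · lift g to L.toSubgroup using hg
        have e := extendZero_coe (fun l : L.toSubgroup =>
          (p.toLinearMap ∘ₗ τ.rep l⁻¹ ∘ₗ i.toLinearMap).dualMap)
          (Subgroup.inclusion hKL k₁ * g * Subgroup.inclusion hKL k₂)
        refine e.trans ?_
        rw [extendZero_coe]
        ext ξ w
        have h1 := Representation.IntertwiningMap.isIntertwining _ _ i k₁⁻¹ w
        have h2 := Representation.IntertwiningMap.isIntertwining _ _ p k₂⁻¹
          (τ.rep g⁻¹ (i (ρ.rep k₁⁻¹ w)))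
        change ξ (p (τ.rep (Subgroup.inclusion hKL k₁ * g * Subgroup.inclusion hKL k₂)⁻¹ (i w))) =
          ξ (ρ.rep k₂⁻¹ (p (τ.rep g⁻¹ (i (ρ.rep k₁⁻¹ w)))))
        rw [← h2, h1]
        simp only [mul_inv_rev, map_mul, Module.End.mul_apply, MonoidHom.comp_apply, map_inv]
      · rw [extendZero_of_notMem _ hg, extendZero_of_notMem]
        · simp
        · rwa [L.toSubgroup.mul_mem_cancel_right (hKL k₂.2),
            L.toSubgroup.mul_mem_cancel_left (hKL k₁.2)]
    refine ⟨isLocallyConstant_of_map_right fun g k => ?_, ?_, hmul⟩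
    · have := hmul 1 k g
      rwa [map_one ρ.rep.dual, one_mul, OneMemClass.coe_one, one_mul] at this
    · refine HasCompactSupport.of_support_subset_isCompact L.isCompact fun g hg => ?_
      by_contra h
      exact hg (extendZero_of_notMem _ h)⟩

variable (i : ρ.rep.IntertwiningMap (restrictLE hKL τ))
  (p : (restrictLE hKL τ).IntertwiningMap ρ.rep)

theorem heckeCoefficient_coe (l : L.toSubgroup) :
    transpose K ρ (heckeCoefficient hKL i p l) = p.toLinearMap ∘ₗ τ.rep l⁻¹ ∘ₗ i.toLinearMap := by
  rw [← transpose_dualMap (p.toLinearMap ∘ₗ τ.rep l⁻¹ ∘ₗ i.toLinearMap)]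
  exact congrArg _ (extendZero_coe (fun l : L.toSubgroup =>
    (p.toLinearMap ∘ₗ τ.rep l⁻¹ ∘ₗ i.toLinearMap).dualMap) l)

theorem heckeCoefficient_of_notMem {g : G} (hg : g ∉ L.toSubgroup) :
    heckeCoefficient hKL i p g = 0 :=
  extendZero_of_notMem (fun l : L.toSubgroup =>
    (p.toLinearMap ∘ₗ τ.rep l⁻¹ ∘ₗ i.toLinearMap).dualMap) hg

/-- The intertwining map `∑ σ(l) ψ p τ(l)⁻¹`, over representatives `l` of `L/K`. -/
def inducedMap (ψ : RhoInvariants K ρ σ) :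
    τ.rep.IntertwiningMap (restrict σ.rep L.toSubgroup) where
  toLinearMap := cosetSum K.toSubgroup (extendZero fun l : L.toSubgroup =>
    σ.rep l ∘ₗ ψ.toLinearMap ∘ₗ p.toLinearMap ∘ₗ τ.rep l⁻¹)
  isIntertwining' l := by
    set F : G → τ.V →ₗ[ℂ] σ.V := extendZero fun l : L.toSubgroup =>
      σ.rep l ∘ₗ ψ.toLinearMap ∘ₗ p.toLinearMap ∘ₗ τ.rep l⁻¹ with hF
    have hfin : CosetFinite K.toSubgroup F := cosetFinite_extendZero _
    have h1 := cosetSum_map hfin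
      (LinearMap.compRight ℂ (M := τ.V) (σ.rep (l : G))).toAddMonoidHom
    have h2 := cosetSum_map hfin (LinearMap.lcomp ℂ σ.V (τ.rep l)).toAddMonoidHom
    have hright : ∀ g, ∀ k ∈ K.toSubgroup, F (g * k) = F g := fun g k hk => by
      lift k to K.toSubgroup using hk
      by_cases hg : g ∈ L.toSubgroup
      · lift g to L.toSubgroup using hg
        have e := extendZero_coe (fun l : L.toSubgroup =>
          σ.rep l ∘ₗ ψ.toLinearMap ∘ₗ p.toLinearMap ∘ₗ τ.rep l⁻¹) (g * Subgroup.inclusion hKL k)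
        refine e.trans ?_
        rw [hF, extendZero_coe]
        ext v
        have h3 := Representation.IntertwiningMap.isIntertwining _ _ p k⁻¹ (τ.rep g⁻¹ v)
        have h4 := Representation.IntertwiningMap.isIntertwining _ _ ψ k
          (ρ.rep k⁻¹ (p (τ.rep g⁻¹ v)))
        rw [Representation.self_inv_apply] at h4
        change σ.rep (g * k) (ψ (p (τ.rep (g * Subgroup.inclusion hKL k)⁻¹ v))) =
          σ.rep g (ψ (p (τ.rep g⁻¹ v)))
        rw [h4, ← h3, map_mul, mul_inv_rev, map_mul]
        rfl
      · rw [hF, extendZero_of_notMem _ hg, extendZero_of_notMem]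
        rwa [L.toSubgroup.mul_mem_cancel_right (hKL k.2)]
    have hleft : ∀ g, F (l * g) ∘ₗ τ.rep l = σ.rep l ∘ₗ F g := fun g => by
      by_cases hg : g ∈ L.toSubgroup
      · lift g to L.toSubgroup using hg
        have e := extendZero_coe (fun l : L.toSubgroup =>
          σ.rep l ∘ₗ ψ.toLinearMap ∘ₗ p.toLinearMap ∘ₗ τ.rep l⁻¹) (l * g)
        rw [Subgroup.coe_mul] at e
        rw [hF, e, extendZero_coe]
        ext v
        simp only [LinearMap.comp_apply, mul_inv_rev, map_mul, Module.End.mul_apply,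
          Representation.inv_self_apply]
      · rw [hF, extendZero_of_notMem _ hg, extendZero_of_notMem]
        · simp
        · rwa [L.toSubgroup.mul_mem_cancel_left l.2]
    change (LinearMap.lcomp ℂ σ.V (τ.rep l)).toAddMonoidHom (cosetSum K.toSubgroup F) =
      (LinearMap.compRight ℂ (M := τ.V) (σ.rep (l : G))).toAddMonoidHom (cosetSum K.toSubgroup F)
    rw [h1, h2]
    change cosetSum K.toSubgroup (fun g => F g ∘ₗ τ.rep l) =
      cosetSum K.toSubgroup (fun g => σ.rep l ∘ₗ F g)
    rw [← cosetSum_translate (x := (l : G))]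
    · simp only [hleft]
    · intro g k hk
      rw [hright g k hk]

/-- The action on `ψ` factors through an `L`-map `τ → σ`. A non-zero result therefore forces the
irreducible `τ` to embed in `σ`. -/
theorem heckeCoefficient_smul_apply (ψ : RhoInvariants K ρ σ) (w : ρ.V) :
    (heckeCoefficient hKL i p • ψ) w = inducedMap hKL p ψ (i w) := by
  rw [RhoInvariants.smul_apply]
  refine Eq.trans ?_ (cosetSum_map (K := K.toSubgroup) (cosetFinite_extendZero (K := K)
    fun l : L.toSubgroup => σ.rep l ∘ₗ ψ.toLinearMap ∘ₗ p.toLinearMap ∘ₗ τ.rep l⁻¹)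
    (LinearMap.applyₗ (R := ℂ) (i w)).toAddMonoidHom).symm
  congr 1; funext g
  by_cases hg : g ∈ L.toSubgroup
  · lift g to L.toSubgroup using hg
    rw [heckeCoefficient_coe, extendZero_coe]
    rfl
  · rw [heckeCoefficient_of_notMem hKL i p hg, extendZero_of_notMem _ hg]
    simp

/-- With `r` a retraction of `j`, the endomorphism `r ∘ inducedMap` of `τ` is a scalar by Schur's
lemma. Since `φ = j ∘ i`, its trace is a sum over `L/K` of the traces of the conjugates `τ(l) i p
τ(l)⁻¹`, each equal to `dim ρ`, so the scalar is not zero. -/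
theorem heckeCoefficient_smul_ne_zero (hpi : ∀ w, p (i w) = w) (φ : RhoInvariants K ρ π)
    (j : τ.rep.IntertwiningMap (restrict π.rep L.toSubgroup)) (hj : Function.Injective j)
    (hji : ∀ w, j (i w) = φ w) : heckeCoefficient hKL i p • φ ≠ 0 := by
  have := nontrivial_of_isIrreducible ρ.irreducible
  have := nontrivial_of_isIrreducible τ.irreducible
  obtain ⟨w, hw⟩ := exists_ne (0 : ρ.V)
  obtain ⟨r, hr⟩ := exists_intertwining_leftInverse τ.smooth (π.smooth.restrict L.toSubgroup) j hj
  let T : τ.rep.IntertwiningMap τ.rep := r.comp (inducedMap hKL p φ)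
  have hT : LinearMap.trace ℂ τ.V T.toLinearMap =
      cosetSum K.toSubgroup (extendZero fun _ : L.toSubgroup => (Module.finrank ℂ ρ.V : ℂ)) := by
    have h1 := cosetSum_map (K := K.toSubgroup) (cosetFinite_extendZero (K := K)
      fun l : L.toSubgroup => π.rep l ∘ₗ φ.toLinearMap ∘ₗ p.toLinearMap ∘ₗ τ.rep l⁻¹)
      ((LinearMap.trace ℂ τ.V) ∘ₗ (LinearMap.compRight ℂ (M := τ.V) r.toLinearMap)).toAddMonoidHom
    refine h1.trans ?_
    congr 1; funext g
    by_cases hg : g ∈ L.toSubgroup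
    · lift g to L.toSubgroup using hg
      rw [extendZero_coe, extendZero_coe]
      have e : r.toLinearMap ∘ₗ π.rep (g : G) ∘ₗ φ.toLinearMap ∘ₗ p.toLinearMap ∘ₗ τ.rep g⁻¹ =
          (τ.rep g ∘ₗ i.toLinearMap ∘ₗ p.toLinearMap) ∘ₗ τ.rep g⁻¹ := by
        ext v
        have h3 := Representation.IntertwiningMap.isIntertwining _ _ j g (i (p (τ.rep g⁻¹ v)))
        rw [hji] at h3
        change r (π.rep g (φ (p (τ.rep g⁻¹ v)))) = τ.rep g (i (p (τ.rep g⁻¹ v)))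
        rw [← hr (τ.rep g (i (p (τ.rep g⁻¹ v)))), h3]
        rfl
      change LinearMap.trace ℂ τ.V (r.toLinearMap ∘ₗ π.rep (g : G) ∘ₗ φ.toLinearMap ∘ₗ
        p.toLinearMap ∘ₗ τ.rep g⁻¹) = _
      rw [e, LinearMap.trace_comp_comm', ← LinearMap.comp_assoc]
      have e2 : τ.rep g⁻¹ ∘ₗ τ.rep g = LinearMap.id := by
        ext v; simp
      rw [e2, LinearMap.id_comp, LinearMap.trace_comp_comm']
      have e3 : p.toLinearMap ∘ₗ i.toLinearMap = LinearMap.id := LinearMap.ext hpi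
      rw [e3, LinearMap.trace_id]
    · rw [extendZero_of_notMem _ hg, extendZero_of_notMem _ hg, map_zero]
  have hT0 : LinearMap.trace ℂ τ.V T.toLinearMap ≠ 0 := by
    -- The sum is moved to the natural numbers, where it is non-zero because the term of the trivial
    -- coset is positive.
    have h1 := cosetSum_map (K := K.toSubgroup) (cosetFinite_extendZero (K := K)
      fun _ : L.toSubgroup => Module.finrank ℂ ρ.V) (Nat.castAddMonoidHom ℂ)
    have h2 : ∀ g : G, Nat.castAddMonoidHom ℂ (extendZero (fun _ : L.toSubgroup =>
        Module.finrank ℂ ρ.V) g) =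
        extendZero (fun _ : L.toSubgroup => (Module.finrank ℂ ρ.V : ℂ)) g := fun g => by
      by_cases hg : g ∈ L.toSubgroup
      · lift g to L.toSubgroup using hg
        rw [extendZero_coe, extendZero_coe]; rfl
      · rw [extendZero_of_notMem _ hg, extendZero_of_notMem _ hg, map_zero]
    simp only [h2] at h1
    rw [hT, ← h1]
    refine Nat.cast_ne_zero.2 fun h0 => ?_
    have hfin : CosetFinite K.toSubgroup (extendZero fun _ : L.toSubgroup =>
      Module.finrank ℂ ρ.V) := cosetFinite_extendZero (K := K) _
    rw [cosetSum, finsum_eq_sum_of_support_subset (s := hfin.toFinset) _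
      (fun q hq => hfin.mem_toFinset.2 hq), Finset.sum_eq_zero_iff] at h0
    have hout : ((1 : G) : G ⧸ K.toSubgroup).out ∈ L.toSubgroup := by
      obtain ⟨k, hk⟩ := QuotientGroup.mk_out_eq_mul K.toSubgroup 1
      rw [hk, one_mul]
      exact hKL k.2
    have hd : extendZero (fun _ : L.toSubgroup => Module.finrank ℂ ρ.V)
        ((1 : G) : G ⧸ K.toSubgroup).out = Module.finrank ℂ ρ.V := extendZero_coe _ ⟨_, hout⟩
    have hpos := (Module.finrank_pos (R := ℂ) (M := ρ.V)).ne'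
    have := h0 ((1 : G) : G ⧸ K.toSubgroup) (hfin.mem_toFinset.2 (by
      rw [Function.mem_support, hd]; exact hpos))
    rw [hd] at this
    exact hpos this
  intro h0
  have h1 : T (i w) = 0 := by
    change r (inducedMap hKL p φ (i w)) = 0
    rw [← heckeCoefficient_smul_apply, h0]
    exact map_zero r.toLinearMap
  rw [schur_trace τ.irreducible] at h1
  have hn : (Module.finrank ℂ τ.V : ℂ) ≠ 0 := by
    exact_mod_cast (Module.finrank_pos (R := ℂ) (M := τ.V)).ne'
  have h2 : i w = 0 := (smul_eq_zero.1 h1).resolve_left (div_ne_zero hT0 hn)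
  refine hw ?_
  rw [← hpi w, h2]
  exact map_zero p.toLinearMap

/-- Functions `g ↦ ζ(π(g) v)` on a compact set are matched exactly by every representation on which
a suitable Hecke operator does not vanish. -/
theorem exists_hecke_forall_coefficient (hG : IsEllCGroup G) (hT : IsTame G)
    [Nontrivial (RhoInvariants K ρ π)] {n : ℕ} (v : Fin n → π.V) (ξ : Fin n → Module.Dual ℂ π.V)
    {B : Set G} (hB : IsCompact B) :
    ∃ f : HeckeAlgebra K ρ, (∃ φ : RhoInvariants K ρ π, f • φ ≠ 0) ∧
      ∀ (σ : SmoothIrrep G) (ψ : RhoInvariants K ρ σ), f • ψ ≠ 0 →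
        ∃ (w : Fin n → σ.V) (ζ : Fin n → Module.Dual ℂ σ.V),
          (∀ j, IsSmoothVector σ.rep.dual (ζ j)) ∧
          ∀ j, ∀ g ∈ B, ξ j (π.rep g (v j)) = ζ j (σ.rep g (w j)) := by
  have := nontrivial_of_isIrreducible ρ.irreducible
  obtain ⟨φ, hφ⟩ := exists_ne (0 : RhoInvariants K ρ π)
  obtain ⟨u, hu⟩ := exists_ne (0 : ρ.V)
  -- `N` is chosen to fix both the vectors `v j` and the image of `φ`, so that the single
  -- irreducible `τ` generated by the `N`-fixed vectors contains them all.
  let N := fixingSubgroup (kernelSubgroup ρ) π v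
  set M := (restrict π.rep N.toSubgroup).invariants with hM
  have hφM : ∀ w, φ w ∈ M := fun w k => φ.mem_invariants w ⟨k, k.2.1⟩
  have hvM : ∀ j, v j ∈ M := fun j k => k.2.2 j
  have hM0 : M ≠ ⊥ := fun h => hu (RhoInvariants.injective_of_ne_zero hφ (by
    have h1 := hφM u
    rw [h] at h1
    exact ((Submodule.mem_bot ℂ).1 h1).trans (map_zero φ.toLinearMap).symm))
  obtain ⟨L₀, hL₀⟩ := exists_isIrreducible_spanSubrepresentation hG hT π N hM0
  obtain ⟨L₁, hKL₁, hBL₁⟩ := exists_compactOpenSubgroup_ge hG K hB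
  obtain ⟨L, hL₀L, hL₁L⟩ := exists_compactOpenSubgroup_ge hG L₀ L₁.isCompact
  have hKL : K.toSubgroup ≤ L.toSubgroup := hKL₁.trans hL₁L
  have hBL : B ⊆ L.toSubgroup := hBL₁.trans hL₁L
  let U := spanSubrepresentation π L.toSubgroup M
  have hMU : M ≤ U.toSubmodule := le_spanSubrepresentation π _ M
  let τ : SmoothIrrep L.toSubgroup :=
    ⟨U.toSubmodule, U.toRepresentation,
      isSmooth_toRepresentation (π.smooth.restrict L.toSubgroup) U, hL₀ L hL₀L⟩
  let j : τ.rep.IntertwiningMap (restrict π.rep L.toSubgroup) :=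
    ⟨U.toSubmodule.subtype, fun _ => rfl⟩
  let i : ρ.rep.IntertwiningMap (restrictLE hKL τ) :=
    ⟨φ.toLinearMap.codRestrict U.toSubmodule fun w => hMU (hφM w), fun k => LinearMap.ext fun w =>
      Subtype.ext (Representation.IntertwiningMap.isIntertwining _ _ φ k w)⟩
  have hi : Function.Injective i := fun w w' h =>
    RhoInvariants.injective_of_ne_zero hφ (congrArg Subtype.val h)
  have hτK : IsSmooth (restrictLE hKL τ) := fun x =>
    (τ.smooth x).preimage (continuous_inclusion hKL)
  obtain ⟨p, hp⟩ := exists_intertwining_leftInverse ρ.smooth hτK i hi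
  refine ⟨heckeCoefficient hKL i p, ⟨φ, heckeCoefficient_smul_ne_zero hKL i p hp φ j
    Subtype.val_injective fun _ => rfl⟩, fun σ ψ hψ => ?_⟩
  have := τ.irreducible
  have hΘ : Function.Injective (inducedMap hKL p ψ) := by
    refine (Representation.IsIrreducible.injective_or_eq_zero _).resolve_right fun h0 => hψ ?_
    refine DFunLike.ext _ _ fun w => ?_
    rw [heckeCoefficient_smul_apply, h0]
    rfl
  obtain ⟨q, hq⟩ := exists_intertwining_leftInverse τ.smooth (σ.smooth.restrict L.toSubgroup) _ hΘ
  -- The vectors `v a` are transported along the embedding of `τ` into `σ`, and the functionals `ξ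
  -- a` are pulled back through a retraction `q` of it. Equivariance under `L ⊇ B` makes the
  -- coefficients agree on `B`; the new functionals are smooth because the kernel of `τ` is open.
  refine ⟨fun a => inducedMap hKL p ψ ⟨v a, hMU (hvM a)⟩,
    fun a => ξ a ∘ₗ j.toLinearMap ∘ₗ q.toLinearMap, fun a => ?_, fun a g hg => ?_⟩
  · refine isSmoothVector_iff.2 ?_
    have h1 : IsOpen ((↑) '' {l : L.toSubgroup | τ.rep l⁻¹ = 1} : Set G) :=
      L.isOpen.isOpenEmbedding_subtypeVal.isOpenMap _ ((isOpen_ker_rep L τ).preimage continuous_inv)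
    filter_upwards [h1.mem_nhds ⟨1, by simp, rfl⟩] with g hg
    obtain ⟨l, hl, rfl⟩ := hg
    have hl : τ.rep l⁻¹ = 1 := hl
    ext y
    have h2 := Representation.IntertwiningMap.isIntertwining _ _ q l⁻¹ y
    rw [hl] at h2
    exact congrArg (fun z => ξ a (j z)) h2
  · have h1 := Representation.IntertwiningMap.isIntertwining _ _ (inducedMap hKL p ψ) ⟨g, hBL hg⟩
      ⟨v a, hMU (hvM a)⟩
    change _ = ξ a (j (q (σ.rep g (inducedMap hKL p ψ ⟨v a, hMU (hvM a)⟩))))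
    have h2 : σ.rep g (inducedMap hKL p ψ ⟨v a, hMU (hvM a)⟩) =
      inducedMap hKL p ψ (τ.rep ⟨g, hBL hg⟩ ⟨v a, hMU (hvM a)⟩) := h1.symm
    rw [h2, hq]
    rfl

end HeckeCompact

/-! ### The homeomorphism -/

section Homeomorph

variable {A : Type u} [Ring A]

theorem isOpen_setOf_notMem_primitive (a : A) : IsOpen {P : PrimitiveSpectrum A | a ∉ P.1} := by
  rw [← isClosed_compl_iff, isClosed_primitive_iff]
  intro P hP
  have : a ∈ P.1 := hP (mem_primitiveKernel.2 fun I hI => not_not.1 hI)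
  exact not_not.2 this

/-- Together with `isOpen_setOf_notMem_primitive`, this says that the sets `{P | a ∉ P}` form a
basis of the Jacobson topology. -/
theorem exists_notMem_of_isOpen_primitive {O : Set (PrimitiveSpectrum A)} (hO : IsOpen O)
    {P : PrimitiveSpectrum A} (hP : P ∈ O) :
    ∃ a : A, a ∉ P.1 ∧ ∀ Q : PrimitiveSpectrum A, a ∉ Q.1 → Q ∈ O := by
  have h := isClosed_primitive_iff.1 hO.isClosed_compl P
  have h1 : ¬ primitiveKernel Oᶜ ≤ P.1 := fun hle => h hle hP
  obtain ⟨a, ha, haP⟩ := SetLike.not_le_iff_exists.1 h1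
  refine ⟨a, haP, fun Q hQ => ?_⟩
  by_contra hQO
  exact hQ (mem_primitiveKernel.1 ha Q hQO)

variable {G : Type u} [Group G] [TopologicalSpace G] [IsTopologicalGroup G]
  {K : CompactOpenSubgroup G} {ρ : SmoothIrrep K.toSubgroup}

theorem notMem_annihilator_iff {π : SmoothIrrep G} {f : HeckeAlgebra K ρ} :
    f ∉ Module.annihilator (HeckeAlgebra K ρ) (RhoInvariants K ρ π) ↔
      ∃ φ : RhoInvariants K ρ π, f • φ ≠ 0 := by
  rw [Module.mem_annihilator]
  push Not
  rfl

theorem toClass_out (x : SmoothDualSpace G) : (Quotient.out x).toClass = x := Quotient.out_eq x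

theorem toClass_eq_iff {π σ : SmoothIrrep G} :
    π.toClass = σ.toClass ↔ Nonempty (π.rep.Equiv σ.rep) := Quotient.eq

variable (K ρ)

/-- The annihilator of the module of `ρ`-invariants, as a primitive ideal. -/
def invariantsIdeal (x : fellBasic K ρ) : PrimitiveSpectrum (HeckeAlgebra K ρ) :=
  ⟨Module.annihilator (HeckeAlgebra K ρ) (RhoInvariants K ρ x.1.out), RhoInvariants K ρ x.1.out,
    inferInstance, inferInstance,
    have := mem_fellBasic_iff.1 ((toClass_out x.1).symm ▸ x.2)
    RhoInvariants.isSimpleModule, rfl⟩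

theorem invariantsIdeal_toClass (π : SmoothIrrep G) (hπ : π.toClass ∈ fellBasic K ρ) :
    (invariantsIdeal K ρ ⟨π.toClass, hπ⟩).1 =
      Module.annihilator (HeckeAlgebra K ρ) (RhoInvariants K ρ π) := by
  obtain ⟨e⟩ := toClass_eq_iff.1 (toClass_out π.toClass)
  exact RhoInvariants.annihilator_eq_of_equiv e

theorem invariantsIdeal_bijective (hT : IsTame G) :
    Function.Bijective (invariantsIdeal K ρ) := by
  constructor
  · rintro ⟨x, hx⟩ ⟨y, hy⟩ h
    induction x using Quotient.inductionOn with | h π => ?_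
    induction y using Quotient.inductionOn with | h σ => ?_
    have h1 := congrArg Subtype.val h
    have h2 := (invariantsIdeal_toClass K ρ π hx).symm.trans
      (h1.trans (invariantsIdeal_toClass K ρ σ hy))
    have := mem_fellBasic_iff.1 hx
    have := mem_fellBasic_iff.1 hy
    exact Subtype.ext (toClass_eq_iff.2 (nonempty_equiv_of_annihilator_eq hT h2))
  · intro P
    obtain ⟨π, hπ, hP⟩ := exists_annihilator_eq P
    refine ⟨⟨π.toClass, mem_fellBasic_iff.2 hπ⟩, Subtype.ext ?_⟩
    rw [invariantsIdeal_toClass, hP]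

theorem continuous_invariantsIdeal : Continuous (invariantsIdeal K ρ) := by
  refine continuous_def.2 fun O hO => isOpen_iff_mem_nhds.2 ?_
  rintro ⟨x, hx⟩ hxO
  induction x using Quotient.inductionOn with | h π => ?_
  obtain ⟨f, hf, hfO⟩ := exists_notMem_of_isOpen_primitive hO hxO
  have h1 : (invariantsIdeal K ρ ⟨π.toClass, hx⟩).1 = _ := invariantsIdeal_toClass K ρ π hx
  obtain ⟨φ, hφ⟩ := notMem_annihilator_iff.1 (h1 ▸ hf)
  obtain ⟨v, ξ, B, ε, hξ, hB, hε, h⟩ := exists_fellNhd_of_smul_ne_zero hφ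
  have hopen : IsOpen (fellNhd π v ξ B ε) :=
    TopologicalSpace.isOpen_generateFrom_of_mem ⟨π, 1, v, ξ, B, ε, hξ, hB, hε, rfl⟩
  have hmem : π.toClass ∈ fellNhd π v ξ B ε := ⟨π, rfl, v, ξ, hξ, fun j g _ => by simpa using hε⟩
  refine Filter.mem_of_superset ((hopen.preimage continuous_subtype_val).mem_nhds hmem) ?_
  rintro ⟨_, hy⟩ ⟨σ, rfl, w, ζ, -, hσ⟩
  refine hfO _ ?_
  rw [invariantsIdeal_toClass, notMem_annihilator_iff]
  exact h σ w ζ hσ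

theorem continuous_invariantsIdeal_symm (hG : IsEllCGroup G) (hT : IsTame G) :
    Continuous (Equiv.ofBijective _ (invariantsIdeal_bijective K ρ hT)).symm := by
  refine continuous_induced_rng.2 (continuous_generateFrom_iff.2 ?_)
  rintro _ ⟨π₀, n, v₀, ξ₀, B, ε, -, hB, -, rfl⟩
  refine isOpen_iff_mem_nhds.2 fun P hP => ?_
  obtain ⟨x, rfl⟩ := (Equiv.ofBijective _ (invariantsIdeal_bijective K ρ hT)).surjective P
  rw [Set.mem_preimage, Function.comp_apply, Equiv.symm_apply_apply] at hP
  obtain ⟨x, hx⟩ := x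
  obtain ⟨π, rfl, v, ξ, -, hπ⟩ := hP
  have := mem_fellBasic_iff.1 hx
  -- The Hecke element is built for `π` and for the vectors and functionals of `π` that witness its
  -- membership in the neighbourhood of `π₀`. Exact agreement on `B` then transfers the original
  -- strict inequality to `σ` with the same `ε`.
  obtain ⟨f, hf, hfσ⟩ := exists_hecke_forall_coefficient (K := K) (ρ := ρ) hG hT v ξ hB
  have hfP : f ∉ (invariantsIdeal K ρ ⟨π.toClass, hx⟩).1 := by
    rwa [invariantsIdeal_toClass, notMem_annihilator_iff]
  refine Filter.mem_of_superset ((isOpen_setOf_notMem_primitive f).mem_nhds hfP) fun Q hQ => ?_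
  obtain ⟨⟨y, hy⟩, rfl⟩ :=
    (Equiv.ofBijective _ (invariantsIdeal_bijective K ρ hT)).surjective Q
  rw [Set.mem_preimage, Function.comp_apply, Equiv.symm_apply_apply]
  obtain ⟨σ, rfl⟩ : ∃ σ : SmoothIrrep G, σ.toClass = y := ⟨_, toClass_out y⟩
  have hQ : f ∉ (invariantsIdeal K ρ ⟨σ.toClass, hy⟩).1 := hQ
  rw [invariantsIdeal_toClass, notMem_annihilator_iff] at hQ
  obtain ⟨ψ, hψ⟩ := hQ
  obtain ⟨w, ζ, hζ, h⟩ := hfσ σ ψ hψ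
  refine ⟨σ, rfl, w, ζ, hζ, fun a g hg => ?_⟩
  rw [← h a g hg]
  exact hπ a g hg

end Homeomorph

end EllGroup

end

theorem mainTheorem3 {G : Type u} [Group G] [TopologicalSpace G] [IsTopologicalGroup G]
    [T2Space G] [LocallyCompactSpace G] [TotallyDisconnectedSpace G]
    (hG : IsEllCGroup G) (hT : IsTame G)
    (K : CompactOpenSubgroup G) (ρ : SmoothIrrep K.toSubgroup) :
    (∀ π : SmoothIrrep G, π.toClass ∈ fellBasic K ρ →
      IsSimpleModule (HeckeAlgebra K ρ) (RhoInvariants K ρ π)) ∧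
    ∃ Φ : fellBasic K ρ ≃ₜ PrimitiveSpectrum (HeckeAlgebra K ρ),
      ∀ (π : SmoothIrrep G) (hπ : π.toClass ∈ fellBasic K ρ),
        (Φ ⟨π.toClass, hπ⟩).1 = Module.annihilator (HeckeAlgebra K ρ) (RhoInvariants K ρ π) := by
  refine ⟨fun π hπ => ?_, ⟨⟨Equiv.ofBijective _ (invariantsIdeal_bijective K ρ hT),
    continuous_invariantsIdeal K ρ, continuous_invariantsIdeal_symm K ρ hG hT⟩,
    invariantsIdeal_toClass K ρ⟩⟩
  have := mem_fellBasic_iff.1 hπ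
  exact RhoInvariants.isSimpleModule
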